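/- Let $k$ be an algebraically closed field of characteristic zero and $R=k[x_0,\dots,x_n]$. An artinian ideal $I\subset R$ generated by $r\le\binom{n+d-1}{n-1}$ forms of degree $d$ is called a *Togliatti system* if $R/I$ fails the weak Lefschetz property in degree $d-1$, i.e. for no linear form $L$ is the multiplication $\times L:(R/I)_{d-1}\to(R/I)_d$ injective or surjective (equivalently, it has not maximal rank for a general $L$). It is *monomial* if it can be generated by monomials; a monomial Togliatti system generated by monomials $m_1,\dots,m_r$ of degree $d$ is *minimal* if no proper subset of $\{m_1,\dots,m_r\}$ generates a monomial Togliatti system. A monomial Togliatti system $I$ is *smooth* if the closure $X$ of the image of the rational map given by all the monomials of degree $d$ not in $I$ is a smooth projective variety of dimension $n$. It is *trivial* if there is a nonzero form $F$ of degree $d-1$ with $x_0F,\dots,x_nF\in I$. Let $\mu(I)$ be the minimal number of generators of $I$, and let $\mu(n,d)$ (resp. $\mu^s(n,d)$) be the minimum of $\mu(I)$ over all minimal (resp. all minimal smooth) monomial Togliatti systems $I\subset k[x_0,\dots,x_n]$ of forms of degree $d$. **Theorem.** For all integers $n\ge 2$ and $d\ge 4$ we have $\mu^s(n,d)=\mu(n,d)=2n+1$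 (both minima being attained). In particular, every minimal (resp. smooth minimal) monomial Togliatti system $I\subset k[x_0,\dots,x_n]$ of forms of degree $d$ satisfies $\mu(I)\ge 2n+1$. In addition, every minimal monomial Togliatti system $I\subset k[x_0,\dots,x_n]$ of forms of degree $d\ge 4$ with $\mu(I)=2n+1$ is trivial, unless one of the following holds: (i) $(n,d)=(2,5)$ and, up to a permutation of the coordinates, $I=(x_0^5,x_1^5,x_2^5,x_0^3x_1x_2,x_0x_1^2x_2^2)$; (ii) $(n,d)=(2,4)$ and, up to a permutation of the coordinates, $I=(x_0^4,x_1^4,x_2^4,x_0x_1x_2^2,x_0^2x_1^2)$. The ideals in (i) and (ii) are indeed non-trivial minimal monomial Togliatti systems with $\mu(I)=5$; those in (i) are smooth, those in (ii) are not smooth. -/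

import Mathlib

noncomputable section

namespace Togliatti

open MvPolynomial

/-- The polynomial ring `k[x_0, ..., x_n]`. -/
abbrev PolyRing (k : Type*) [Field k] (n : ℕ) : Type _ := MvPolynomial (Fin (n + 1)) k

/-- The graded piece `(R/I)_j`: the image in `R/I` of the forms of degree `j`. -/
def gradedPiece {k : Type*} [Field k] {n : ℕ} (I : Ideal (PolyRing k n)) (j : ℕ) :
    Submodule k (PolyRing k n ⧸ I) :=
  (homogeneousSubmodule (Fin (n + 1)) k j).map (Ideal.Quotient.mkₐ k I).toLinearMap

/-- Multiplication by `L` from `(R/I)_j` to `(R/I)_{j+1}` has maximal rank,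
i.e. it is injective or surjective. -/
def MulHasMaximalRank {k : Type*} [Field k] {n : ℕ} (I : Ideal (PolyRing k n))
    (L : PolyRing k n) (j : ℕ) : Prop :=
  Set.InjOn (fun f => Ideal.Quotient.mk I L * f) (gradedPiece I j : Set (PolyRing k n ⧸ I)) ∨
  Set.SurjOn (fun f => Ideal.Quotient.mk I L * f)
    (gradedPiece I j : Set (PolyRing k n ⧸ I)) (gradedPiece I (j + 1) : Set (PolyRing k n ⧸ I))

/-- `I` fails the weak Lefschetz property in degree `j`: multiplication by a linear form
`(R/I)_j → (R/I)_{j+1}` never has maximal rank. (Having maximal rank is a Zariski open condition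
on the linear form, so failure for the general linear form is failure for every linear form.) -/
def FailsWLPInDegree {k : Type*} [Field k] {n : ℕ} (I : Ideal (PolyRing k n)) (j : ℕ) : Prop :=
  ∀ L : PolyRing k n, L.IsHomogeneous 1 → ¬ MulHasMaximalRank I L j

/-- Togliatti systems of forms of degree `d` in `n + 1` variables: artinian ideals generated by
`r ≤ binom (n+d-1) (n-1)` forms of degree `d` which fail the weak Lefschetz property in
degree `d - 1`. -/
structure IsTogliattiSystem {k : Type*} [Field k] {n : ℕ} (d : ℕ) (I : Ideal (PolyRing k n)) :
    Prop where
  artinian : IsArtinianRing (PolyRing k n ⧸ I)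
  forms : ∃ S : Finset (PolyRing k n), (∀ F ∈ S, F.IsHomogeneous d) ∧
    S.card ≤ (n + d - 1).choose (n - 1) ∧ I = Ideal.span (S : Set (PolyRing k n))
  failsWLP : FailsWLPInDegree I (d - 1)

/-- The ideal generated by the monomials `x^m`, for `m` in a set `M` of exponent vectors. -/
def monomialIdeal (k : Type*) [Field k] {n : ℕ} (M : Set (Fin (n + 1) →₀ ℕ)) :
    Ideal (PolyRing k n) :=
  Ideal.span ((fun m => monomial m (1 : k)) '' M)

/-- Togliatti systems that can be generated by monomials. -/
def IsMonomialTogliattiSystem {k : Type*} [Field k] {n : ℕ} (d : ℕ)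
    (I : Ideal (PolyRing k n)) : Prop :=
  IsTogliattiSystem d I ∧ ∃ M : Set (Fin (n + 1) →₀ ℕ), I = monomialIdeal k M

/-- Minimal monomial Togliatti systems: `I` is generated by monomials of degree `d`, no proper
subset of which generates a monomial Togliatti system. -/
def IsMinimalMonomialTogliattiSystem {k : Type*} [Field k] {n : ℕ} (d : ℕ)
    (I : Ideal (PolyRing k n)) : Prop :=
  IsMonomialTogliattiSystem d I ∧
  ∃ M : Finset (Fin (n + 1) →₀ ℕ), (∀ m ∈ M, m.degree = d) ∧
    I = monomialIdeal k (M : Set (Fin (n + 1) →₀ ℕ)) ∧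
    ∀ M' : Finset (Fin (n + 1) →₀ ℕ), M' ⊂ M →
      ¬ IsMonomialTogliattiSystem d (monomialIdeal k (M' : Set (Fin (n + 1) →₀ ℕ)))

/-- A Togliatti system is trivial if it contains `x_0 F, ..., x_n F` for some (nonzero) form `F`
of degree `d - 1`. -/
def IsTrivial {k : Type*} [Field k] {n : ℕ} (d : ℕ) (I : Ideal (PolyRing k n)) : Prop :=
  ∃ F : PolyRing k n, F ≠ 0 ∧ F.IsHomogeneous (d - 1) ∧ ∀ i : Fin (n + 1), X i * F ∈ I

open Classical in
/-- The exponent vectors of the monomials of degree `d` that do not belong to `I`. For a monomial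
ideal `I` these monomials are a basis of the degree `d` part of the inverse system of `I`. -/
def inverseExponents {k : Type*} [Field k] {n : ℕ} (d : ℕ) (I : Ideal (PolyRing k n)) :
    Finset (Fin (n + 1) →₀ ℕ) :=
  (Finset.finsuppAntidiag Finset.univ d).filter (fun a => monomial a (1 : k) ∉ I)

/-- The map `k^{n+1} → k^A`, `t ↦ (t^a)_{a ∈ A}`, given by the monomials with exponents in `A`. -/
def monomialMap (k : Type*) [Field k] {n : ℕ} (A : Finset (Fin (n + 1) →₀ ℕ))
    (t : Fin (n + 1) → k) : A → k :=
  fun a => ∏ i, t i ^ (a : Fin (n + 1) →₀ ℕ) i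

/-- The ideal of all polynomials vanishing on the image of `monomialMap`. Over an algebraically
closed field, if all exponents in `A` have the same degree `d > 0`, it is the homogeneous ideal of
the projective variety `X ⊆ ℙ(k^A)` that is the closure of the image of the rational map
`ℙ^n ⇢ ℙ(k^A)` given by the monomials with exponents in `A`. -/
def toricIdeal (k : Type*) [Field k] {n : ℕ} (A : Finset (Fin (n + 1) →₀ ℕ)) :
    Ideal (MvPolynomial A k) :=
  vanishingIdeal k (Set.range (monomialMap k A))

/-- The tangent space at `c` to the affine cone over `X`: the kernel at `c` of the differentials
of all equations of `X`. Its projectivization is the projective tangent space to `X` at `[c]`. -/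
def coneTangentSpace (k : Type*) [Field k] {n : ℕ} (A : Finset (Fin (n + 1) →₀ ℕ)) (c : A → k) :
    Submodule k (A → k) where
  carrier := {v | ∀ f ∈ toricIdeal k A, ∑ a, eval c (pderiv a f) * v a = 0}
  zero_mem' := by intro f _; simp
  add_mem' := by
    intro v w hv hw f hf
    simp only [Pi.add_apply, mul_add, Finset.sum_add_distrib, hv f hf, hw f hf, add_zero]
  smul_mem' := by
    intro r v hv f hf
    simp only [Pi.smul_apply, smul_eq_mul, mul_left_comm _ r, ← Finset.mul_sum, hv f hf, mul_zero]

/-- The projective variety `X`, the closure of the image of the rational map given by the degree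
`d` part of the inverse system of `I`, is smooth of dimension `n`: at each of its points `[c]` the
projective tangent space has dimension `n`, so that the tangent space to the affine cone at `c` has
dimension `n + 1` (Jacobian criterion; at a general point of `X` this dimension is `dim X + 1`, so
that the condition contains `dim X = n`). -/
def IsSmoothSystem {k : Type*} [Field k] {n : ℕ} (d : ℕ) (I : Ideal (PolyRing k n)) : Prop :=
  ∀ c ∈ zeroLocus k (toricIdeal k (inverseExponents d I)), c ≠ 0 →
    Module.finrank k (coneTangentSpace k (inverseExponents d I) c) = n + 1

/-- The set of all minimal monomial Togliatti systems of forms of degree `d` in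
`k[x_0, ..., x_n]`. -/
def minimalSystems (k : Type*) [Field k] (n d : ℕ) : Set (Ideal (PolyRing k n)) :=
  {I | IsMinimalMonomialTogliattiSystem d I}

/-- The set of all minimal smooth monomial Togliatti systems of forms of degree `d` in
`k[x_0, ..., x_n]`. -/
def minimalSmoothSystems (k : Type*) [Field k] (n d : ℕ) : Set (Ideal (PolyRing k n)) :=
  {I | IsMinimalMonomialTogliattiSystem d I ∧ IsSmoothSystem d I}

/-- The minimal number of generators of an ideal. -/
def numGens {k : Type*} [Field k] {n : ℕ} (I : Ideal (PolyRing k n)) : ℕ :=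
  Submodule.spanFinrank I

/-- The ideal `(x_0^5, x_1^5, x_2^5, x_0^3 x_1 x_2, x_0 x_1^2 x_2^2)`. -/
def quinticSystem (k : Type*) [Field k] : Ideal (PolyRing k 2) :=
  Ideal.span {X 0 ^ 5, X 1 ^ 5, X 2 ^ 5, X 0 ^ 3 * X 1 * X 2, X 0 * X 1 ^ 2 * X 2 ^ 2}

/-- The ideal `(x_0^4, x_1^4, x_2^4, x_0 x_1 x_2^2, x_0^2 x_1^2)`. -/
def quarticSystem (k : Type*) [Field k] : Ideal (PolyRing k 2) :=
  Ideal.span {X 0 ^ 4, X 1 ^ 4, X 2 ^ 4, X 0 * X 1 * X 2 ^ 2, X 0 ^ 2 * X 1 ^ 2}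

/-- `I` is obtained from the ideal `J` of `k[x_0, x_1, x_2]` by a bijective renaming of the
variables. For `n = 2` this says that `I` and `J` agree up to a permutation of the coordinates;
for `n ≠ 2` it is impossible. -/
def IsPermutationOf {k : Type*} [Field k] {n : ℕ} (J : Ideal (PolyRing k 2))
    (I : Ideal (PolyRing k n)) : Prop :=
  ∃ e : Fin 3 ≃ Fin (n + 1), I = J.map (rename (R := k) e)

end Togliatti

end

/-!
Write `L = ∑ x_i`. If a Togliatti system is generated by the monomials of degree `d` with exponents
in `M`, then multiplication by `L` fails to be injective: there is a form `F ≠ 0` of degree `d - 1`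
such that all terms of `L F` have exponents in `M`. Moreover `M` contains the `n + 1` pure powers as
the ideal is artinian (`exists_form_of_isTogliattiSystem`). Conversely, such forms for all linear
forms suffice (`isTogliattiSystem_of_forall_exists`), the bound on the number of generators
excluding surjectivity. Hence the lower bound `2 n + 1` says that `L F` has at least `n` terms besides pure
powers (`le_card_mixed_univ`). It comes from restricting `L F` to points with coordinate sum zero on
edges and triangles of the simplex of variables: on an edge with only one pure power there is a
further term (`exists_mem_mixed_pair`), and if the pure power of `x_i` occurs there is a further
term close to each edge at `i` of each triangle (`exists_mem_mixed_triple`). Since `d ≥ 4`, a single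
monomial cannot be close to all three edges of a triangle. Variables are then removed by induction,
one at a time, each contained in two further terms (`card_le_card_mixed`).

If there are exactly `n` further terms, either only one pure power `x_i ^ d` occurs, and the further
terms are the `x_i ^ (d - 1) x_l` (`mem_mixed_of_card_eq`), so that the system is trivial; or
`n = 2`. In the latter case two pure powers are impossible (`not_exactly_two_pure`), and if there are
three, one of the two further terms is close to two edges of the triangle, the other one to the
third; comparison of coefficients in one variable (`exceptional_of_close`) leaves the two
exceptional systems. As the lower bound holds for all monomial Togliatti systems, those with
`2 n + 1` generators are automatically minimal (`mem_minimalSystems`).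

Tangent vectors to the toric variety are points of its cone over the dual numbers
(`mem_coneTangentSpace_iff`). For the trivial and the quintic systems, the exponents not in `I`
fill a simplex truncated at its vertices, except possibly for some holes: each point lies in a chart
at a vertex (`exists_vertex_ne_zero`), which is an affine space
(`finrank_coneTangentSpace_of_chart`, `finrank_coneTangentSpace_of_truncated`). For the quartic
system, the hole at `x_0 ^ 2 x_1 ^ 2` produces four independent tangent vectors to the cone of a
surface at a coordinate point (`not_isSmoothSystem_quarticExponents`).
-/

namespace Togliatti

open MvPolynomial

variable {k : Type*} [Field k] {n : ℕ}

/-! ### Ideals generated by monomials of one degree -/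

theorem mem_monomialIdeal {M : Set (Fin (n + 1) →₀ ℕ)} {p : PolyRing k n} :
    p ∈ monomialIdeal k M ↔ ∀ a ∈ p.support, ∃ m ∈ M, m ≤ a :=
  mem_ideal_span_monomial_image

theorem eq_of_le_of_degree_eq {a b : Fin (n + 1) →₀ ℕ} (h : a ≤ b) (hd : a.degree = b.degree) :
    a = b := by
  obtain ⟨c, rfl⟩ := le_iff_exists_add.1 h
  have : c.degree = 0 := by
    rw [map_add] at hd
    omega
  rw [(Finsupp.degree_eq_zero_iff c).1 this, add_zero]

theorem degree_mono {a b : Fin (n + 1) →₀ ℕ} (h : a ≤ b) : a.degree ≤ b.degree := by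
  obtain ⟨c, rfl⟩ := le_iff_exists_add.1 h
  rw [map_add]
  omega

theorem mem_monomialIdeal_of_isHomogeneous {M : Set (Fin (n + 1) →₀ ℕ)} {d : ℕ}
    (hM : ∀ m ∈ M, m.degree = d) {p : PolyRing k n} (hp : p.IsHomogeneous d) :
    p ∈ monomialIdeal k M ↔ ∀ a, coeff a p ≠ 0 → a ∈ M := by
  rw [mem_monomialIdeal]
  refine forall_congr' fun a => ?_
  rw [mem_support_iff]
  refine imp_congr_right fun ha => ⟨?_, fun h => ⟨a, h, le_rfl⟩⟩
  rintro ⟨m, hm, hma⟩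
  have hd : a.degree = d := by
    by_contra h
    exact ha (hp.coeff_eq_zero h)
  rwa [← eq_of_le_of_degree_eq hma ((hM m hm).trans hd.symm)]

theorem monomial_mem_monomialIdeal {M : Set (Fin (n + 1) →₀ ℕ)} {d : ℕ}
    (hM : ∀ m ∈ M, m.degree = d) {a : Fin (n + 1) →₀ ℕ} (ha : a.degree = d) :
    monomial a (1 : k) ∈ monomialIdeal k M ↔ a ∈ M := by
  classical
  rw [mem_monomialIdeal_of_isHomogeneous hM (isHomogeneous_monomial 1 ha)]
  simp [coeff_monomial]

theorem eq_zero_of_mem_monomialIdeal {M : Set (Fin (n + 1) →₀ ℕ)} {d e : ℕ}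
    (hM : ∀ m ∈ M, m.degree = d) (hed : e < d) {p : PolyRing k n} (hp : p.IsHomogeneous e)
    (h : p ∈ monomialIdeal k M) : p = 0 := by
  rw [mem_monomialIdeal] at h
  by_contra h0
  obtain ⟨a, ha⟩ := ne_zero_iff.1 h0
  obtain ⟨m, hm, hma⟩ := h a (mem_support_iff.2 ha)
  have hd : a.degree = e := by
    by_contra h
    exact ha (hp.coeff_eq_zero h)
  have := degree_mono hma
  rw [hM m hm] at this
  omega

/-- In an artinian quotient by a monomial ideal some power of each variable vanishes, so a
minimal generator is a pure power of that variable. -/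
theorem single_mem_of_isArtinianRing {M : Set (Fin (n + 1) →₀ ℕ)} {d : ℕ}
    (hM : ∀ m ∈ M, m.degree = d)
    (h : IsArtinianRing (PolyRing k n ⧸ monomialIdeal k M)) (i : Fin (n + 1)) :
    Finsupp.single i d ∈ M := by
  classical
  obtain ⟨N, y, hy⟩ := IsArtinian.exists_pow_succ_smul_dvd
    (Ideal.Quotient.mk (monomialIdeal k M) (X i)) (1 : PolyRing k n ⧸ monomialIdeal k M)
  obtain ⟨g, rfl⟩ := Ideal.Quotient.mk_surjective y
  simp only [smul_eq_mul, mul_one, ← map_pow, ← map_mul] at hy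
  rw [Ideal.Quotient.eq, mem_monomialIdeal] at hy
  -- the pure power `X i ^ N` survives in `X i ^ (N + 1) * g - X i ^ N`
  obtain ⟨m, hm, hle⟩ := hy (Finsupp.single i N) (by
    rw [mem_support_iff, coeff_sub, X_pow_eq_monomial, X_pow_eq_monomial, coeff_monomial_mul',
      coeff_monomial, if_pos rfl, if_neg]
    · simp
    · intro h
      have := h i
      simp at this)
  have hs : m = Finsupp.single i (m i) := by
    ext j
    by_cases hj : i = j
    · subst hj; simp
    · have := hle j
      rw [Finsupp.single_eq_of_ne (Ne.symm hj)] at this ⊢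
      omega
  have hd := hM m hm
  rw [hs, Finsupp.degree_single] at hd
  rw [hs, hd] at hm
  exact hm

theorem isArtinianRing_of_single_mem {M : Set (Fin (n + 1) →₀ ℕ)} {d : ℕ}
    (h : ∀ i, Finsupp.single i d ∈ M) :
    IsArtinianRing (PolyRing k n ⧸ monomialIdeal k M) := by
  have hint : ∀ i, IsIntegral k (Ideal.Quotient.mkₐ k (monomialIdeal k M) (X i)) := by
    intro i
    refine ⟨Polynomial.X ^ d, Polynomial.monic_X_pow d, ?_⟩
    have : (Ideal.Quotient.mkₐ k (monomialIdeal k M) (X i)) ^ d = 0 := by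
      rw [← map_pow, X_pow_eq_monomial]
      exact Ideal.Quotient.eq_zero_iff_mem.2 (Ideal.subset_span ⟨_, h i, rfl⟩)
    simpa using this
  have htop : Algebra.adjoin k (Set.range fun i =>
      Ideal.Quotient.mkₐ k (monomialIdeal k M) (X i)) = ⊤ := by
    have := congrArg (Subalgebra.map (Ideal.Quotient.mkₐ k (monomialIdeal k M)))
      (adjoin_range_X (R := k) (σ := Fin (n + 1)))
    rw [AlgHom.map_adjoin, Algebra.map_top, ← Set.range_comp,
      (AlgHom.range_eq_top _).2 (Ideal.Quotient.mkₐ_surjective k _)] at this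
    exact this
  have hI : Algebra.IsIntegral k (PolyRing k n ⧸ monomialIdeal k M) := by
    rw [← integralClosure_eq_top_iff, eq_top_iff, ← htop]
    refine Algebra.adjoin_le ?_
    rintro _ ⟨i, rfl⟩
    exact hint i
  have : Module.Finite k (PolyRing k n ⧸ monomialIdeal k M) := Algebra.IsIntegral.finite
  exact IsArtinianRing.of_finite k _

/-- The minimal number of generators of an ideal generated by monomials of one degree is the
number of these monomials: modulo the higher degrees, any generating set spans their span. -/
theorem numGens_monomialIdeal {M : Finset (Fin (n + 1) →₀ ℕ)} {d : ℕ}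
    (hM : ∀ m ∈ M, m.degree = d) :
    numGens (monomialIdeal k (M : Set (Fin (n + 1) →₀ ℕ))) = M.card := by
  classical
  set I := monomialIdeal k (M : Set (Fin (n + 1) →₀ ℕ)) with hI
  apply le_antisymm
  · have hfin : ((fun m => monomial m (1 : k)) '' (M : Set (Fin (n + 1) →₀ ℕ))).Finite :=
      M.finite_toSet.image _
    calc numGens I ≤ _ := Submodule.spanFinrank_span_le_ncard_of_finite hfin
      _ ≤ (M : Set (Fin (n + 1) →₀ ℕ)).ncard := Set.ncard_image_le M.finite_toSet
      _ = M.card := Set.ncard_coe_finset M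
  · have hfg : I.FG := ⟨M.image (fun m => monomial m (1 : k)), by rw [Finset.coe_image]; rfl⟩
    obtain ⟨S, hcard, hspan⟩ := Submodule.FG.exists_span_finset_card_eq_spanFinrank hfg
    have hcard' : S.card = numGens I := hcard
    rw [← hcard']
    have horder : ∀ s ∈ I, ∀ a : Fin (n + 1) →₀ ℕ, a.degree < d → coeff a s = 0 := by
      intro s hs a ha
      by_contra h0
      obtain ⟨m, hm, hma⟩ := mem_monomialIdeal.1 hs a (mem_support_iff.2 h0)
      have := degree_mono hma
      rw [hM m hm] at this
      omega
    have hSI : ∀ s ∈ S, s ∈ I := fun s hs => by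
      rw [← hspan]; exact Submodule.subset_span hs
    let π : PolyRing k n →ₗ[k] (M → k) := LinearMap.pi fun m => lcoeff k (m : Fin (n + 1) →₀ ℕ)
    have hπ : ∀ p m, π p m = coeff (m : Fin (n + 1) →₀ ℕ) p := fun p m => rfl
    have hmul : ∀ (r : PolyRing k n) (s : PolyRing k n), s ∈ I →
        π (r * s) = coeff 0 r • π s := by
      intro r s hs
      funext m
      rw [Pi.smul_apply, hπ, hπ, coeff_mul, smul_eq_mul]
      rw [Finset.sum_eq_single (0, (m : Fin (n + 1) →₀ ℕ))]
      · rintro ⟨a, b⟩ hab hne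
        have hab' : a + b = m := by simpa using hab
        have hd : a.degree + b.degree = d := by rw [← map_add, hab', hM m m.2]
        have ha : a.degree ≠ 0 := by
          intro h0
          rw [Finsupp.degree_eq_zero_iff] at h0
          subst h0
          rw [zero_add] at hab'
          subst hab'
          exact hne rfl
        simp only
        rw [horder s hs b (by omega), mul_zero]
      · intro h
        simp at h
    have htop : Submodule.span k ((S.image π : Finset (M → k)) : Set (M → k)) = ⊤ := by
      rw [eq_top_iff]
      have key : ∀ p ∈ I, π p ∈ Submodule.span k ((S.image π : Finset (M → k)) : Set (M → k)) := by
        intro p hp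
        rw [← hspan] at hp
        induction hp using Submodule.span_induction with
        | mem x hx =>
          exact Submodule.subset_span (by
            rw [Finset.coe_image]
            exact ⟨x, hx, rfl⟩)
        | zero => simp
        | add x y _ _ hx hy => rw [map_add]; exact Submodule.add_mem _ hx hy
        | smul r x hx h =>
          rw [smul_eq_mul, hmul r x (by rw [← hspan]; exact hx)]
          exact Submodule.smul_mem _ _ h
      intro v _
      have hv : v = π (∑ m : M, monomial (m : Fin (n + 1) →₀ ℕ) (v m)) := by
        funext m
        rw [hπ, coeff_sum, Finset.sum_eq_single m]
        · simp
        · intro b _ hb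
          rw [coeff_monomial, if_neg]
          exact fun h => hb (Subtype.ext h)
        · simp
      rw [hv]
      refine key _ (Ideal.sum_mem _ fun m _ => ?_)
      have : monomial (m : Fin (n + 1) →₀ ℕ) (v m) =
          C (v m) * monomial (m : Fin (n + 1) →₀ ℕ) 1 := by
        rw [C_mul_monomial, mul_one]
      rw [this]
      exact Ideal.mul_mem_left _ _ (Ideal.subset_span ⟨_, m.2, rfl⟩)
    calc M.card = Module.finrank k (M → k) := by simp
      _ = Module.finrank k (⊤ : Submodule k (M → k)) := finrank_top k (M → k) |>.symm
      _ = Module.finrank k (Submodule.span k ((S.image π : Finset (M → k)) : Set (M → k))) := by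
          rw [htop]
      _ ≤ (S.image π).card := finrank_span_finset_le_card _
      _ ≤ S.card := Finset.card_image_le

theorem finrank_homogeneousSubmodule (e : ℕ) :
    Module.finrank k (homogeneousSubmodule (Fin (n + 1)) k e) = (n + e).choose e := by
  classical
  have hspan : homogeneousSubmodule (Fin (n + 1)) k e = Submodule.span k (Set.range
      fun m : Finset.finsuppAntidiag (Finset.univ : Finset (Fin (n + 1))) e =>
        monomial (m : Fin (n + 1) →₀ ℕ) (1 : k)) := by
    apply le_antisymm
    · intro p hp
      rw [p.as_sum]
      refine Submodule.sum_mem _ fun a ha => ?_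
      have : monomial a (coeff a p) = coeff a p • monomial a (1 : k) := by
        rw [smul_monomial, smul_eq_mul, mul_one]
      rw [this]
      refine Submodule.smul_mem _ _ (Submodule.subset_span ⟨⟨a, ?_⟩, rfl⟩)
      have hd : a.degree = e := by
        by_contra h
        exact (mem_support_iff.1 ha) (IsHomogeneous.coeff_eq_zero hp h)
      rw [Finset.mem_finsuppAntidiag]
      refine ⟨?_, Finset.subset_univ _⟩
      rw [← hd, Finsupp.degree_eq_sum]
    · rw [Submodule.span_le]
      rintro _ ⟨m, rfl⟩
      have := (Finset.mem_finsuppAntidiag.1 m.2).1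
      exact isHomogeneous_monomial 1 (by rw [Finsupp.degree_eq_sum]; exact this)
  rw [hspan, finrank_span_eq_card, Fintype.card_coe, Finset.card_finsuppAntidiag_nat_eq_choose]
  · simp only [Finset.card_univ, Fintype.card_fin]
    congr 1
    omega
  · have := (basisMonomials (Fin (n + 1)) k).linearIndependent
    exact this.comp (fun m : Finset.finsuppAntidiag (Finset.univ : Finset (Fin (n + 1))) e =>
      (m : Fin (n + 1) →₀ ℕ)) Subtype.val_injective

/-! ### The sum of the variables and the weak Lefschetz property -/

/-- The sum of the variables: for monomial ideals the general linear form can be replaced by it. -/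
noncomputable def varSum (k : Type*) [Field k] (n : ℕ) : PolyRing k n := ∑ i, X i

theorem isHomogeneous_varSum : (varSum k n).IsHomogeneous 1 :=
  IsHomogeneous.sum _ _ _ fun i _ => isHomogeneous_X k i

theorem mem_gradedPiece {I : Ideal (PolyRing k n)} {j : ℕ} {f : PolyRing k n ⧸ I} :
    f ∈ gradedPiece I j ↔ ∃ F : PolyRing k n, F.IsHomogeneous j ∧ Ideal.Quotient.mk I F = f :=
  Iff.rfl

theorem exists_form_of_failsWLP {I : Ideal (PolyRing k n)} {j : ℕ} (h : FailsWLPInDegree I j) :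
    ∃ F : PolyRing k n, F ≠ 0 ∧ F.IsHomogeneous j ∧ varSum k n * F ∈ I := by
  have h1 := h (varSum k n) isHomogeneous_varSum
  rw [MulHasMaximalRank, not_or] at h1
  have h2 := h1.1
  simp only [Set.InjOn, not_forall] at h2
  obtain ⟨x, hx, y, hy, hxy, hne⟩ := h2
  obtain ⟨F, hF, rfl⟩ := mem_gradedPiece.1 hx
  obtain ⟨G, hG, rfl⟩ := mem_gradedPiece.1 hy
  refine ⟨F - G, ?_, hF.sub hG, ?_⟩
  · rintro h0
    exact hne (by rw [sub_eq_zero.1 h0])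
  · rw [mul_sub, ← Ideal.Quotient.eq, map_mul, map_mul]
    exact hxy

/-- A criterion for Togliatti systems. Since the number of generators is at most
`dim R_d - dim R_{d-1}`, a multiplication map which is not injective is not surjective either. -/
theorem isTogliattiSystem_of_forall_exists {M : Finset (Fin (n + 1) →₀ ℕ)} {d : ℕ}
    (hn : 1 ≤ n) (hd : 1 ≤ d)
    (hM : ∀ m ∈ M, m.degree = d) (hpure : ∀ i, Finsupp.single i d ∈ M)
    (hcard : M.card ≤ (n + d - 1).choose (n - 1))
    (hF : ∀ L : PolyRing k n, L.IsHomogeneous 1 → ∃ F : PolyRing k n, F ≠ 0 ∧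
      F.IsHomogeneous (d - 1) ∧ L * F ∈ monomialIdeal k (M : Set (Fin (n + 1) →₀ ℕ))) :
    IsTogliattiSystem d (monomialIdeal k (M : Set (Fin (n + 1) →₀ ℕ))) := by
  classical
  have hM' : ∀ m ∈ (M : Set (Fin (n + 1) →₀ ℕ)), m.degree = d := fun m hm => hM m hm
  refine ⟨isArtinianRing_of_single_mem (M := (M : Set (Fin (n + 1) →₀ ℕ))) hpure,
    ⟨M.image fun m => monomial m 1, ?_, Finset.card_image_le.trans hcard, ?_⟩, ?_⟩
  · intro F hF
    obtain ⟨m, hm, rfl⟩ := Finset.mem_image.1 hF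
    exact isHomogeneous_monomial 1 (hM m hm)
  · rw [Finset.coe_image]; rfl
  intro L hL
  obtain ⟨F, hF0, hFd, hLF⟩ := hF L hL
  rw [MulHasMaximalRank, not_or]
  constructor
  · intro hinj
    have h0 : (0 : PolyRing k n ⧸ monomialIdeal k (M : Set (Fin (n + 1) →₀ ℕ))) ∈
        gradedPiece _ (d - 1) := Submodule.zero_mem _
    have h1 := hinj (mem_gradedPiece.2 ⟨F, hFd, rfl⟩) h0 (by
      simp only [mul_zero, ← map_mul]
      exact Ideal.Quotient.eq_zero_iff_mem.2 hLF)
    exact hF0 (eq_zero_of_mem_monomialIdeal hM' (by omega) hFd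
      (Ideal.Quotient.eq_zero_iff_mem.1 h1))
  · intro hsurj
    rw [show d - 1 + 1 = d by omega] at hsurj
    -- the map `(f, c) ↦ L f + ∑ c_m x^m` maps onto the forms of degree `d`
    let V := homogeneousSubmodule (Fin (n + 1)) k (d - 1)
    let S : (M → k) →ₗ[k] PolyRing k n := Fintype.linearCombination k fun m : M =>
      monomial (m : Fin (n + 1) →₀ ℕ) (1 : k)
    have hS : ∀ p : PolyRing k n, p.IsHomogeneous d →
        p ∈ monomialIdeal k (M : Set (Fin (n + 1) →₀ ℕ)) → ∃ c, S c = p := by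
      intro p hp hpI
      rw [mem_monomialIdeal_of_isHomogeneous hM' hp] at hpI
      refine ⟨fun m => coeff m p, ?_⟩
      ext a
      rw [Fintype.linearCombination_apply, coeff_sum]
      simp only [coeff_smul, coeff_monomial, smul_eq_mul, mul_ite, mul_one, mul_zero]
      by_cases ha : a ∈ M
      · rw [Finset.sum_eq_single ⟨a, ha⟩]
        · simp
        · intro b _ hb
          exact if_neg fun h => hb (Subtype.ext h)
        · simp
      · rw [Finset.sum_eq_zero]
        · by_contra h
          exact ha (hpI a (Ne.symm h))
        · intro b _
          exact if_neg fun h : (b : Fin (n + 1) →₀ ℕ) = a => ha (h ▸ b.2)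
    let T : V × (M → k) →ₗ[k] PolyRing k n :=
      LinearMap.coprod ((LinearMap.mulLeft k L).comp V.subtype) S
    have hfinV : FiniteDimensional k V :=
      Module.Finite.iff_fg.2 (homogeneousSubmodule_fg (Fin (n + 1)) k (d - 1))
    have hle : homogeneousSubmodule (Fin (n + 1)) k d ≤ LinearMap.range T := by
      intro g hg
      obtain ⟨x, hx, hxg⟩ := hsurj (mem_gradedPiece.2 ⟨g, hg, rfl⟩)
      obtain ⟨f, hf, rfl⟩ := mem_gradedPiece.1 hx
      simp only [← map_mul] at hxg
      have hmem := Ideal.Quotient.eq.1 hxg.symm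
      have hLf : (L * f).IsHomogeneous d := by
        have := hL.mul hf
        rwa [show 1 + (d - 1) = d by omega] at this
      obtain ⟨c, hc⟩ := hS (g - L * f) (IsHomogeneous.sub hg hLf) hmem
      refine ⟨(⟨f, hf⟩, c), ?_⟩
      simp only [T, LinearMap.coprod_apply, LinearMap.comp_apply, hc]
      simp
    obtain ⟨c, hc⟩ := hS (L * F) (by
      have := hL.mul hFd
      rwa [show 1 + (d - 1) = d by omega] at this) hLF
    have hker : LinearMap.ker T ≠ ⊥ := by
      intro h
      have : ((⟨F, hFd⟩, -c) : V × (M → k)) ∈ LinearMap.ker T := by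
        rw [LinearMap.mem_ker]
        simp only [T, LinearMap.coprod_apply, LinearMap.comp_apply, map_neg, hc]
        simp
      rw [h, Submodule.mem_bot] at this
      exact hF0 (congrArg (fun z : V × (M → k) => (z.1 : PolyRing k n)) this)
    have hkpos : 0 < Module.finrank k (LinearMap.ker T) := by
      exact Submodule.one_le_finrank_iff.2 hker
    have hrn : Module.finrank k (LinearMap.range T) + Module.finrank k (LinearMap.ker T) =
      Module.finrank k (V × (M → k)) := LinearMap.finrank_range_add_finrank_ker T
    have hmono : _ ≤ Module.finrank k (LinearMap.range T) := Submodule.finrank_mono hle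
    rw [finrank_homogeneousSubmodule] at hmono
    rw [Module.finrank_prod, show Module.finrank k V = _ from finrank_homogeneousSubmodule (d - 1),
      Module.finrank_fintype_fun_eq_card, Fintype.card_coe] at hrn
    obtain ⟨e, rfl⟩ : ∃ e, d = e + 1 := ⟨d - 1, by omega⟩
    have hp : (n + (e + 1)).choose (e + 1) = (n + e).choose e + (n + e).choose (e + 1) := by
      rw [← add_assoc, Nat.choose_succ_succ]
    have hs : (n + (e + 1) - 1).choose (n - 1) = (n + e).choose (e + 1) := by
      rw [show n + (e + 1) - 1 = n + e by omega]
      exact Nat.choose_symm_of_eq_add (by omega)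
    simp only [Nat.add_sub_cancel] at hrn
    omega

/-! ### Terms of multiples of the sum of the variables -/

theorem prod_pow_eq_zero {R : Type*} [CommSemiring R] {W : Finset (Fin (n + 1))}
    {φ : Fin (n + 1) → R} (hφ : ∀ i, i ∉ W → φ i = 0) {m : Fin (n + 1) →₀ ℕ}
    (hm : ¬ m.support ⊆ W) : ∏ i, φ i ^ m i = 0 := by
  obtain ⟨i, hi, hiW⟩ := Finset.not_subset.1 hm
  refine Finset.prod_eq_zero (Finset.mem_univ i) ?_
  rw [hφ i hiW, zero_pow (Finsupp.mem_support_iff.1 hi)]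

/-- A multiple of the sum of the variables vanishes at every point with coordinate sum zero. -/
theorem sum_coeff_mul_prod_eq_zero {R : Type*} [CommRing R] [Algebra k R] (F : PolyRing k n)
    (φ : Fin (n + 1) → R) (hφ : ∑ i, φ i = 0) :
    ∑ m ∈ (varSum k n * F).support,
      algebraMap k R (coeff m (varSum k n * F)) * ∏ i, φ i ^ m i = 0 := by
  have h : aeval φ (varSum k n * F) = 0 := by
    rw [map_mul, varSum, map_sum]
    simp only [aeval_X, hφ, zero_mul]
  rwa [aeval_def, eval₂_eq'] at h

/-- The exponents of `G` which are supported on `W` and are not the `d`-th power of a variable. -/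
noncomputable def mixed (d : ℕ) (G : PolyRing k n) (W : Finset (Fin (n + 1))) :
    Finset (Fin (n + 1) →₀ ℕ) := by
  classical
  exact G.support.filter fun m => m.support ⊆ W ∧ ∀ i, m ≠ Finsupp.single i d

theorem mem_mixed {d : ℕ} {G : PolyRing k n} {W : Finset (Fin (n + 1))}
    {m : Fin (n + 1) →₀ ℕ} :
    m ∈ mixed d G W ↔ coeff m G ≠ 0 ∧ m.support ⊆ W ∧ ∀ i, m ≠ Finsupp.single i d := by
  classical
  rw [mixed, Finset.mem_filter, mem_support_iff]

theorem mixed_mono {d : ℕ} {G : PolyRing k n} {W W' : Finset (Fin (n + 1))} (h : W ⊆ W') :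
    mixed d G W ⊆ mixed d G W' := fun m hm => by
  rw [mem_mixed] at hm ⊢
  exact ⟨hm.1, hm.2.1.trans h, hm.2.2⟩

theorem eq_single_of_support_subset {m : Fin (n + 1) →₀ ℕ} {i : Fin (n + 1)}
    (h : m.support ⊆ {i}) : m = Finsupp.single i m.degree := by
  obtain ⟨c, rfl⟩ : ∃ c, m = Finsupp.single i c := by
    exact ⟨m i, (Finsupp.support_subset_singleton.1 h)⟩
  rw [Finsupp.degree_single]

theorem one_lt_card_support_of_mem_mixed {d : ℕ} {G : PolyRing k n} (hG : G.IsHomogeneous d)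
    {W : Finset (Fin (n + 1))} {m : Fin (n + 1) →₀ ℕ} (hm : m ∈ mixed d G W) :
    1 < m.support.card := by
  rw [mem_mixed] at hm
  have hd : m.degree = d := by
    by_contra h
    exact hm.1 (hG.coeff_eq_zero h)
  by_contra h
  obtain ⟨i, hi⟩ : ∃ i, m.support ⊆ {i} :=
    Finset.card_le_one_iff_subset_singleton.1 (by omega)
  exact hm.2.2 i (hd ▸ eq_single_of_support_subset hi)

theorem ne_zero_of_mem_mixed_pair {d : ℕ} {G : PolyRing k n} (hG : G.IsHomogeneous d)
    {i j : Fin (n + 1)} {m : Fin (n + 1) →₀ ℕ} (hm : m ∈ mixed d G {i, j}) :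
    m i ≠ 0 ∧ m j ≠ 0 := by
  have h2 := one_lt_card_support_of_mem_mixed hG hm
  rw [mem_mixed] at hm
  have hij : m.support = {i, j} := by
    refine Finset.eq_of_subset_of_card_le hm.2.1 ?_
    exact (Finset.card_le_two).trans h2
  rw [← Finsupp.mem_support_iff, ← Finsupp.mem_support_iff, hij]
  simp

theorem apply_eq_zero_of_mem_mixed {d : ℕ} {G : PolyRing k n} {W : Finset (Fin (n + 1))}
    {m : Fin (n + 1) →₀ ℕ} (hm : m ∈ mixed d G W) {x : Fin (n + 1)} (hx : x ∉ W) : m x = 0 := by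
  rw [mem_mixed] at hm
  rw [← Finsupp.notMem_support_iff]
  exact fun h => hx (hm.2.1 h)

/-- On the edge from a vertex at which `(∑ x_i) F` has a term to a vertex at which it has none there
is a further term. -/
theorem exists_mem_mixed_pair {d : ℕ} {F : PolyRing k n}
    {i j : Fin (n + 1)} (hij : i ≠ j) (hi : coeff (Finsupp.single i d) (varSum k n * F) ≠ 0)
    (hj : coeff (Finsupp.single j d) (varSum k n * F) = 0) :
    ∃ m, m ∈ mixed d (varSum k n * F) {i, j} := by
  classical
  by_contra hno
  push Not at hno
  set φ : Fin (n + 1) → k := fun x => if x = i then 1 else if x = j then -1 else 0 with hφ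
  have hφ0 : ∀ x, x ∉ ({i, j} : Finset (Fin (n + 1))) → φ x = 0 := by
    intro x hx
    simp only [Finset.mem_insert, Finset.mem_singleton, not_or] at hx
    simp [hφ, hx.1, hx.2]
  have hsum : ∑ x, φ x = 0 := by
    rw [← Finset.sum_subset (Finset.subset_univ {i, j}) (fun x _ hx => hφ0 x hx),
      Finset.sum_pair hij]
    simp [hφ, Ne.symm hij]
  have h := sum_coeff_mul_prod_eq_zero F φ hsum
  rw [Finset.sum_eq_single (Finsupp.single i d)] at h
  · refine hi ?_
    rw [Finset.prod_eq_single i] at h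
    · simpa [hφ] using h
    · intro b _ hb
      rw [Finsupp.single_eq_of_ne hb, pow_zero]
    · simp
  · intro b hb hbi
    by_cases hW : b.support ⊆ {i, j}
    · have hb' := hno b
      rw [mem_mixed] at hb'
      rw [mem_support_iff] at hb
      by_cases hp : ∀ x, b ≠ Finsupp.single x d
      · exact absurd ⟨hb, hW, hp⟩ hb'
      · push Not at hp
        obtain ⟨x, rfl⟩ := hp
        by_cases hd : d = 0
        · subst hd
          simp at hbi
        · have hx : x ∈ ({i, j} : Finset (Fin (n + 1))) := by
            apply hW
            simp [hd]
          simp only [Finset.mem_insert, Finset.mem_singleton] at hx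
          rcases hx with rfl | rfl
          · exact absurd rfl hbi
          · exact absurd hj hb
    · rw [prod_pow_eq_zero hφ0 hW, mul_zero]
  · intro hns
    rw [notMem_support_iff] at hns
    exact absurd hns hi

/-- The substitution `x_i = A`, `x_j = B`, `x_l = C`, all other variables being zero. -/
noncomputable def facePoint (i j l : Fin (n + 1)) {R : Type*} [Zero R] (A B C : R) :
    Fin (n + 1) → R :=
  fun x => if x = i then A else if x = j then B else if x = l then C else 0

theorem facePoint_eq_zero {i j l : Fin (n + 1)} {R : Type*} [Zero R] (A B C : R) (x : Fin (n + 1))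
    (hx : x ∉ ({i, j, l} : Finset (Fin (n + 1)))) : facePoint i j l A B C x = 0 := by
  simp only [Finset.mem_insert, Finset.mem_singleton, not_or] at hx
  simp [facePoint, hx.1, hx.2.1, hx.2.2]

theorem sum_triple {i j l : Fin (n + 1)} (hij : i ≠ j) (hil : i ≠ l) (hjl : j ≠ l)
    {R : Type*} [AddCommMonoid R] {f : Fin (n + 1) → R}
    (hf : ∀ x, x ∉ ({i, j, l} : Finset (Fin (n + 1))) → f x = 0) :
    ∑ x, f x = f i + f j + f l := by
  rw [← Finset.sum_subset (Finset.subset_univ {i, j, l}) (fun x _ hx => hf x hx),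
    Finset.sum_insert (by simp [hij, hil]), Finset.sum_pair hjl, add_assoc]

theorem sum_facePoint {i j l : Fin (n + 1)} (hij : i ≠ j) (hil : i ≠ l) (hjl : j ≠ l)
    {R : Type*} [AddCommMonoid R] (A B C : R) :
    ∑ x, facePoint i j l A B C x = A + B + C := by
  rw [sum_triple hij hil hjl (facePoint_eq_zero A B C)]
  simp [facePoint, hij.symm, hil.symm, hjl.symm]

theorem prod_facePoint {i j l : Fin (n + 1)} (hij : i ≠ j) (hil : i ≠ l) (hjl : j ≠ l)
    {R : Type*} [CommSemiring R] (A B C : R) {m : Fin (n + 1) →₀ ℕ}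
    (hm : m.support ⊆ {i, j, l}) :
    ∏ x, facePoint i j l A B C x ^ m x = A ^ m i * B ^ m j * C ^ m l := by
  rw [← Finset.prod_subset (Finset.subset_univ {i, j, l}),
    Finset.prod_insert (by simp [hij, hil]), Finset.prod_pair hjl, ← mul_assoc]
  · simp [facePoint, hij.symm, hil.symm, hjl.symm]
  · intro x _ hx
    have : m x = 0 := by
      rw [← Finsupp.notMem_support_iff]
      exact fun h => hx (hm h)
    rw [this, pow_zero]

theorem prod_facePoint_single {i j l : Fin (n + 1)} {R : Type*} [CommSemiring R] (A B C : R)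
    (x : Fin (n + 1)) (d : ℕ) :
    ∏ y, facePoint i j l A B C y ^ (Finsupp.single x d) y = facePoint i j l A B C x ^ d := by
  rw [Finset.prod_eq_single x]
  · rw [Finsupp.single_eq_same]
  · intro b _ hb
    rw [Finsupp.single_eq_of_ne hb, pow_zero]
  · simp

theorem coeff_one_neg_one_add_X_pow (d : ℕ) :
    ((-(1 + Polynomial.X) : Polynomial k) ^ d).coeff 1 = (-1) ^ d * d := by
  rw [neg_pow, add_comm, show ((-1 : Polynomial k) ^ d) = Polynomial.C ((-1) ^ d) by simp,
    Polynomial.coeff_C_mul, Polynomial.coeff_X_add_one_pow, Nat.choose_one_right]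

/-- If `(∑ x_i) F` has a term `x_i ^ d`, then each edge at `i` of each triangle `i, j, l` carries,
or is adjacent in the triangle to, a further term: otherwise the substitution `x_i = -(1 + t)`,
`x_j = 1`, `x_l = t` has a nonzero coefficient at `t`. -/
theorem exists_mem_mixed_triple [CharZero k] {d : ℕ} (hd : 2 ≤ d) {F : PolyRing k n}
    {i j l : Fin (n + 1)} (hij : i ≠ j) (hil : i ≠ l) (hjl : j ≠ l)
    (hi : coeff (Finsupp.single i d) (varSum k n * F) ≠ 0) :
    ∃ m ∈ mixed d (varSum k n * F) {i, j, l}, m l ≤ 1 := by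
  classical
  by_contra hno
  push Not at hno
  have h := sum_coeff_mul_prod_eq_zero F
    (facePoint i j l (-(1 + Polynomial.X)) 1 (Polynomial.X : Polynomial k))
    (by rw [sum_facePoint hij hil hjl]; ring)
  have h1 := congrArg (fun p : Polynomial k => p.coeff 1) h
  simp only [Polynomial.finsetSum_coeff, Polynomial.coeff_zero, Polynomial.algebraMap_eq,
    Polynomial.coeff_C_mul] at h1
  rw [Finset.sum_eq_single (Finsupp.single i d)] at h1
  · rw [prod_facePoint_single, facePoint, if_pos rfl, coeff_one_neg_one_add_X_pow] at h1
    have hd0 : (d : k) ≠ 0 := Nat.cast_ne_zero.2 (by omega)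
    exact mul_ne_zero hi (mul_ne_zero (pow_ne_zero _ (neg_ne_zero.2 one_ne_zero)) hd0) h1
  · intro b hb hbi
    by_cases hW : b.support ⊆ {i, j, l}
    · have hb' := hno b
      rw [mem_mixed] at hb'
      rw [mem_support_iff] at hb
      by_cases hp : ∀ x, b ≠ Finsupp.single x d
      · have h2 := hb' ⟨hb, hW, hp⟩
        rw [prod_facePoint hij hil hjl _ _ _ hW, Polynomial.coeff_mul_X_pow', if_neg (by omega),
          mul_zero]
      · push Not at hp
        obtain ⟨x, rfl⟩ := hp
        have hx : x ∈ ({i, j, l} : Finset (Fin (n + 1))) := by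
          apply hW
          simp; omega
        rw [prod_facePoint_single]
        simp only [Finset.mem_insert, Finset.mem_singleton] at hx
        rcases hx with rfl | rfl | rfl
        · exact absurd rfl hbi
        · simp [facePoint, hij.symm, Polynomial.coeff_one]
        · simp only [facePoint, hil.symm, hjl.symm, if_false, if_true, Polynomial.coeff_X_pow]
          rw [if_neg (by omega), mul_zero]
    · rw [prod_pow_eq_zero (facePoint_eq_zero _ _ _) hW, Polynomial.coeff_zero, mul_zero]
  · intro hns
    rw [notMem_support_iff] at hns
    exact absurd hns hi

theorem degree_eq_triple {i j l : Fin (n + 1)} (hij : i ≠ j) (hil : i ≠ l) (hjl : j ≠ l)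
    {m : Fin (n + 1) →₀ ℕ} (hm : m.support ⊆ {i, j, l}) : m.degree = m i + m j + m l := by
  rw [Finsupp.degree_eq_sum, sum_triple hij hil hjl]
  intro x hx
  rw [← Finsupp.notMem_support_iff]
  exact fun h => hx (hm h)

theorem IsHomogeneous.varSum_mul {d : ℕ} (hd : 1 ≤ d) {F : PolyRing k n}
    (hF : F.IsHomogeneous (d - 1)) : (varSum k n * F).IsHomogeneous d := by
  have := (isHomogeneous_varSum (k := k) (n := n)).mul hF
  rwa [show 1 + (d - 1) = d by omega] at this

/-- A nonzero multiple of the sum of the variables has at least as many terms as there are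
variables: a term of `F` of maximal degree in `x_i`, multiplied by `x_i`, cannot be cancelled. -/
theorem card_support_varSum_mul {F : PolyRing k n} (hF : F ≠ 0) :
    n + 1 ≤ (varSum k n * F).support.card := by
  classical
  have hne : F.support.Nonempty := support_nonempty.2 hF
  choose a ha hmax using fun i : Fin (n + 1) =>
    Finset.exists_max_image F.support (fun m => m i) hne
  have hmem : ∀ i, a i + Finsupp.single i 1 ∈ (varSum k n * F).support := by
    intro i
    rw [mem_support_iff, varSum, Finset.sum_mul, coeff_sum, Finset.sum_eq_single i]
    · rw [add_comm (a i), coeff_X_mul]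
      exact mem_support_iff.1 (ha i)
    · intro j _ hj
      rw [coeff_X_mul']
      split_ifs with hs
      · by_contra h0
        have := hmax i _ (mem_support_iff.2 h0)
        simp [Finsupp.single_eq_of_ne hj.symm] at this
      · rfl
    · simp
  have hinj : Function.Injective fun i => a i + Finsupp.single i 1 := by
    intro i j hij
    by_contra hne
    have h1 := congrArg (fun m : Fin (n + 1) →₀ ℕ => m i) hij
    simp only [Finsupp.add_apply, Finsupp.single_eq_same, Finsupp.single_eq_of_ne hne] at h1
    have := hmax i _ (ha j)
    omega
  calc n + 1 = (Finset.univ.image fun i => a i + Finsupp.single i 1).card := by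
        rw [Finset.card_image_of_injective _ hinj]; simp
    _ ≤ _ := Finset.card_le_card (by
        intro m hm
        obtain ⟨i, _, rfl⟩ := Finset.mem_image.1 hm
        exact hmem i)

theorem card_mixed_erase_add_two {d : ℕ} {G : PolyRing k n} {W : Finset (Fin (n + 1))}
    {l : Fin (n + 1)} {m m' : Fin (n + 1) →₀ ℕ} (hm : m ∈ mixed d G W) (hm' : m' ∈ mixed d G W)
    (hne : m ≠ m') (hl : m l ≠ 0) (hl' : m' l ≠ 0) :
    (mixed d G (W.erase l)).card + 2 ≤ (mixed d G W).card := by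
  classical
  have hnot : ∀ x : Fin (n + 1) →₀ ℕ, x l ≠ 0 → x ∉ mixed d G (W.erase l) := fun x hx h =>
    hx (apply_eq_zero_of_mem_mixed h (by simp))
  rw [← Finset.card_pair hne, ← Finset.card_union_of_disjoint]
  · refine Finset.card_le_card (Finset.union_subset (mixed_mono (Finset.erase_subset _ _)) ?_)
    intro x hx
    simp only [Finset.mem_insert, Finset.mem_singleton] at hx
    rcases hx with rfl | rfl <;> assumption
  · rw [Finset.disjoint_left]
    intro x hx hx'
    simp only [Finset.mem_insert, Finset.mem_singleton] at hx'
    rcases hx' with rfl | rfl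
    · exact hnot _ hl hx
    · exact hnot _ hl' hx

/-- If `x_i ^ d` is the only pure power in `(∑ x_i) F` among the variables of `W`, the further terms
on the edges at `i` are distinct. -/
theorem card_sub_one_le_card_mixed {d : ℕ} {F : PolyRing k n}
    (hG : (varSum k n * F).IsHomogeneous d) {W : Finset (Fin (n + 1))} {i : Fin (n + 1)}
    (hiW : i ∈ W) (hi : coeff (Finsupp.single i d) (varSum k n * F) ≠ 0)
    (hW : ∀ j ∈ W, j ≠ i → coeff (Finsupp.single j d) (varSum k n * F) = 0) :
    W.card - 1 ≤ (mixed d (varSum k n * F) W).card := by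
  classical
  have hex : ∀ j : Fin (n + 1), ∃ m, j ∈ W.erase i → m ∈ mixed d (varSum k n * F) {i, j} := by
    intro j
    by_cases hj : j ∈ W.erase i
    · rw [Finset.mem_erase] at hj
      obtain ⟨m, hm⟩ := exists_mem_mixed_pair hj.1.symm hi (hW j hj.2 hj.1)
      exact ⟨m, fun _ => hm⟩
    · exact ⟨0, fun h => absurd h hj⟩
  choose f hf using hex
  rw [← Finset.card_erase_of_mem hiW]
  refine Finset.card_le_card_of_injOn f ?_ ?_
  · intro j hj
    refine mixed_mono ?_ (hf j hj)
    intro x hx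
    simp only [Finset.mem_insert, Finset.mem_singleton] at hx
    rcases hx with rfl | rfl
    · exact hiW
    · exact Finset.mem_of_mem_erase hj
  · intro j hj j' hj' hjj
    by_contra hne
    have h1 := (ne_zero_of_mem_mixed_pair hG (hf j hj)).2
    rw [hjj] at h1
    refine h1 (apply_eq_zero_of_mem_mixed (hf j' hj') ?_)
    have hji : j ≠ i := Finset.ne_of_mem_erase hj
    simp [hji, hne]

/-- If all pure powers in the three variables of a triangle occur, there are two further terms on
the triangle, since one monomial of degree at least four is close to at most two edges. -/
theorem two_le_card_mixed_triple [CharZero k] {d : ℕ} (hd : 4 ≤ d) {F : PolyRing k n}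
    (hG : (varSum k n * F).IsHomogeneous d) {W : Finset (Fin (n + 1))} (hcard : W.card = 3)
    (hW : ∀ j ∈ W, coeff (Finsupp.single j d) (varSum k n * F) ≠ 0) :
    2 ≤ (mixed d (varSum k n * F) W).card := by
  obtain ⟨i, j, l, hij, hil, hjl, rfl⟩ := Finset.card_eq_three.1 hcard
  obtain ⟨m₁, hm₁, h₁⟩ := exists_mem_mixed_triple (by omega) hij hil hjl (hW i (by simp))
  obtain ⟨m₂, hm₂, h₂⟩ := exists_mem_mixed_triple (by omega) hil hij hjl.symm (hW i (by simp))
  obtain ⟨m₃, hm₃, h₃⟩ := exists_mem_mixed_triple (by omega) hjl hij.symm hil.symm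
    (hW j (by simp))
  have e₂ : ({i, l, j} : Finset (Fin (n + 1))) = {i, j, l} := by
    ext; simp; tauto
  have e₃ : ({j, l, i} : Finset (Fin (n + 1))) = {i, j, l} := by
    ext; simp; tauto
  rw [e₂] at hm₂
  rw [e₃] at hm₃
  by_contra hlt
  have hle : (mixed d (varSum k n * F) {i, j, l}).card ≤ 1 := by omega
  obtain rfl := Finset.card_le_one.1 hle m₁ hm₁ m₂ hm₂
  obtain rfl := Finset.card_le_one.1 hle m₁ hm₁ m₃ hm₃
  rw [mem_mixed] at hm₁
  have hdeg : m₁.degree = d := by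
    by_contra h
    exact hm₁.1 (hG.coeff_eq_zero h)
  rw [degree_eq_triple hij hil hjl hm₁.2.1] at hdeg
  omega

/-- If the variables of `W` include one whose pure power occurs in `(∑ x_i) F`, there are at least
`|W| - 1` further terms in the variables of `W`, and at least `|W|` if there are two such variables
and `W` is not a triangle. The induction removes a variable involved in two further terms. -/
theorem card_le_card_mixed [CharZero k] {d : ℕ} (hd : 4 ≤ d) {F : PolyRing k n}
    (hG : (varSum k n * F).IsHomogeneous d) (W : Finset (Fin (n + 1))) (h3 : 3 ≤ W.card)
    (hS : ∃ i ∈ W, coeff (Finsupp.single i d) (varSum k n * F) ≠ 0) :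
    W.card - 1 ≤ (mixed d (varSum k n * F) W).card ∧
      (4 ≤ W.card → (∃ i ∈ W, ∃ j ∈ W, i ≠ j ∧ coeff (Finsupp.single i d) (varSum k n * F) ≠ 0 ∧
        coeff (Finsupp.single j d) (varSum k n * F) ≠ 0) →
        W.card ≤ (mixed d (varSum k n * F) W).card) := by
  classical
  induction hc : W.card using Nat.strong_induction_on generalizing W with
  | _ N ih =>
    subst hc
    obtain ⟨i, hiW, hi⟩ := hS
    by_cases hone : ∀ j ∈ W, j ≠ i → coeff (Finsupp.single j d) (varSum k n * F) = 0
    · refine ⟨card_sub_one_le_card_mixed hG hiW hi hone, ?_⟩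
      rintro _ ⟨a, haW, b, hbW, hab, ha, hb⟩
      have h1 : a = i := by
        by_contra h
        exact ha (hone a haW h)
      have h2 : b = i := by
        by_contra h
        exact hb (hone b hbW h)
      exact absurd (h1.trans h2.symm) hab
    push Not at hone
    obtain ⟨j, hjW, hji, hj⟩ := hone
    -- it suffices to find a variable involved in two further terms
    have key : ∀ l ∈ W, (∃ i ∈ W, i ≠ l ∧ coeff (Finsupp.single i d) (varSum k n * F) ≠ 0) →
        (∃ m ∈ mixed d (varSum k n * F) W, ∃ m' ∈ mixed d (varSum k n * F) W,
          m ≠ m' ∧ m l ≠ 0 ∧ m' l ≠ 0) →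
        W.card - 1 ≤ (mixed d (varSum k n * F) W).card ∧
          (4 ≤ W.card → W.card ≤ (mixed d (varSum k n * F) W).card) := by
      rintro l hlW ⟨a, haW, hal, ha⟩ ⟨m, hm, m', hm', hne, h0, h0'⟩
      have h2 := card_mixed_erase_add_two hm hm' hne h0 h0'
      have hce : (W.erase l).card = W.card - 1 := Finset.card_erase_of_mem hlW
      by_cases h4 : 4 ≤ W.card
      · have := (ih (W.erase l).card (by omega) (W.erase l) (by omega)
          ⟨a, Finset.mem_erase.2 ⟨hal, haW⟩, ha⟩ rfl).1
        omega
      · omega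
    suffices h : W.card - 1 ≤ (mixed d (varSum k n * F) W).card ∧
        (4 ≤ W.card → W.card ≤ (mixed d (varSum k n * F) W).card) from
      ⟨h.1, fun h4 _ => h.2 h4⟩
    by_cases hall : ∃ l ∈ W, coeff (Finsupp.single l d) (varSum k n * F) = 0
    · obtain ⟨l, hlW, hl⟩ := hall
      have hil : i ≠ l := by
        rintro rfl
        exact hi hl
      have hjl : j ≠ l := by
        rintro rfl
        exact hj hl
      obtain ⟨m, hm⟩ := exists_mem_mixed_pair hil hi hl
      obtain ⟨m', hm'⟩ := exists_mem_mixed_pair hjl hj hl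
      refine key l hlW ⟨i, hiW, hil, hi⟩ ⟨m, mixed_mono ?_ hm, m', mixed_mono ?_ hm', ?_,
        (ne_zero_of_mem_mixed_pair hG hm).2, (ne_zero_of_mem_mixed_pair hG hm').2⟩
      · simp [Finset.insert_subset_iff, hiW, hlW]
      · simp [Finset.insert_subset_iff, hjW, hlW]
      · rintro rfl
        refine (ne_zero_of_mem_mixed_pair hG hm).1 (apply_eq_zero_of_mem_mixed hm' ?_)
        simp [hil, hji.symm]
    · push Not at hall
      by_cases h4 : W.card = 3
      · have := two_le_card_mixed_triple hd hG h4 hall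
        omega
      · obtain ⟨T, hTW, hT⟩ := Finset.exists_subset_card_eq h3
        have h2 := two_le_card_mixed_triple hd hG hT fun a ha => hall a (hTW ha)
        obtain ⟨m, hm, m', hm', hne⟩ := Finset.one_lt_card.1 (show 1 < _ from h2)
        obtain ⟨l, hl⟩ : (m.support ∩ m'.support).Nonempty := by
          rw [← Finset.card_pos]
          have h1 := one_lt_card_support_of_mem_mixed hG hm
          have h1' := one_lt_card_support_of_mem_mixed hG hm'
          have hu : (m.support ∪ m'.support).card ≤ 3 := by
            rw [← hT]
            exact Finset.card_le_card (Finset.union_subset (mem_mixed.1 hm).2.1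
              (mem_mixed.1 hm').2.1)
          have := Finset.card_union_add_card_inter m.support m'.support
          omega
        rw [Finset.mem_inter, Finsupp.mem_support_iff, Finsupp.mem_support_iff] at hl
        have hlW : l ∈ W := by
          apply hTW
          apply (mem_mixed.1 hm).2.1
          rw [Finsupp.mem_support_iff]
          exact hl.1
        refine key l hlW ?_ ⟨m, mixed_mono hTW hm, m', mixed_mono hTW hm', hne, hl.1, hl.2⟩
        by_cases hil : i = l
        · exact ⟨j, hjW, hil ▸ hji, hj⟩
        · exact ⟨i, hiW, hil, hi⟩

/-! ### The lower bound for the number of generators -/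

/-- The exponents of the `d`-th powers of the variables. -/
noncomputable def purePowers (n d : ℕ) : Finset (Fin (n + 1) →₀ ℕ) := by
  classical
  exact Finset.univ.image fun i => Finsupp.single i d

theorem mem_purePowers {d : ℕ} {m : Fin (n + 1) →₀ ℕ} :
    m ∈ purePowers n d ↔ ∃ i, m = Finsupp.single i d := by
  classical
  simp [purePowers, eq_comm]

theorem card_purePowers {d : ℕ} (hd : d ≠ 0) : (purePowers n d).card = n + 1 := by
  classical
  rw [purePowers, Finset.card_image_of_injective _ (Finsupp.single_left_injective hd)]
  simp

theorem disjoint_purePowers_mixed {d : ℕ} {G : PolyRing k n} {W : Finset (Fin (n + 1))} :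
    Disjoint (purePowers n d) (mixed d G W) := by
  rw [Finset.disjoint_left]
  intro m hm hm'
  obtain ⟨i, rfl⟩ := mem_purePowers.1 hm
  exact (mem_mixed.1 hm').2.2 i rfl

theorem card_add_le_card_of_support_subset {d : ℕ} (hd : d ≠ 0) {M : Finset (Fin (n + 1) →₀ ℕ)}
    {G : PolyRing k n} (hpure : ∀ i, Finsupp.single i d ∈ M) (hG : ∀ a, coeff a G ≠ 0 → a ∈ M) :
    purePowers n d ∪ mixed d G Finset.univ ⊆ M ∧
      n + 1 + (mixed d G Finset.univ).card = (purePowers n d ∪ mixed d G Finset.univ).card := by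
  constructor
  · refine Finset.union_subset ?_ fun m hm => hG m (mem_mixed.1 hm).1
    intro m hm
    obtain ⟨i, rfl⟩ := mem_purePowers.1 hm
    exact hpure i
  · rw [Finset.card_union_of_disjoint disjoint_purePowers_mixed, card_purePowers hd]

/-- At least `n` terms of `(∑ x_i) F` are not pure powers; if there are exactly `n` of them, then
some pure power occurs, and only one if `n ≠ 2`. -/
theorem le_card_mixed_univ [CharZero k] (hn : 2 ≤ n) {d : ℕ} (hd : 4 ≤ d) {F : PolyRing k n}
    (hF : F ≠ 0) (hFd : F.IsHomogeneous (d - 1)) :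
    n ≤ (mixed d (varSum k n * F) Finset.univ).card ∧
      ((mixed d (varSum k n * F) Finset.univ).card = n →
        ∃ i, coeff (Finsupp.single i d) (varSum k n * F) ≠ 0 ∧
          (n ≠ 2 → ∀ j, j ≠ i → coeff (Finsupp.single j d) (varSum k n * F) = 0)) := by
  have hG := IsHomogeneous.varSum_mul (by omega) hFd
  by_cases hS : ∃ i, coeff (Finsupp.single i d) (varSum k n * F) ≠ 0
  · obtain ⟨i, hi⟩ := hS
    have h := card_le_card_mixed hd hG Finset.univ (by simp; omega) ⟨i, Finset.mem_univ i, hi⟩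
    rw [Finset.card_univ, Fintype.card_fin] at h
    refine ⟨by omega, fun heq => ⟨i, hi, fun hn2 j hji => ?_⟩⟩
    by_contra hj
    have := h.2 (by omega) ⟨j, Finset.mem_univ j, i, Finset.mem_univ i, hji, hj, hi⟩
    omega
  · push Not at hS
    have hsub : (varSum k n * F).support ⊆ mixed d (varSum k n * F) Finset.univ := by
      intro m hm
      rw [mem_mixed]
      rw [mem_support_iff] at hm
      refine ⟨hm, Finset.subset_univ _, ?_⟩
      rintro i rfl
      exact hm (hS i)
    have := (card_support_varSum_mul hF).trans (Finset.card_le_card hsub)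
    exact ⟨by omega, by omega⟩

theorem exists_form_of_isTogliattiSystem {M : Finset (Fin (n + 1) →₀ ℕ)} {d : ℕ} (hd : 1 ≤ d)
    (hM : ∀ m ∈ M, m.degree = d)
    (h : IsTogliattiSystem d (monomialIdeal k (M : Set (Fin (n + 1) →₀ ℕ)))) :
    (∀ i, Finsupp.single i d ∈ M) ∧ ∃ F : PolyRing k n, F ≠ 0 ∧ F.IsHomogeneous (d - 1) ∧
      ∀ a, coeff a (varSum k n * F) ≠ 0 → a ∈ M := by
  refine ⟨fun i => single_mem_of_isArtinianRing (M := (M : Set (Fin (n + 1) →₀ ℕ)))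
    (fun m hm => hM m hm) h.artinian i, ?_⟩
  obtain ⟨F, hF, hFd, hmem⟩ := exists_form_of_failsWLP h.failsWLP
  refine ⟨F, hF, hFd, ?_⟩
  exact (mem_monomialIdeal_of_isHomogeneous (M := (M : Set (Fin (n + 1) →₀ ℕ)))
    (fun m hm => hM m hm) (IsHomogeneous.varSum_mul hd hFd)).1 hmem

/-- The lower bound for the number of generators of a monomial Togliatti system. -/
theorem two_mul_add_one_le_card [CharZero k] (hn : 2 ≤ n) {d : ℕ} (hd : 4 ≤ d)
    {M : Finset (Fin (n + 1) →₀ ℕ)} (hM : ∀ m ∈ M, m.degree = d)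
    (h : IsTogliattiSystem d (monomialIdeal k (M : Set (Fin (n + 1) →₀ ℕ)))) :
    2 * n + 1 ≤ M.card := by
  obtain ⟨hpure, F, hF, hFd, hsupp⟩ := exists_form_of_isTogliattiSystem (by omega) hM h
  obtain ⟨h1, h2⟩ := card_add_le_card_of_support_subset (by omega) hpure hsupp
  have h3 := (le_card_mixed_univ hn hd hF hFd).1
  have := Finset.card_le_card h1
  omega

/-- If `x_i ^ d` is the only pure power in `(∑ x_j) F` and there are only `n` further terms, these
are the `x_i ^ (d - 1) x_l`: modulo `t ^ 2`, the substitution `x_i = -(1 + t)`, `x_j = 1`, `x_l = t`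
leaves only `x_i ^ d` and the term on the edge `i, j` if the term on the edge `i, l` has degree at
least two in `x_l`. -/
theorem mem_mixed_of_card_eq [CharZero k] (hn : 2 ≤ n) {d : ℕ} (hd : 2 ≤ d) {F : PolyRing k n}
    (hFd : F.IsHomogeneous (d - 1)) {i : Fin (n + 1)}
    (hi : coeff (Finsupp.single i d) (varSum k n * F) ≠ 0)
    (hS : ∀ j, j ≠ i → coeff (Finsupp.single j d) (varSum k n * F) = 0)
    (hcard : (mixed d (varSum k n * F) Finset.univ).card = n) {l : Fin (n + 1)} (hl : l ≠ i) :
    Finsupp.single i (d - 1) + Finsupp.single l 1 ∈ mixed d (varSum k n * F) Finset.univ := by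
  classical
  have hG := IsHomogeneous.varSum_mul (by omega) hFd
  have hex : ∀ j : Fin (n + 1), ∃ m, j ≠ i → m ∈ mixed d (varSum k n * F) {i, j} := by
    intro j
    by_cases hj : j = i
    · exact ⟨0, fun h => absurd hj h⟩
    · obtain ⟨m, hm⟩ := exists_mem_mixed_pair (Ne.symm hj) hi (hS j hj)
      exact ⟨m, fun _ => hm⟩
  choose f hf using hex
  have hdeg : ∀ j, j ≠ i → f j i + f j j = d := by
    intro j hj
    have h1 := (mem_mixed.1 (hf j hj))
    have h2 : (f j).degree = d := by
      by_contra h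
      exact h1.1 (hG.coeff_eq_zero h)
    rw [← h2, Finsupp.degree_eq_sum, ← Finset.sum_subset (Finset.subset_univ {i, j}),
      Finset.sum_pair (Ne.symm hj)]
    intro x _ hx
    exact apply_eq_zero_of_mem_mixed (hf j hj) hx
  have hall : mixed d (varSum k n * F) Finset.univ = (Finset.univ.erase i).image f := by
    symm
    refine Finset.eq_of_subset_of_card_le ?_ ?_
    · intro m hm
      obtain ⟨j, hj, rfl⟩ := Finset.mem_image.1 hm
      exact mixed_mono (Finset.subset_univ _) (hf j (Finset.ne_of_mem_erase hj))
    · rw [hcard, Finset.card_image_of_injOn]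
      · rw [Finset.card_erase_of_mem (Finset.mem_univ i), Finset.card_univ, Fintype.card_fin]
        omega
      · intro j hj j' hj' hjj
        have hji := Finset.ne_of_mem_erase hj
        have hji' := Finset.ne_of_mem_erase hj'
        by_contra hne
        have h1 := (ne_zero_of_mem_mixed_pair hG (hf j hji)).2
        rw [hjj] at h1
        refine h1 (apply_eq_zero_of_mem_mixed (hf j' hji') ?_)
        simp [hji, hne]
  have hl0 := ne_zero_of_mem_mixed_pair hG (hf l hl)
  suffices hl1 : f l l = 1 by
    have heq : f l = Finsupp.single i (d - 1) + Finsupp.single l 1 := by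
      have hdl := hdeg l hl
      ext x
      by_cases hxi : x = i
      · subst hxi
        simp [Finsupp.single_eq_of_ne (Ne.symm hl)]
        omega
      · by_cases hxl : x = l
        · subst hxl
          simp [Finsupp.single_eq_of_ne hl, hl1]
        · rw [apply_eq_zero_of_mem_mixed (hf l hl) (by simp [hxi, hxl])]
          simp [Finsupp.single_eq_of_ne hxi, Finsupp.single_eq_of_ne hxl]
    rw [← heq]
    exact mixed_mono (Finset.subset_univ _) (hf l hl)
  by_contra hl1
  obtain ⟨j, hj⟩ : ∃ j, j ∉ ({i, l} : Finset (Fin (n + 1))) := by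
    by_contra h
    push Not at h
    have h1 : (Finset.univ : Finset (Fin (n + 1))).card ≤ ({i, l} : Finset (Fin (n + 1))).card :=
      Finset.card_le_card fun x _ => h x
    have h2 := Finset.card_le_two (a := i) (b := l)
    rw [Finset.card_univ, Fintype.card_fin] at h1
    omega
  simp only [Finset.mem_insert, Finset.mem_singleton, not_or] at hj
  obtain ⟨hji, hjl⟩ : j ≠ i ∧ j ≠ l := hj
  have h := sum_coeff_mul_prod_eq_zero F
    (facePoint i j l (-(1 + Polynomial.X)) 1 (Polynomial.X : Polynomial k))
    (by rw [sum_facePoint hji.symm hl.symm hjl]; ring)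
  have hne : Finsupp.single i d ≠ f j := ((mem_mixed.1 (hf j hji)).2.2 i).symm
  have hfjl : f j l = 0 := apply_eq_zero_of_mem_mixed (hf j hji) (by simp [hl, hjl.symm])
  have hcoef : ∀ c, c ≤ 1 →
      coeff (Finsupp.single i d) (varSum k n * F) *
          ((-(1 + Polynomial.X) : Polynomial k) ^ d).coeff c +
        coeff (f j) (varSum k n * F) *
          ((-(1 + Polynomial.X) : Polynomial k) ^ (f j i)).coeff c = 0 := by
    intro c hc
    have h1 := congrArg (fun p : Polynomial k => p.coeff c) h
    simp only [Polynomial.finsetSum_coeff, Polynomial.coeff_zero, Polynomial.algebraMap_eq,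
      Polynomial.coeff_C_mul] at h1
    rw [← h1, ← Finset.sum_subset (s₁ := {Finsupp.single i d, f j}), Finset.sum_pair hne,
      prod_facePoint_single, prod_facePoint hji.symm hl.symm hjl]
    · simp [facePoint, hfjl]
    · refine (mem_mixed.1 (hf j hji)).2.1.trans ?_
      intro x hx
      simp only [Finset.mem_insert, Finset.mem_singleton] at hx ⊢
      tauto
    · intro x hx
      simp only [Finset.mem_insert, Finset.mem_singleton] at hx
      rw [mem_support_iff]
      rcases hx with rfl | rfl
      · exact hi
      · exact (mem_mixed.1 (hf j hji)).1
    · intro b hb hb2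
      simp only [Finset.mem_insert, Finset.mem_singleton, not_or] at hb2
      rw [mem_support_iff] at hb
      by_cases hp : ∀ x, b ≠ Finsupp.single x d
      · have hbm : b ∈ mixed d (varSum k n * F) Finset.univ :=
          mem_mixed.2 ⟨hb, Finset.subset_univ _, hp⟩
        rw [hall, Finset.mem_image] at hbm
        obtain ⟨x, hx, rfl⟩ := hbm
        have hxi := Finset.ne_of_mem_erase hx
        have hxj : x ≠ j := by
          rintro rfl
          exact hb2.2 rfl
        by_cases hxl : x = l
        · subst hxl
          rw [prod_facePoint hji.symm hl.symm hjl, Polynomial.coeff_mul_X_pow', if_neg (by omega),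
            mul_zero]
          refine (mem_mixed.1 (hf x hxi)).2.1.trans ?_
          intro y hy
          simp only [Finset.mem_insert, Finset.mem_singleton] at hy ⊢
          tauto
        · rw [prod_pow_eq_zero (facePoint_eq_zero _ _ _), Polynomial.coeff_zero, mul_zero]
          intro hsub
          have h3 := hsub (Finsupp.mem_support_iff.2 (ne_zero_of_mem_mixed_pair hG (hf x hxi)).2)
          simp [hxi, hxj, hxl] at h3
      · push Not at hp
        obtain ⟨x, rfl⟩ := hp
        have hxi : x ≠ i := by
          rintro rfl
          exact hb2.1 rfl
        rw [hS x hxi, zero_mul]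
  have h0 := hcoef 0 (by omega)
  have h1 := hcoef 1 le_rfl
  rw [coeff_one_neg_one_add_X_pow, coeff_one_neg_one_add_X_pow] at h1
  simp only [Polynomial.coeff_zero_eq_eval_zero, Polynomial.eval_pow, Polynomial.eval_neg,
    Polynomial.eval_add, Polynomial.eval_one, Polynomial.eval_X, add_zero] at h0
  have hdj := hdeg j hji
  have hj0 := (ne_zero_of_mem_mixed_pair hG (hf j hji)).2
  have hcast : (d : k) = (f j i : k) + (f j j : k) := by exact_mod_cast hdj.symm
  have : coeff (Finsupp.single i d) (varSum k n * F) * ((-1) ^ d * (f j j : k)) = 0 := by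
    rw [hcast] at h1
    linear_combination h1 - (f j i : k) * h0
  exact mul_ne_zero hi (mul_ne_zero (pow_ne_zero _ (neg_ne_zero.2 one_ne_zero))
    (Nat.cast_ne_zero.2 hj0)) this

/-! ### Two polynomial identities in one variable -/

/-- The coefficient of `t ^ j` in `(1 + t) ^ ε t ^ p` for `ε ≤ 1`. -/
theorem coeff_one_add_X_pow_mul_X_pow_eq_zero {ε p j : ℕ} (hε : ε ≤ 1)
    (h : ¬ (j = p ∨ (ε = 1 ∧ j = p + 1))) :
    ((1 + Polynomial.X : Polynomial k) ^ ε * Polynomial.X ^ p).coeff j = 0 := by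
  rw [Polynomial.coeff_mul_X_pow', add_comm (1 : Polynomial k), Polynomial.coeff_X_add_one_pow]
  split_ifs with hp
  · rw [Nat.choose_eq_zero_of_lt (by omega), Nat.cast_zero]
  · rfl

theorem coeff_one_add_X_pow_mul_X_pow {e p j : ℕ} (hp : p ≤ j) :
    ((1 + Polynomial.X : Polynomial k) ^ e * Polynomial.X ^ p).coeff j =
      (e.choose (j - p) : k) := by
  rw [Polynomial.coeff_mul_X_pow', add_comm (1 : Polynomial k), Polynomial.coeff_X_add_one_pow,
    if_pos hp]

theorem coeff_relation {d p₁ ε p e : ℕ} {a b c α β : k}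
    (h : Polynomial.C a * (1 + Polynomial.X) ^ d + Polynomial.C b * Polynomial.X ^ d +
      Polynomial.C c + Polynomial.C α * ((1 + Polynomial.X) ^ e * Polynomial.X ^ p₁) +
      Polynomial.C β * ((1 + Polynomial.X) ^ ε * Polynomial.X ^ p) = 0) {j : ℕ} (hj : 1 ≤ j)
    (hjd : j < d) (hp : p₁ ≤ j) :
    a * (d.choose j : k) + α * (e.choose (j - p₁) : k) +
      β * ((1 + Polynomial.X : Polynomial k) ^ ε * Polynomial.X ^ p).coeff j = 0 := by
  have h1 := congrArg (fun q : Polynomial k => q.coeff j) h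
  simp only [Polynomial.coeff_add, Polynomial.coeff_C_mul, coeff_one_add_X_pow_mul_X_pow hp,
    Polynomial.coeff_zero, Polynomial.coeff_X_pow, if_neg (show ¬ j = d by omega), mul_zero,
    add_zero, Polynomial.coeff_C, if_neg (show ¬ j = 0 by omega)] at h1
  rw [add_comm (1 : Polynomial k) Polynomial.X, Polynomial.coeff_X_add_one_pow] at h1
  rw [add_comm (1 : Polynomial k) Polynomial.X]
  exact h1

/-- The polynomial identity behind the two exceptional systems: the coefficients `a, α` satisfy
`a * d.choose j + α * (d - 2).choose (j - 1) = 0` for `0 < j < d`, up to the at most two values of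
`j` for which `t ^ j` occurs in the last summand, and this fails for `j = 1, 2` and likewise for
`j = d - 1, d - 2`. -/
theorem eq_of_relation_one_one [CharZero k] {d ε p q : ℕ} {a b c α β : k} (hd : 4 ≤ d)
    (ha : a ≠ 0) (hε : ε ≤ 1) (hdeg : ε + p + q = d)
    (h : Polynomial.C a * (1 + Polynomial.X) ^ d + Polynomial.C b * Polynomial.X ^ d +
      Polynomial.C c + Polynomial.C α * ((1 + Polynomial.X) ^ (d - 2) * Polynomial.X ^ 1) +
      Polynomial.C β * ((1 + Polynomial.X) ^ ε * Polynomial.X ^ p) = 0) :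
    (d = 4 ∧ ε = 0 ∧ p = 2) ∨ (d = 5 ∧ ε = 1 ∧ p = 2) := by
  have hrel := fun j (hj : 1 ≤ j) (hjd : j < d) => coeff_relation h hj hjd hj
  have hz := fun j => coeff_one_add_X_pow_mul_X_pow_eq_zero (k := k) (p := p) (j := j) hε
  obtain ⟨e, rfl⟩ : ∃ e, d = e + 2 := ⟨d - 2, by omega⟩
  have hc2 : ((e + 2).choose 2 : k) * 2 = (e + 2) * (e + 1) := by
    have h2 := Nat.choose_two_right (e + 2)
    have h3 : 2 ∣ (e + 2) * (e + 2 - 1) := by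
      have := Nat.even_mul_pred_self (e + 2)
      exact this.two_dvd
    have h4 : (e + 2).choose 2 * 2 = (e + 2) * (e + 1) := by
      rw [h2, Nat.div_mul_cancel h3]
      rfl
    exact_mod_cast h4
  have hfin : a * (e + 2) + α = 0 → a * ((e + 2).choose 2 : k) + α * e = 0 → False := by
    intro h1 h2
    have h3 : a * ((e + 2 : k) * (e - 1)) = 0 := by
      linear_combination 2 * e * h1 - 2 * h2 + a * hc2
    have h4 : ((e : k) + 2) ≠ 0 := by exact_mod_cast (Nat.succ_ne_zero (e + 1))
    have h5 : (e : k) - 1 ≠ 0 := by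
      rw [sub_ne_zero]
      exact_mod_cast (show e ≠ 1 by omega)
    exact mul_ne_zero ha (mul_ne_zero h4 h5) h3
  have hlow : (1 = p ∨ (ε = 1 ∧ 1 = p + 1)) ∨ (2 = p ∨ (ε = 1 ∧ 2 = p + 1)) := by
    by_contra hno
    rw [not_or] at hno
    have h1 := hrel 1 le_rfl (by omega)
    have h2 := hrel 2 (by omega) (by omega)
    rw [hz 1 hno.1] at h1
    rw [hz 2 hno.2] at h2
    simp at h1 h2
    exact hfin h1 h2
  have hhigh : (e + 1 = p ∨ (ε = 1 ∧ e + 1 = p + 1)) ∨ (e = p ∨ (ε = 1 ∧ e = p + 1)) := by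
    by_contra hno
    rw [not_or] at hno
    have h1 := hrel (e + 1) (by omega) (by omega)
    have h2 := hrel e (by omega) (by omega)
    rw [hz _ hno.1, Nat.choose_symm_of_eq_add (show e + 2 = (e + 1) + 1 by omega)] at h1
    rw [hz _ hno.2, Nat.choose_symm_of_eq_add (show e + 2 = e + 2 by omega)] at h2
    simp only [Nat.add_sub_cancel] at h1 h2
    rw [Nat.choose_symm_of_eq_add (show e = (e - 1) + 1 by omega)] at h2
    simp at h1 h2
    exact hfin h1 h2
  have h4 : e = 2 → ε = 0 ∧ p = 2 := by
    rintro rfl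
    by_contra hno
    have hε1 : ε = 1 := by omega
    subst hε1
    have e1 := hrel 1 (by omega) (by omega)
    have e2 := hrel 2 (by omega) (by omega)
    have e3 := hrel 3 (by omega) (by omega)
    have hp : p = 1 ∨ p = 2 := by omega
    rcases hp with rfl | rfl
    · rw [coeff_one_add_X_pow_mul_X_pow (by omega)] at e1 e2 e3
      norm_num [Nat.choose] at e1 e2 e3
      exact ha (by linear_combination -(1 / 2 : k) * e2 + (1 / 2 : k) * e1 + (1 / 2 : k) * e3)
    · rw [hz 1 (by omega)] at e1
      rw [coeff_one_add_X_pow_mul_X_pow (by omega)] at e2 e3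
      norm_num [Nat.choose] at e1 e2 e3
      exact ha (by linear_combination -(1 / 2 : k) * e2 + (1 / 2 : k) * e3 + (1 / 2 : k) * e1)
  omega

/-- The analogue of `eq_of_relation_one_one` for a term on an edge: here the coefficients satisfy
`a * d.choose j + α * (d - 1).choose (j - 1) = 0`, i.e. `a * d + α * j = 0`, for at most one `j`. -/
theorem not_relation_one_zero [CharZero k] {d ε p q : ℕ} {a b c α β : k} (hd : 4 ≤ d)
    (ha : a ≠ 0) (hε : ε ≤ 1) (hdeg : ε + p + q = d)
    (h : Polynomial.C a * (1 + Polynomial.X) ^ d + Polynomial.C b * Polynomial.X ^ d +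
      Polynomial.C c + Polynomial.C α * ((1 + Polynomial.X) ^ (d - 1) * Polynomial.X ^ 1) +
      Polynomial.C β * ((1 + Polynomial.X) ^ ε * Polynomial.X ^ p) = 0) : False := by
  have hrel := fun j (hj : 1 ≤ j) (hjd : j < d) => coeff_relation h hj hjd hj
  have hz := fun j => coeff_one_add_X_pow_mul_X_pow_eq_zero (k := k) (p := p) (j := j) hε
  have hlin : ∀ j, 1 ≤ j → j < d → ¬ (j = p ∨ (ε = 1 ∧ j = p + 1)) → a * d + α * j = 0 := by
    intro j hj hjd hjp
    have h1 := hrel j hj hjd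
    rw [hz j hjp] at h1
    have h2 : (d : k) * ((d - 1).choose (j - 1) : k) = (d.choose j : k) * j := by
      have := Nat.add_one_mul_choose_eq (d - 1) (j - 1)
      rw [show d - 1 + 1 = d by omega, show j - 1 + 1 = j by omega] at this
      exact_mod_cast this
    have h3 : (d.choose j : k) * (a * d + α * j) = 0 := by
      linear_combination (d : k) * h1 - α * h2
    exact (mul_eq_zero.1 h3).resolve_left (Nat.cast_ne_zero.2 (Nat.choose_pos hjd.le).ne')
  have htwo : ∀ i j, 1 ≤ i → i < j → j < d → ¬ (i = p ∨ (ε = 1 ∧ i = p + 1)) →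
      ¬ (j = p ∨ (ε = 1 ∧ j = p + 1)) → False := by
    intro i j hi hij hjd hip hjp
    have h1 := hlin i hi (by omega) hip
    have h2 := hlin j (by omega) hjd hjp
    have h3 : α * ((j : k) - i) = 0 := by linear_combination h2 - h1
    have h4 : (j : k) - i ≠ 0 := by
      rw [sub_ne_zero]
      exact_mod_cast hij.ne'
    have h5 := (mul_eq_zero.1 h3).resolve_right h4
    rw [h5, zero_mul, add_zero] at h1
    exact mul_ne_zero ha (Nat.cast_ne_zero.2 (by omega)) h1
  have h12 := htwo 1 2 le_rfl (by omega) (by omega)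
  have h13 := htwo 1 3 le_rfl (by omega) (by omega)
  have h23 := htwo 2 3 (by omega) (by omega) (by omega)
  by_cases h5 : 5 ≤ d
  · have h34 := htwo 3 4 (by omega) (by omega) (by omega)
    have h14 := htwo 1 4 (by omega) (by omega) (by omega)
    by_cases hp1 : p ≤ 1
    · exact h34 (by omega) (by omega)
    · by_cases hp2 : p = 2
      · exact h14 (by omega) (by omega)
      · exact h12 (by omega) (by omega)
  · obtain rfl : d = 4 := by omega
    by_cases hp : ε = 1 ∧ (p = 1 ∨ p = 2)
    · obtain ⟨rfl, hp⟩ := hp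
      have e1 := hrel 1 (by omega) (by omega)
      have e2 := hrel 2 (by omega) (by omega)
      have e3 := hrel 3 (by omega) (by omega)
      rcases hp with rfl | rfl
      · rw [coeff_one_add_X_pow_mul_X_pow (by omega)] at e1 e2 e3
        norm_num [Nat.choose] at e1 e2 e3
        exact ha (by linear_combination (3 / 2 : k) * e1 - (3 / 2 : k) * e2 + e3)
      · rw [hz 1 (by omega)] at e1
        rw [coeff_one_add_X_pow_mul_X_pow (by omega)] at e2 e3
        norm_num [Nat.choose] at e1 e2 e3
        exact ha (by linear_combination (1 / 2 : k) * e2 - (1 / 2 : k) * e3)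
    · by_cases hp1 : p ≤ 1
      · exact h23 (by omega) (by omega)
      · by_cases hp2 : p = 2
        · exact h13 (by omega) (by omega)
        · exact h12 (by omega) (by omega)

/-! ### Systems in three variables -/

/-- The exponent of `x^a y^b z^c`, where `x, y, z` are the variables enumerated by `e`. -/
noncomputable def triExponent (e : Fin 3 ≃ Fin (2 + 1)) (a b c : ℕ) : Fin (2 + 1) →₀ ℕ :=
  Finsupp.single (e 0) a + Finsupp.single (e 1) b + Finsupp.single (e 2) c

theorem triExponent_apply (e : Fin 3 ≃ Fin (2 + 1)) (a b c : ℕ) :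
    triExponent e a b c (e 0) = a ∧ triExponent e a b c (e 1) = b ∧
      triExponent e a b c (e 2) = c := by
  simp [triExponent]

theorem eq_triExponent_iff (e : Fin 3 ≃ Fin (2 + 1)) {m : Fin (2 + 1) →₀ ℕ} {a b c : ℕ} :
    m = triExponent e a b c ↔ m (e 0) = a ∧ m (e 1) = b ∧ m (e 2) = c := by
  constructor
  · rintro rfl
    exact triExponent_apply e a b c
  · rintro ⟨rfl, rfl, rfl⟩
    have h := triExponent_apply e (m (e 0)) (m (e 1)) (m (e 2))
    ext x
    obtain ⟨y, rfl⟩ := e.surjective x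
    fin_cases y
    · exact h.1.symm
    · exact h.2.1.symm
    · exact h.2.2.symm

theorem degree_eq_add (e : Fin 3 ≃ Fin (2 + 1)) (m : Fin (2 + 1) →₀ ℕ) :
    m.degree = m (e 0) + m (e 1) + m (e 2) := by
  rw [Finsupp.degree_eq_sum, ← e.sum_comp, Fin.sum_univ_three]

theorem degree_triExponent (e : Fin 3 ≃ Fin (2 + 1)) (a b c : ℕ) :
    (triExponent e a b c).degree = a + b + c := by
  simp [triExponent]

theorem mem_purePowers_two (e : Fin 3 ≃ Fin (2 + 1)) {d : ℕ} {m : Fin (2 + 1) →₀ ℕ} :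
    m ∈ purePowers 2 d ↔
      m = triExponent e d 0 0 ∨ m = triExponent e 0 d 0 ∨ m = triExponent e 0 0 d := by
  rw [mem_purePowers]
  constructor
  · rintro ⟨i, rfl⟩
    obtain ⟨y, rfl⟩ := e.surjective i
    fin_cases y <;> simp [triExponent]
  · rintro (rfl | rfl | rfl)
    · exact ⟨e 0, by simp [triExponent]⟩
    · exact ⟨e 1, by simp [triExponent]⟩
    · exact ⟨e 2, by simp [triExponent]⟩

/-- The exponents of the generators of `quinticSystem`, in the variables enumerated by `e`. -/
noncomputable def quinticExponents (e : Fin 3 ≃ Fin (2 + 1)) : Finset (Fin (2 + 1) →₀ ℕ) := by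
  classical
  exact {triExponent e 5 0 0, triExponent e 0 5 0, triExponent e 0 0 5, triExponent e 3 1 1,
    triExponent e 1 2 2}

/-- The exponents of the generators of `quarticSystem`, in the variables enumerated by `e`. -/
noncomputable def quarticExponents (e : Fin 3 ≃ Fin (2 + 1)) : Finset (Fin (2 + 1) →₀ ℕ) := by
  classical
  exact {triExponent e 4 0 0, triExponent e 0 4 0, triExponent e 0 0 4, triExponent e 1 1 2,
    triExponent e 2 2 0}

theorem mem_quinticExponents {e : Fin 3 ≃ Fin (2 + 1)} {m : Fin (2 + 1) →₀ ℕ} :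
    m ∈ quinticExponents e ↔ m = triExponent e 5 0 0 ∨ m = triExponent e 0 5 0 ∨
      m = triExponent e 0 0 5 ∨ m = triExponent e 3 1 1 ∨ m = triExponent e 1 2 2 := by
  simp [quinticExponents]

theorem mem_quarticExponents {e : Fin 3 ≃ Fin (2 + 1)} {m : Fin (2 + 1) →₀ ℕ} :
    m ∈ quarticExponents e ↔ m = triExponent e 4 0 0 ∨ m = triExponent e 0 4 0 ∨
      m = triExponent e 0 0 4 ∨ m = triExponent e 1 1 2 ∨ m = triExponent e 2 2 0 := by
  simp [quarticExponents]

theorem mem_triple {i j l : Fin (2 + 1)} (hij : i ≠ j) (hil : i ≠ l) (hjl : j ≠ l)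
    (x : Fin (2 + 1)) : x ∈ ({i, j, l} : Finset (Fin (2 + 1))) := by
  simp only [Finset.mem_insert, Finset.mem_singleton]
  omega

theorem exists_equiv {i j l : Fin (2 + 1)} (hij : i ≠ j) (hil : i ≠ l) (hjl : j ≠ l) :
    ∃ e : Fin 3 ≃ Fin (2 + 1), e 0 = i ∧ e 1 = j ∧ e 2 = l := by
  have hinj : Function.Injective (![i, j, l] : Fin 3 → Fin (2 + 1)) := by
    intro a b hab
    fin_cases a <;> fin_cases b <;> simp_all
  exact ⟨Equiv.ofBijective _ (Finite.injective_iff_bijective.1 hinj), rfl, rfl, rfl⟩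

/-- The relation obtained by evaluating `(∑ x_i) F` at a point with coordinate sum zero, if there
are only two terms besides the pure powers. -/
theorem plane_relation {R : Type*} [CommRing R] [Algebra k R] {d : ℕ} (hd : d ≠ 0)
    (F : PolyRing k 2) {i j l : Fin (2 + 1)} (hij : i ≠ j) (hil : i ≠ l) (hjl : j ≠ l)
    {m m' : Fin (2 + 1) →₀ ℕ} (hne : m ≠ m')
    (hmixed : ∀ x, x ∈ mixed d (varSum k 2 * F) Finset.univ ↔ x = m ∨ x = m')
    {A B C : R} (hABC : A + B + C = 0) :
    algebraMap k R (coeff (Finsupp.single i d) (varSum k 2 * F)) * A ^ d +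
      algebraMap k R (coeff (Finsupp.single j d) (varSum k 2 * F)) * B ^ d +
      algebraMap k R (coeff (Finsupp.single l d) (varSum k 2 * F)) * C ^ d +
      algebraMap k R (coeff m (varSum k 2 * F)) * (A ^ m i * B ^ m j * C ^ m l) +
      algebraMap k R (coeff m' (varSum k 2 * F)) * (A ^ m' i * B ^ m' j * C ^ m' l) = 0 := by
  classical
  have h := sum_coeff_mul_prod_eq_zero F (facePoint i j l A B C)
    (by rw [sum_facePoint hij hil hjl, hABC])
  have hm : mixed d (varSum k 2 * F) Finset.univ = {m, m'} := by
    ext x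
    simp [hmixed]
  have hsub : (varSum k 2 * F).support ⊆ purePowers 2 d ∪ mixed d (varSum k 2 * F) Finset.univ := by
    intro x hx
    rw [mem_support_iff] at hx
    rw [Finset.mem_union, mem_purePowers, mem_mixed]
    by_cases hp : ∃ i, x = Finsupp.single i d
    · exact Or.inl hp
    · push Not at hp
      exact Or.inr ⟨hx, Finset.subset_univ _, hp⟩
  rw [Finset.sum_subset hsub, Finset.sum_union disjoint_purePowers_mixed, hm, Finset.sum_pair hne,
    purePowers, Finset.sum_image (fun x _ y _ hxy => Finsupp.single_left_injective hd hxy),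
    sum_triple hij hil hjl (fun x hx => absurd (mem_triple hij hil hjl x) hx)] at h
  · rw [prod_facePoint_single, prod_facePoint_single, prod_facePoint_single,
      prod_facePoint hij hil hjl _ _ _ (fun x _ => mem_triple hij hil hjl x),
      prod_facePoint hij hil hjl _ _ _ (fun x _ => mem_triple hij hil hjl x)] at h
    simp only [facePoint, if_true, if_neg hij.symm, if_neg hil.symm, if_neg hjl.symm] at h
    rw [← add_assoc] at h
    exact h
  · intro x _ hx
    rw [notMem_support_iff] at hx
    rw [hx, map_zero, zero_mul]

theorem C_mul_neg_pow {R : Type*} [CommRing R] (c : R) (p : Polynomial R) (e : ℕ) :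
    Polynomial.C c * (-p) ^ e = Polynomial.C (c * (-1) ^ e) * p ^ e := by
  rw [neg_pow, Polynomial.C_mul, Polynomial.C_pow, Polynomial.C_neg, Polynomial.C_1, mul_assoc]

/-- `plane_relation` for `x_i = -(1 + t)`, `x_j = t`, `x_l = 1`. -/
theorem plane_relation_polynomial {d : ℕ} (hd : d ≠ 0)
    (F : PolyRing k 2) {i j l : Fin (2 + 1)} (hij : i ≠ j) (hil : i ≠ l) (hjl : j ≠ l)
    {m m' : Fin (2 + 1) →₀ ℕ} (hne : m ≠ m')
    (hmixed : ∀ x, x ∈ mixed d (varSum k 2 * F) Finset.univ ↔ x = m ∨ x = m') :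
    Polynomial.C (coeff (Finsupp.single i d) (varSum k 2 * F) * (-1) ^ d) *
        (1 + Polynomial.X) ^ d +
      Polynomial.C (coeff (Finsupp.single j d) (varSum k 2 * F)) * Polynomial.X ^ d +
      Polynomial.C (coeff (Finsupp.single l d) (varSum k 2 * F)) +
      Polynomial.C (coeff m (varSum k 2 * F) * (-1) ^ m i) *
        ((1 + Polynomial.X) ^ m i * Polynomial.X ^ m j) +
      Polynomial.C (coeff m' (varSum k 2 * F) * (-1) ^ m' i) *
        ((1 + Polynomial.X) ^ m' i * Polynomial.X ^ m' j) = 0 := by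
  have h := plane_relation (R := Polynomial k) hd F hij hil hjl hne hmixed
    (A := -(1 + Polynomial.X)) (B := Polynomial.X) (C := 1) (by ring)
  simp only [Polynomial.algebraMap_eq, one_pow, mul_one] at h
  rw [C_mul_neg_pow, ← mul_assoc (Polynomial.C _) ((-(1 + Polynomial.X)) ^ m i),
    ← mul_assoc (Polynomial.C _) ((-(1 + Polynomial.X)) ^ m' i), C_mul_neg_pow, C_mul_neg_pow,
    mul_assoc, mul_assoc (Polynomial.C _) ((1 + Polynomial.X) ^ m' i)] at h
  exact h

/-- If one further term is close to two edges of the triangle and the other one is close to the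
third edge, then the exponents are those of one of the two exceptional systems. -/
theorem exceptional_of_close [CharZero k] {d : ℕ} (hd : 4 ≤ d) {F : PolyRing k 2}
    (hG : (varSum k 2 * F).IsHomogeneous d)
    {i j l : Fin (2 + 1)} (hij : i ≠ j) (hil : i ≠ l) (hjl : j ≠ l)
    {m m' : Fin (2 + 1) →₀ ℕ} (hne : m ≠ m')
    (hmixed : ∀ x, x ∈ mixed d (varSum k 2 * F) Finset.univ ↔ x = m ∨ x = m')
    (hi : coeff (Finsupp.single i d) (varSum k 2 * F) ≠ 0)
    (hmj : m j ≤ 1) (hml : m l ≤ 1) (hmi : m' i ≤ 1) :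
    m i + 2 = d ∧ m j = 1 ∧ m l = 1 ∧ ((d = 4 ∧ m' i = 0 ∧ m' j = 2 ∧ m' l = 2) ∨
      (d = 5 ∧ m' i = 1 ∧ m' j = 2 ∧ m' l = 2)) := by
  have hm := mem_mixed.1 ((hmixed m).2 (Or.inl rfl))
  have hm' := mem_mixed.1 ((hmixed m').2 (Or.inr rfl))
  have hdeg : ∀ x, coeff x (varSum k 2 * F) ≠ 0 → x i + x j + x l = d := by
    intro x hx
    rw [← degree_eq_triple hij hil hjl fun y _ => mem_triple hij hil hjl y]
    by_contra h
    exact hx (hG.coeff_eq_zero h)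
  have h1 := hdeg m hm.1
  have h2 := hdeg m' hm'.1
  have ha : coeff (Finsupp.single i d) (varSum k 2 * F) * (-1) ^ d ≠ 0 :=
    mul_ne_zero hi (pow_ne_zero _ (neg_ne_zero.2 one_ne_zero))
  have hrel := plane_relation_polynomial (by omega) F hij hil hjl hne hmixed
  have hrel' := plane_relation_polynomial (by omega) F hil hij hjl.symm hne hmixed
  have hcases : (m j = 0 ∧ m l = 0) ∨ (m j = 1 ∧ m l = 0) ∨ (m j = 0 ∧ m l = 1) ∨
    (m j = 1 ∧ m l = 1) := by omega
  rcases hcases with ⟨hj0, hl0⟩ | ⟨hj1, hl0⟩ | ⟨hj0, hl1⟩ | ⟨hj1, hl1⟩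
  · exfalso
    refine hm.2.2 i ?_
    ext x
    have hx := mem_triple hij hil hjl x
    simp only [Finset.mem_insert, Finset.mem_singleton] at hx
    rcases hx with rfl | rfl | rfl
    · rw [Finsupp.single_eq_same]; omega
    · rw [Finsupp.single_eq_of_ne hij.symm]; omega
    · rw [Finsupp.single_eq_of_ne hil.symm]; omega
  · rw [show m i = d - 1 by omega, hj1] at hrel
    exact (not_relation_one_zero hd ha hmi h2 hrel).elim
  · rw [show m i = d - 1 by omega, hl1] at hrel'
    exact (not_relation_one_zero hd ha hmi (q := m' j) (by omega) hrel').elim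
  · rw [show m i = d - 2 by omega, hj1] at hrel
    have := eq_of_relation_one_one hd ha hmi h2 hrel
    omega

/-- In three variables, the pure powers of exactly two variables and two further terms do not
suffice: the substitution `x_i = t`, `x_j = 1`, `x_l = -(1 + t)` forces the further terms to be
`x_i x_l ^ (d - 1)` and `x_j x_l ^ (d - 1)`, with coefficients `α = -(d - 1) β`,
`β = -(d - 1) α`. -/
theorem not_exactly_two_pure [CharZero k] {d : ℕ} (hd : 4 ≤ d) {F : PolyRing k 2}
    (hG : (varSum k 2 * F).IsHomogeneous d)
    (hcard : (mixed d (varSum k 2 * F) Finset.univ).card = 2)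
    {i j l : Fin (2 + 1)} (hij : i ≠ j) (hil : i ≠ l) (hjl : j ≠ l)
    (hi : coeff (Finsupp.single i d) (varSum k 2 * F) ≠ 0)
    (hj : coeff (Finsupp.single j d) (varSum k 2 * F) ≠ 0)
    (hl : coeff (Finsupp.single l d) (varSum k 2 * F) = 0) : False := by
  classical
  obtain ⟨m, hm⟩ := exists_mem_mixed_pair hil hi hl
  obtain ⟨m', hm'⟩ := exists_mem_mixed_pair hjl hj hl
  have hm0 := ne_zero_of_mem_mixed_pair hG hm
  have hm0' := ne_zero_of_mem_mixed_pair hG hm'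
  have hmj : m j = 0 := apply_eq_zero_of_mem_mixed hm (by simp [hij.symm, hjl])
  have hmi' : m' i = 0 := apply_eq_zero_of_mem_mixed hm' (by simp [hij, hil])
  have hne : m ≠ m' := by
    rintro rfl
    exact hm0.1 hmi'
  have hmixed : mixed d (varSum k 2 * F) Finset.univ = {m, m'} := by
    symm
    refine Finset.eq_of_subset_of_card_le ?_ ?_
    · intro x hx
      simp only [Finset.mem_insert, Finset.mem_singleton] at hx
      rcases hx with rfl | rfl
      · exact mixed_mono (Finset.subset_univ _) hm
      · exact mixed_mono (Finset.subset_univ _) hm'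
    · rw [hcard, Finset.card_pair hne]
  have hdeg : ∀ x, coeff x (varSum k 2 * F) ≠ 0 → x i + x j + x l = d := by
    intro x hx
    rw [← degree_eq_triple hij hil hjl fun y _ => mem_triple hij hil hjl y]
    by_contra h
    exact hx (hG.coeff_eq_zero h)
  have h1 := hdeg m (mem_mixed.1 hm).1
  have h2 := hdeg m' (mem_mixed.1 hm').1
  have h := plane_relation (R := Polynomial k) (show d ≠ 0 by omega) F hij hil hjl hne
    (by intro x; rw [hmixed]; simp)
    (A := Polynomial.X) (B := 1) (C := -(1 + Polynomial.X)) (by ring)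
  rw [hl, hmj, hmi', pow_zero, pow_zero] at h
  simp only [Polynomial.algebraMap_eq, one_pow, mul_one, map_zero, zero_mul, add_zero,
    one_mul] at h
  rw [mul_comm (Polynomial.X ^ m i), ← mul_assoc, C_mul_neg_pow, C_mul_neg_pow, mul_assoc] at h
  generalize coeff (Finsupp.single i d) (varSum k 2 * F) = a at h hi
  generalize coeff (Finsupp.single j d) (varSum k 2 * F) = b at h hj
  generalize coeff m (varSum k 2 * F) * (-1) ^ m l = α at h
  generalize coeff m' (varSum k 2 * F) * (-1) ^ m' l = β at h
  have hc : ∀ c, a * (if c = d then 1 else 0) + b * (if c = 0 then 1 else 0) +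
      α * (if m i ≤ c then ((m l).choose (c - m i) : k) else 0) +
        β * ((m' l).choose c : k) = 0 := by
    intro c
    have h3 := congrArg (fun q : Polynomial k => q.coeff c) h
    rw [add_comm (1 : Polynomial k) Polynomial.X] at h3
    simp only [Polynomial.coeff_add, Polynomial.coeff_zero] at h3
    rw [Polynomial.coeff_C_mul, Polynomial.coeff_X_pow, Polynomial.coeff_C, Polynomial.coeff_C_mul,
      Polynomial.coeff_mul_X_pow', Polynomial.coeff_C_mul, Polynomial.coeff_X_add_one_pow,
      Polynomial.coeff_X_add_one_pow] at h3
    simpa only [mul_ite, mul_one, mul_zero] using h3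
  have c0 := hc 0
  have c1 := hc 1
  have cd := hc d
  have cd1 := hc (d - 1)
  rw [if_neg (by omega), if_pos rfl, if_neg (by omega), Nat.choose_zero_right] at c0
  rw [if_neg (by omega), if_neg (by omega), Nat.choose_one_right] at c1
  rw [if_pos rfl, if_neg (by omega), if_pos (by omega), show d - m i = m l by omega,
    Nat.choose_self, Nat.choose_eq_zero_of_lt (by omega)] at cd
  rw [if_neg (by omega), if_neg (by omega), if_pos (by omega), show d - 1 - m i = m l - 1 by omega,
    Nat.choose_symm_of_eq_add (show m l = (m l - 1) + 1 by omega), Nat.choose_one_right] at cd1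
  have hα : α ≠ 0 := by
    rintro rfl
    apply hi
    linear_combination cd
  have hβ : β ≠ 0 := by
    rintro rfl
    apply hj
    linear_combination c0
  have hml : m i = 1 := by
    by_contra hmi
    rw [if_neg (by omega)] at c1
    refine mul_ne_zero hβ (Nat.cast_ne_zero.2 hm0'.2) ?_
    linear_combination c1
  have hml' : m' l = d - 1 := by
    by_contra hml'
    rw [Nat.choose_eq_zero_of_lt (by omega)] at cd1
    refine mul_ne_zero hα (Nat.cast_ne_zero.2 hm0.2) ?_
    push_cast at cd1
    linear_combination cd1
  rw [if_pos (by omega), hml, hml', Nat.sub_self, Nat.choose_zero_right] at c1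
  rw [hml', Nat.choose_self, show m l = d - 1 by omega] at cd1
  push_cast at c1 cd1
  obtain ⟨e, rfl⟩ : ∃ e, d = e + 2 := ⟨d - 2, by omega⟩
  simp only [show e + 2 - 1 = e + 1 by omega] at c1 cd1
  push_cast at c1 cd1
  have h4 : α * ((e : k) * (e + 2)) = 0 := by linear_combination ((e : k) + 1) * cd1 - c1
  refine mul_ne_zero hα (mul_ne_zero (Nat.cast_ne_zero.2 (by omega)) ?_) h4
  exact_mod_cast Nat.succ_ne_zero (e + 1)

/-! ### Classification of the systems with few generators -/

theorem monomial_triExponent (e : Fin 3 ≃ Fin (2 + 1)) (a b c : ℕ) :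
    monomial (triExponent e a b c) (1 : k) = X (e 0) ^ a * X (e 1) ^ b * X (e 2) ^ c := by
  rw [triExponent, X_pow_eq_monomial, X_pow_eq_monomial, X_pow_eq_monomial, monomial_mul,
    monomial_mul, one_mul, one_mul]

theorem map_quinticSystem (e : Fin 3 ≃ Fin (2 + 1)) :
    (quinticSystem k).map (rename (R := k) e) =
      monomialIdeal k (quinticExponents e : Set (Fin (2 + 1) →₀ ℕ)) := by
  classical
  rw [quinticSystem, Ideal.map_span, monomialIdeal, quinticExponents]
  congr 1
  simp only [Set.image_insert_eq, Set.image_singleton, Finset.coe_insert, Finset.coe_singleton,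
    map_mul, map_pow, rename_X, monomial_triExponent, pow_zero, pow_one, mul_one, one_mul]

theorem map_quarticSystem (e : Fin 3 ≃ Fin (2 + 1)) :
    (quarticSystem k).map (rename (R := k) e) =
      monomialIdeal k (quarticExponents e : Set (Fin (2 + 1) →₀ ℕ)) := by
  classical
  rw [quarticSystem, Ideal.map_span, monomialIdeal, quarticExponents]
  congr 1
  simp only [Set.image_insert_eq, Set.image_singleton, Finset.coe_insert, Finset.coe_singleton,
    map_mul, map_pow, rename_X, monomial_triExponent, pow_zero, pow_one, mul_one, one_mul]

/-- In three variables, two further terms besides the pure powers of all variables lead to the two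
exceptional systems. -/
theorem exists_equiv_of_all_pure [CharZero k] {d : ℕ} (hd : 4 ≤ d) {F : PolyRing k 2}
    (hG : (varSum k 2 * F).IsHomogeneous d)
    (hcard : (mixed d (varSum k 2 * F) Finset.univ).card = 2)
    (hS : ∀ i, coeff (Finsupp.single i d) (varSum k 2 * F) ≠ 0) :
    (d = 5 ∧ ∃ e : Fin 3 ≃ Fin (2 + 1), ∀ m, m ∈ mixed d (varSum k 2 * F) Finset.univ ↔
      m = triExponent e 3 1 1 ∨ m = triExponent e 1 2 2) ∨
    (d = 4 ∧ ∃ e : Fin 3 ≃ Fin (2 + 1), ∀ m, m ∈ mixed d (varSum k 2 * F) Finset.univ ↔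
      m = triExponent e 1 1 2 ∨ m = triExponent e 2 2 0) := by
  classical
  obtain ⟨m₁, m₂, hne, hmixed⟩ := Finset.card_eq_two.1 hcard
  have hmix : ∀ x, x ∈ mixed d (varSum k 2 * F) Finset.univ ↔ x = m₁ ∨ x = m₂ := by
    intro x
    rw [hmixed]
    simp
  have hmix' : ∀ x, x ∈ mixed d (varSum k 2 * F) Finset.univ ↔ x = m₂ ∨ x = m₁ :=
    fun x => (hmix x).trans or_comm
  have hclose : ∀ i j l : Fin (2 + 1), i ≠ j → i ≠ l → j ≠ l → m₁ l ≤ 1 ∨ m₂ l ≤ 1 := by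
    intro i j l hij hil hjl
    obtain ⟨m, hm, hml⟩ := exists_mem_mixed_triple (by omega) hij hil hjl (hS i)
    rcases (hmix m).1 (mixed_mono (Finset.subset_univ _) hm) with rfl | rfl
    · exact Or.inl hml
    · exact Or.inr hml
  -- the conclusion, once it is known which term is close to which edges
  have hfin : ∀ (m m' : Fin (2 + 1) →₀ ℕ) (i j l : Fin (2 + 1)), m ≠ m' →
      (∀ x, x ∈ mixed d (varSum k 2 * F) Finset.univ ↔ x = m ∨ x = m') → i ≠ j → i ≠ l → j ≠ l →
      m j ≤ 1 → m l ≤ 1 → m' i ≤ 1 →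
      (d = 5 ∧ ∃ e : Fin 3 ≃ Fin (2 + 1), ∀ m, m ∈ mixed d (varSum k 2 * F) Finset.univ ↔
        m = triExponent e 3 1 1 ∨ m = triExponent e 1 2 2) ∨
      (d = 4 ∧ ∃ e : Fin 3 ≃ Fin (2 + 1), ∀ m, m ∈ mixed d (varSum k 2 * F) Finset.univ ↔
        m = triExponent e 1 1 2 ∨ m = triExponent e 2 2 0) := by
    intro m m' i j l hne hmix hij hil hjl hmj hml hmi
    obtain ⟨h1, h2, h3, ⟨rfl, h4, h5, h6⟩ | ⟨rfl, h4, h5, h6⟩⟩ :=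
      exceptional_of_close hd hG hij hil hjl hne hmix (hS i) hmj hml hmi
    · right
      obtain ⟨e, rfl, rfl, rfl⟩ := exists_equiv hjl hij.symm hil.symm
      refine ⟨rfl, e, fun x => ?_⟩
      rw [hmix, (eq_triExponent_iff e (m := m) (c := 2)).2 ⟨h2, h3, by omega⟩,
        (eq_triExponent_iff e (m := m')).2 ⟨h5, h6, h4⟩]
    · left
      obtain ⟨e, rfl, rfl, rfl⟩ := exists_equiv hij hil hjl
      refine ⟨rfl, e, fun x => ?_⟩
      rw [hmix, (eq_triExponent_iff e (m := m) (a := 3)).2 ⟨by omega, h2, h3⟩,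
        (eq_triExponent_iff e (m := m')).2 ⟨h4, h5, h6⟩]
  have c0 := hclose 1 2 0 (by decide) (by decide) (by decide)
  have c1 := hclose 0 2 1 (by decide) (by decide) (by decide)
  have c2 := hclose 0 1 2 (by decide) (by decide) (by decide)
  have hlarge : ∀ m, m ∈ mixed d (varSum k 2 * F) Finset.univ →
      ¬ (m 0 ≤ 1 ∧ m 1 ≤ 1 ∧ m 2 ≤ 1) := by
    rintro m hm ⟨h0, h1, h2⟩
    have hdeg : m.degree = d := by
      by_contra h
      exact (mem_mixed.1 hm).1 (hG.coeff_eq_zero h)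
    rw [Finsupp.degree_eq_sum, Fin.sum_univ_three] at hdeg
    omega
  have l1 := hlarge m₁ ((hmix m₁).2 (Or.inl rfl))
  have l2 := hlarge m₂ ((hmix m₂).2 (Or.inr rfl))
  have n1 := fun i j l => hfin m₁ m₂ i j l hne hmix
  have n2 := fun i j l => hfin m₂ m₁ i j l hne.symm hmix'
  rcases c0 with c0 | c0 <;> rcases c1 with c1 | c1 <;> rcases c2 with c2 | c2
  · exact absurd ⟨c0, c1, c2⟩ l1
  · exact n1 2 0 1 (by decide) (by decide) (by decide) c0 c1 c2
  · exact n1 1 0 2 (by decide) (by decide) (by decide) c0 c2 c1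
  · exact n2 0 1 2 (by decide) (by decide) (by decide) c1 c2 c0
  · exact n1 0 1 2 (by decide) (by decide) (by decide) c1 c2 c0
  · exact n2 1 0 2 (by decide) (by decide) (by decide) c0 c2 c1
  · exact n2 2 0 1 (by decide) (by decide) (by decide) c0 c1 c2
  · exact absurd ⟨c0, c1, c2⟩ l2

/-- Systems of `2 n + 1` monomials which contain all the products `x_i ^ (d - 1) x_l` for some `i`
are trivial. -/
theorem isTrivial_of_forall_mem {M : Finset (Fin (n + 1) →₀ ℕ)} {d : ℕ} (hd : 1 ≤ d)
    {i : Fin (n + 1)} (hpure : Finsupp.single i d ∈ M)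
    (h : ∀ l, l ≠ i → Finsupp.single i (d - 1) + Finsupp.single l 1 ∈ M) :
    IsTrivial d (monomialIdeal k (M : Set (Fin (n + 1) →₀ ℕ))) := by
  refine ⟨monomial (Finsupp.single i (d - 1)) 1, ?_,
    isHomogeneous_monomial 1 (Finsupp.degree_single _ _), ?_⟩
  · rw [Ne, monomial_eq_zero]
    exact one_ne_zero
  · intro l
    have : X l * monomial (Finsupp.single i (d - 1)) (1 : k) =
        monomial (Finsupp.single i (d - 1) + Finsupp.single l 1) 1 := by
      rw [X, monomial_mul, one_mul, add_comm (Finsupp.single l 1)]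
    rw [this]
    refine Ideal.subset_span ⟨_, ?_, rfl⟩
    by_cases hl : l = i
    · subst hl
      rw [← Finsupp.single_add, show d - 1 + 1 = d by omega]
      exact hpure
    · exact h l hl

/-- The classification of the monomial Togliatti systems with `2 n + 1` generators. -/
theorem isTrivial_or_isPermutationOf [CharZero k] (hn : 2 ≤ n) {d : ℕ} (hd : 4 ≤ d)
    {M : Finset (Fin (n + 1) →₀ ℕ)} (hM : ∀ m ∈ M, m.degree = d)
    (h : IsTogliattiSystem d (monomialIdeal k (M : Set (Fin (n + 1) →₀ ℕ))))
    (hcard : M.card = 2 * n + 1) :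
    IsTrivial d (monomialIdeal k (M : Set (Fin (n + 1) →₀ ℕ))) ∨
      (n = 2 ∧ d = 5 ∧ IsPermutationOf (quinticSystem k)
        (monomialIdeal k (M : Set (Fin (n + 1) →₀ ℕ)))) ∨
      (n = 2 ∧ d = 4 ∧ IsPermutationOf (quarticSystem k)
        (monomialIdeal k (M : Set (Fin (n + 1) →₀ ℕ)))) := by
  obtain ⟨hpure, F, hF, hFd, hsupp⟩ := exists_form_of_isTogliattiSystem (by omega) hM h
  obtain ⟨h1, h2⟩ := card_add_le_card_of_support_subset (by omega) hpure hsupp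
  obtain ⟨h3, h4⟩ := le_card_mixed_univ hn hd hF hFd
  have hmc : (mixed d (varSum k n * F) Finset.univ).card = n := by
    have := Finset.card_le_card h1
    omega
  have hMeq : purePowers n d ∪ mixed d (varSum k n * F) Finset.univ = M :=
    Finset.eq_of_subset_of_card_le h1 (by omega)
  have hG := IsHomogeneous.varSum_mul (by omega) hFd
  -- if only one pure power occurs, the system is trivial
  have htriv : (∃ i, coeff (Finsupp.single i d) (varSum k n * F) ≠ 0 ∧
      ∀ j, j ≠ i → coeff (Finsupp.single j d) (varSum k n * F) = 0) →
      IsTrivial d (monomialIdeal k (M : Set (Fin (n + 1) →₀ ℕ))) := by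
    rintro ⟨i, hi, hS⟩
    refine isTrivial_of_forall_mem (by omega) (hpure i) fun l hl => ?_
    rw [← hMeq]
    exact Finset.mem_union_right _ (mem_mixed_of_card_eq hn (by omega) hFd hi hS hmc hl)
  obtain ⟨i, hi, hS⟩ := h4 hmc
  by_cases hn2 : n = 2
  · subst hn2
    by_cases hone : ∀ j, j ≠ i → coeff (Finsupp.single j d) (varSum k 2 * F) = 0
    · exact Or.inl (htriv ⟨i, hi, hone⟩)
    · push Not at hone
      obtain ⟨j, hji, hj⟩ := hone
      obtain ⟨l, hil, hjl⟩ : ∃ l : Fin (2 + 1), i ≠ l ∧ j ≠ l := by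
        revert i j
        intro i _ _ j _ _
        clear * -
        revert i j
        decide
      have hl : coeff (Finsupp.single l d) (varSum k 2 * F) ≠ 0 := fun hl =>
        not_exactly_two_pure hd hG hmc hji.symm hil hjl hi hj hl
      have hall : ∀ x, coeff (Finsupp.single x d) (varSum k 2 * F) ≠ 0 := by
        intro x
        have hx := mem_triple hji.symm hil hjl x
        simp only [Finset.mem_insert, Finset.mem_singleton] at hx
        rcases hx with rfl | rfl | rfl <;> assumption
      right
      rcases exists_equiv_of_all_pure hd hG hmc hall with ⟨rfl, e, he⟩ | ⟨rfl, e, he⟩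
      · refine Or.inl ⟨rfl, rfl, e, ?_⟩
        have hMe : M = quinticExponents e := by
          ext m
          rw [← hMeq, Finset.mem_union, mem_purePowers_two e, he, mem_quinticExponents, or_assoc,
            or_assoc]
        rw [map_quinticSystem, hMe]
      · refine Or.inr ⟨rfl, rfl, e, ?_⟩
        have hMe : M = quarticExponents e := by
          ext m
          rw [← hMeq, Finset.mem_union, mem_purePowers_two e, he, mem_quarticExponents, or_assoc,
            or_assoc]
        rw [map_quarticSystem, hMe]
  · exact Or.inl (htriv ⟨i, hi, hS hn2⟩)

/-! ### Tangent spaces of toric varieties -/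

/-- The value of the monomial with exponent `a` at `s`. -/
def monomialValue (s : Fin (n + 1) → k) (a : Fin (n + 1) →₀ ℕ) : k := ∏ i, s i ^ a i

theorem monomialValue_add (s : Fin (n + 1) → k) (a b : Fin (n + 1) →₀ ℕ) :
    monomialValue s (a + b) = monomialValue s a * monomialValue s b := by
  simp only [monomialValue, Finsupp.add_apply, pow_add, Finset.prod_mul_distrib]

theorem monomialValue_nsmul (s : Fin (n + 1) → k) (N : ℕ) (a : Fin (n + 1) →₀ ℕ) :
    monomialValue s (N • a) = monomialValue s a ^ N := by
  simp only [monomialValue, Finsupp.smul_apply, smul_eq_mul, ← Finset.prod_pow]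
  exact Finset.prod_congr rfl fun i _ => by rw [← pow_mul, mul_comm]

theorem monomialValue_sum {ι : Type*} (s : Fin (n + 1) → k) (S : Finset ι)
    (f : ι → Fin (n + 1) →₀ ℕ) :
    monomialValue s (∑ i ∈ S, f i) = ∏ i ∈ S, monomialValue s (f i) := by
  classical
  induction S using Finset.induction_on with
  | empty => simp [monomialValue]
  | insert a S ha ih => rw [Finset.sum_insert ha, Finset.prod_insert ha, monomialValue_add, ih]

theorem monomialValue_single (s : Fin (n + 1) → k) (i : Fin (n + 1)) (e : ℕ) :
    monomialValue s (Finsupp.single i e) = s i ^ e := by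
  rw [monomialValue, Finset.prod_eq_single i]
  · rw [Finsupp.single_eq_same]
  · intro b _ hb
    rw [Finsupp.single_eq_of_ne hb, pow_zero]
  · simp

theorem mem_toricIdeal {A : Finset (Fin (n + 1) →₀ ℕ)} {f : MvPolynomial A k} :
    f ∈ toricIdeal k A ↔ ∀ s : Fin (n + 1) → k,
      aeval (fun a : A => monomialValue s (a : Fin (n + 1) →₀ ℕ)) f = 0 := by
  rw [toricIdeal, mem_vanishingIdeal_iff, Set.forall_mem_range]
  rfl

/-- The dual number point `c + ξ ε`. -/
def dualPoint {R σ : Type*} (c ξ : σ → R) : σ → DualNumber R := fun a => (c a, ξ a)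

@[simp]
theorem fst_dualPoint {R σ : Type*} (c ξ : σ → R) (a : σ) : (dualPoint c ξ a).fst = c a := rfl

@[simp]
theorem snd_dualPoint {R σ : Type*} (c ξ : σ → R) (a : σ) : (dualPoint c ξ a).snd = ξ a := rfl

theorem aeval_dualPoint {σ : Type*} [Fintype σ] (c ξ : σ → k) (f : MvPolynomial σ k) :
    (aeval (dualPoint c ξ) f).fst = eval c f ∧
      (aeval (dualPoint c ξ) f).snd = ∑ a, eval c (pderiv a f) * ξ a := by
  classical
  induction f using MvPolynomial.induction_on with
  | C r =>
    rw [algHom_C]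
    simp [TrivSqZeroExt.algebraMap_eq_inl]
  | add p q hp hq =>
    rw [map_add, TrivSqZeroExt.fst_add, TrivSqZeroExt.snd_add, hp.1, hp.2, hq.1, hq.2]
    simp [add_mul, Finset.sum_add_distrib]
  | mul_X p i hp =>
    rw [map_mul, aeval_X, TrivSqZeroExt.fst_mul, TrivSqZeroExt.snd_mul, hp.1, hp.2]
    refine ⟨by simp, ?_⟩
    have h1 : ∀ a, eval c (pderiv a (p * X i)) * ξ a =
        c i * (eval c (pderiv a p) * ξ a) + eval c p * ((if i = a then 1 else 0) * ξ a) := by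
      intro a
      rw [Derivation.leibniz, pderiv_X, smul_eq_mul, smul_eq_mul, map_add, map_mul, map_mul, eval_X]
      by_cases hia : i = a
      · subst hia
        simp
        ring
      · rw [Pi.single_eq_of_ne hia, if_neg hia]
        simp
        ring
    rw [Finset.sum_congr rfl fun a _ => h1 a, Finset.sum_add_distrib, ← Finset.mul_sum,
      ← Finset.mul_sum]
    simp
    ring

theorem mem_coneTangentSpace_iff {A : Finset (Fin (n + 1) →₀ ℕ)} {c ξ : A → k} :
    ξ ∈ coneTangentSpace k A c ↔
      ∀ f ∈ toricIdeal k A, (aeval (dualPoint c ξ) f).snd = 0 := by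
  refine forall₂_congr fun f _ => ?_
  rw [(aeval_dualPoint c ξ f).2]

/-- The binomial relation `y_a y_v ^ K = y_v ∏ y_{w_l} ^ κ_l`, where `K` is the sum of the
`κ_l`, given by `a - v = ∑ κ_l (w_l - v)`. -/
theorem binomial_mem_toricIdeal {A : Finset (Fin (n + 1) →₀ ℕ)} {v a : A} {w : Fin (n + 1) → A}
    {κ : Fin (n + 1) → ℕ}
    (h : (a : Fin (n + 1) →₀ ℕ) + (∑ l, κ l) • (v : Fin (n + 1) →₀ ℕ) =
      v + ∑ l, κ l • (w l : Fin (n + 1) →₀ ℕ)) :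
    X a * X v ^ (∑ l, κ l) - X v * ∏ l, X (w l) ^ κ l ∈ toricIdeal k A := by
  rw [mem_toricIdeal]
  intro s
  have h1 := congrArg (monomialValue s) h
  rw [monomialValue_add, monomialValue_add, monomialValue_nsmul, monomialValue_sum] at h1
  simp only [monomialValue_nsmul] at h1
  simp only [map_sub, map_mul, map_pow, map_prod, aeval_X]
  rw [h1, sub_self]

theorem mul_sub_sq_mem_toricIdeal {A : Finset (Fin (n + 1) →₀ ℕ)} {a b b' : A}
    (h : (b : Fin (n + 1) →₀ ℕ) + b' = a + a) :
    X b * X b' - X a * X a ∈ toricIdeal k A := by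
  rw [mem_toricIdeal]
  intro s
  have h1 := congrArg (monomialValue s) h
  rw [monomialValue_add, monomialValue_add] at h1
  simp only [map_sub, map_mul, aeval_X]
  rw [h1, sub_self]

/-- An affine chart of a toric variety which is an affine space: all exponents are obtained from
`w i₀` by adding multiples of the differences `w l - w i₀`, with coefficients `κ a l`, and these
differences, together with `w i₀`, define coordinates on the torus. The tangent vectors at a point
of the chart are given by their coordinates `w l`. -/
theorem finrank_coneTangentSpace_of_chart [Infinite k] {A : Finset (Fin (n + 1) →₀ ℕ)}
    (i₀ : Fin (n + 1)) (w : Fin (n + 1) → A) (κ : A → Fin (n + 1) → ℕ)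
    (hκ : ∀ a : A, (a : Fin (n + 1) →₀ ℕ) + (∑ l, κ a l) • (w i₀ : Fin (n + 1) →₀ ℕ) =
      w i₀ + ∑ l, κ a l • (w l : Fin (n + 1) →₀ ℕ))
    (hκ₀ : ∀ a, κ a i₀ = 0) (hκv : κ (w i₀) = 0) (hκw : ∀ l, l ≠ i₀ → κ (w l) = Pi.single l 1)
    (hlift : ∀ t : Fin (n + 1) → k, (∀ l, t l ≠ 0) → ∃ s : Fin (n + 1) → k,
      monomialValue s (w i₀) = t i₀ ∧ ∀ l, l ≠ i₀ → monomialValue s (w l) = t i₀ * t l)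
    {c : A → k} (hc : c ∈ zeroLocus k (toricIdeal k A)) (hcv : c (w i₀) ≠ 0) :
    Module.finrank k (coneTangentSpace k A c) = n + 1 := by
  classical
  -- the parametrization of the chart
  have hpar : ∀ f ∈ toricIdeal k A,
      aeval (fun a : A => (X i₀ : PolyRing k n) * ∏ l, X l ^ κ a l) f = 0 := by
    intro f hf
    rw [mem_toricIdeal] at hf
    have hprod : (∏ l, X l : PolyRing k n) ≠ 0 := Finset.prod_ne_zero_iff.2 fun l _ => X_ne_zero l
    refine (mul_eq_zero.1 (?_ : _ * (∏ l, X l : PolyRing k n) = 0)).resolve_right hprod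
    refine MvPolynomial.funext fun t => ?_
    rw [map_mul, map_zero, map_prod]
    by_cases ht : ∃ l, t l = 0
    · obtain ⟨l, hl⟩ := ht
      rw [Finset.prod_eq_zero (Finset.mem_univ l) (by rw [eval_X, hl]), mul_zero]
    · push Not at ht
      obtain ⟨s, hs0, hs⟩ := hlift t ht
      have hval : ∀ a : A, monomialValue s (a : Fin (n + 1) →₀ ℕ) =
          eval t ((X i₀ : PolyRing k n) * ∏ l, X l ^ κ a l) := by
        intro a
        have h1 := congrArg (monomialValue s) (hκ a)
        rw [monomialValue_add, monomialValue_add, monomialValue_nsmul, monomialValue_sum] at h1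
        simp only [monomialValue_nsmul] at h1
        have h2 : ∏ l, monomialValue s (w l : Fin (n + 1) →₀ ℕ) ^ κ a l =
            t i₀ ^ (∑ l, κ a l) * ∏ l, t l ^ κ a l := by
          rw [← Finset.prod_pow_eq_pow_sum, ← Finset.prod_mul_distrib]
          refine Finset.prod_congr rfl fun l _ => ?_
          by_cases hl : l = i₀
          · subst hl
            simp [hκ₀]
          · rw [hs l hl, mul_pow]
        rw [h2, hs0] at h1
        have h3 : t i₀ ^ (∑ l, κ a l) ≠ 0 := pow_ne_zero _ (ht i₀)
        simp only [map_mul, map_prod, map_pow, eval_X]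
        refine mul_right_cancel₀ h3 ?_
        rw [h1]
        ring
      have h4 := hf s
      rw [funext hval] at h4
      have h5 : eval t (aeval (fun a : A => (X i₀ : PolyRing k n) * ∏ l, X l ^ κ a l) f) = 0 := by
        rw [← h4, ← MvPolynomial.coe_aeval_eq_eval]
        exact (MvPolynomial.comp_aeval_apply _ (aeval t) f)
      rw [h5, zero_mul]
  have hpar' : ∀ (u : Fin (n + 1) → DualNumber k), ∀ f ∈ toricIdeal k A,
      aeval (fun a : A => u i₀ * ∏ l, u l ^ κ a l) f = 0 := by
    intro u f hf
    have h1 := congrArg (aeval u) (hpar f hf)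
    rw [map_zero, MvPolynomial.comp_aeval_apply] at h1
    simpa only [map_mul, map_prod, map_pow, aeval_X] using h1
  have hcrel : ∀ a : A, c a * c (w i₀) ^ (∑ l, κ a l) = c (w i₀) * ∏ l, c (w l) ^ κ a l := by
    intro a
    have := hc _ (binomial_mem_toricIdeal (k := k) (hκ a))
    simpa only [map_sub, map_mul, map_pow, map_prod, aeval_X, sub_eq_zero] using this
  let ev : coneTangentSpace k A c →ₗ[k] (Fin (n + 1) → k) :=
    (LinearMap.funLeft k k w).comp (coneTangentSpace k A c).subtype
  have hinj : Function.Injective ev := by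
    rw [injective_iff_map_eq_zero]
    rintro ⟨ξ, hξ⟩ h0
    have hw : ∀ l, ξ (w l) = 0 := fun l => congrFun h0 l
    refine Subtype.ext (funext fun a => ?_)
    have h1 := mem_coneTangentSpace_iff.1 hξ _ (binomial_mem_toricIdeal (k := k) (hκ a))
    have hdw : ∀ l, dualPoint c ξ (w l) = TrivSqZeroExt.inlHom k k (c (w l)) := fun l =>
      TrivSqZeroExt.ext rfl (hw l)
    simp only [map_sub, map_mul, map_pow, map_prod, aeval_X, hdw] at h1
    simp only [← map_mul, ← map_pow, ← map_prod] at h1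
    have h2 : ξ a * c (w i₀) ^ (∑ l, κ a l) = 0 := by
      rw [TrivSqZeroExt.snd_sub, TrivSqZeroExt.snd_mul] at h1
      simp only [TrivSqZeroExt.inlHom_apply, TrivSqZeroExt.snd_inl, TrivSqZeroExt.fst_inl,
        snd_dualPoint, smul_zero, zero_add, sub_zero, MulOpposite.smul_eq_mul_unop,
        MulOpposite.unop_op] at h1
      exact h1
    exact (mul_eq_zero.1 h2).resolve_right (pow_ne_zero _ hcv)
  have hsurj : Function.Surjective ev := by
    intro η
    let U : Fin (n + 1) → DualNumber k := fun l => (c (w l), η l)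
    have hU0 : (U i₀).fst ≠ 0 := hcv
    let u : Fin (n + 1) → DualNumber k := fun l => if l = i₀ then U i₀ else U l * (U i₀)⁻¹
    have hu0 : u i₀ = U i₀ := if_pos rfl
    have hul : ∀ l, l ≠ i₀ → U i₀ * u l = U l := by
      intro l hl
      rw [show u l = U l * (U i₀)⁻¹ from if_neg hl, mul_comm, mul_assoc,
        TrivSqZeroExt.inv_mul_cancel hU0, mul_one]
    let Y : A → DualNumber k := fun a => u i₀ * ∏ l, u l ^ κ a l
    have hYw : ∀ l, Y (w l) = U l := by
      intro l
      by_cases hl : l = i₀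
      · subst hl
        simp [Y, hκv, hu0]
      · simp only [Y, hκw l hl]
        rw [Finset.prod_eq_single l]
        · rw [Pi.single_eq_same, pow_one, hu0, hul l hl]
        · intro b _ hb
          rw [Pi.single_eq_of_ne hb, pow_zero]
        · simp
    have hfst : ∀ a, (Y a).fst = c a := by
      intro a
      have h1 : Y a * U i₀ ^ (∑ l, κ a l) = U i₀ * ∏ l, U l ^ κ a l := by
        rw [show Y a = u i₀ * ∏ l, u l ^ κ a l from rfl, hu0, ← Finset.prod_pow_eq_pow_sum,
          mul_assoc, ← Finset.prod_mul_distrib]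
        congr 1
        refine Finset.prod_congr rfl fun l _ => ?_
        by_cases hl : l = i₀
        · subst hl
          simp [hκ₀]
        · rw [← mul_pow, mul_comm, hul l hl]
      have h2 := congrArg (TrivSqZeroExt.fstHom k k k) h1
      simp only [map_mul, map_pow, map_prod, TrivSqZeroExt.fstHom_apply] at h2
      refine mul_right_cancel₀ (pow_ne_zero (∑ l, κ a l) hcv) ?_
      rw [hcrel a]
      exact h2
    refine ⟨⟨fun a => (Y a).snd, ?_⟩, ?_⟩
    · rw [mem_coneTangentSpace_iff]
      intro f hf
      have : dualPoint c (fun a => (Y a).snd) = Y := by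
        funext a
        exact TrivSqZeroExt.ext (hfst a).symm rfl
      rw [this, hpar' u f hf]
      rfl
    · funext l
      exact congrArg TrivSqZeroExt.snd (hYw l)
  rw [(LinearEquiv.ofBijective ev ⟨hinj, hsurj⟩).finrank_eq]
  simp

/-- On a toric variety some vertex coordinate of each point is nonzero: among the exponents with
nonzero coordinate choose one of maximal Euclidean length; if it is the midpoint of two other
exponents, the coordinates of these are nonzero too, and one of them is longer. -/
theorem exists_vertex_ne_zero {A : Finset (Fin (n + 1) →₀ ℕ)} {P : (Fin (n + 1) →₀ ℕ) → Prop}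
    (hP : ∀ a ∈ A, ¬ P a → ∃ b ∈ A, ∃ b' ∈ A, b ≠ a ∧ b + b' = a + a)
    {c : A → k} (hc : c ∈ zeroLocus k (toricIdeal k A)) (hc0 : c ≠ 0) :
    ∃ a : A, P a ∧ c a ≠ 0 := by
  classical
  have hne : (Finset.univ.filter fun a : A => c a ≠ 0).Nonempty := by
    obtain ⟨a, ha⟩ := Function.ne_iff.1 hc0
    exact ⟨a, by simpa using ha⟩
  obtain ⟨a, ha, hmax⟩ := Finset.exists_max_image _
    (fun a : A => ∑ i, (a : Fin (n + 1) →₀ ℕ) i ^ 2) hne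
  rw [Finset.mem_filter] at ha
  refine ⟨a, ?_, ha.2⟩
  by_contra hPa
  obtain ⟨b, hb, b', hb', hba, hsum⟩ := hP a a.2 hPa
  have hrel := hc _ (mul_sub_sq_mem_toricIdeal (k := k) (a := a)
    (b := ⟨b, hb⟩) (b' := ⟨b', hb'⟩) hsum)
  simp only [map_sub, map_mul, aeval_X, sub_eq_zero] at hrel
  have hprod : c ⟨b, hb⟩ * c ⟨b', hb'⟩ ≠ 0 := by
    rw [hrel]
    exact mul_ne_zero ha.2 ha.2
  have h1 := hmax ⟨b, hb⟩ (by simpa using left_ne_zero_of_mul hprod)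
  have h2 := hmax ⟨b', hb'⟩ (by simpa using right_ne_zero_of_mul hprod)
  simp only at h1 h2
  have hco : ∀ i, b i + b' i = (a : Fin (n + 1) →₀ ℕ) i + (a : Fin (n + 1) →₀ ℕ) i := fun i => by
    have := congrArg (fun x : Fin (n + 1) →₀ ℕ => x i) hsum
    simpa using this
  have hle : ∀ i, 2 * (a : Fin (n + 1) →₀ ℕ) i ^ 2 ≤ b i ^ 2 + b' i ^ 2 := by
    intro i
    have := hco i
    zify at this ⊢
    have hb' : (b' i : ℤ) = 2 * (a : Fin (n + 1) →₀ ℕ) i - b i := by linarith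
    rw [hb']
    nlinarith [sq_nonneg ((b i : ℤ) - (a : Fin (n + 1) →₀ ℕ) i)]
  obtain ⟨j, hj⟩ : ∃ j, b j ≠ (a : Fin (n + 1) →₀ ℕ) j := by
    by_contra h
    push Not at h
    exact hba (Finsupp.ext h)
  have hlt : 2 * (a : Fin (n + 1) →₀ ℕ) j ^ 2 < b j ^ 2 + b' j ^ 2 := by
    have := hco j
    zify at this ⊢
    have hb' : (b' j : ℤ) = 2 * (a : Fin (n + 1) →₀ ℕ) j - b j := by linarith
    rw [hb']
    have hpos : 0 < ((b j : ℤ) - (a : Fin (n + 1) →₀ ℕ) j) ^ 2 := by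
      have : (b j : ℤ) - (a : Fin (n + 1) →₀ ℕ) j ≠ 0 := by
        rw [sub_ne_zero]
        exact_mod_cast hj
      positivity
    nlinarith
  have hS := Finset.sum_lt_sum (fun i (_ : i ∈ Finset.univ) => hle i) ⟨j, Finset.mem_univ j, hlt⟩
  rw [Finset.sum_add_distrib, ← Finset.mul_sum] at hS
  omega

/-! ### Charts at the vertices of a truncated simplex -/

/-- The vertex on the edge from `i` to `j` next to `i`, for the simplex of exponents of degree `d`
truncated at the vertex `i` by the condition that the degree in `x_i` is at most `p`. -/
noncomputable def cutVertex (d p : ℕ) (i j : Fin (n + 1)) : Fin (n + 1) →₀ ℕ :=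
  Finsupp.single i p + Finsupp.single j (d - p)

/-- The exponents adjacent to `cutVertex d p i j` (for `l ≠ i`), and this vertex itself (for
`l = i`). -/
noncomputable def cutNeighbor (d p : ℕ) (i j l : Fin (n + 1)) : Fin (n + 1) →₀ ℕ :=
  if l = i then cutVertex d p i j
  else if l = j then Finsupp.single i (p - 1) + Finsupp.single j (d - p + 1)
  else Finsupp.single i p + Finsupp.single j (d - p - 1) + Finsupp.single l 1

/-- The coordinates of `a` in the chart at `cutVertex d p i j`. -/
def cutCoordinate (p : ℕ) (i j : Fin (n + 1)) (a : Fin (n + 1) →₀ ℕ) (l : Fin (n + 1)) : ℕ :=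
  if l = i then 0 else if l = j then p - a i else a l

theorem add_nsmul_cutVertex {d p : ℕ} (hp : 1 ≤ p) (hpd : p < d) {i j : Fin (n + 1)} (hij : i ≠ j)
    {a : Fin (n + 1) →₀ ℕ} (had : a.degree = d) (hai : a i ≤ p) :
    a + (∑ l, cutCoordinate p i j a l) • cutNeighbor d p i j i =
      cutNeighbor d p i j i + ∑ l, cutCoordinate p i j a l • cutNeighbor d p i j l := by
  classical
  have hv : cutNeighbor d p i j i = cutVertex d p i j := if_pos rfl
  rw [hv]
  ext x
  simp only [Finsupp.add_apply, Finsupp.smul_apply, smul_eq_mul, Finsupp.finsetSum_apply]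
  zify
  -- the difference of the two neighbors, as a function of `l`
  have hmain : ∀ g : Fin (n + 1) → ℤ,
      (∀ l, (cutCoordinate p i j a l : ℤ) * cutNeighbor d p i j l x =
        cutCoordinate p i j a l * cutVertex d p i j x + g l) →
      ∑ l, g l = a x - cutVertex d p i j x →
      (a x : ℤ) + (∑ l, (cutCoordinate p i j a l : ℤ)) * cutVertex d p i j x =
        cutVertex d p i j x + ∑ l, (cutCoordinate p i j a l : ℤ) * cutNeighbor d p i j l x := by
    intro g hg hsum
    rw [Finset.sum_congr rfl fun l _ => hg l, Finset.sum_add_distrib, hsum, Finset.sum_mul]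
    ring
  by_cases hxi : x = i
  · subst hxi
    refine hmain (fun l => if l = j then (a x : ℤ) - p else 0) ?_ ?_
    · intro l
      by_cases hl : l = x
      · subst hl
        simp [cutCoordinate, hij]
      · by_cases hlj : l = j
        · subst hlj
          simp [cutCoordinate, cutNeighbor, cutVertex, hl, Finsupp.single_eq_of_ne hij]
          push_cast [hp, hai]
          ring
        · simp [cutCoordinate, cutNeighbor, cutVertex, hl, hlj, Finsupp.single_eq_of_ne hij,
            Finsupp.single_eq_of_ne (Ne.symm hl)]
    · simp [cutVertex, Finsupp.single_eq_of_ne hij]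
  · by_cases hxj : x = j
    · subst hxj
      refine hmain (fun l => -(a l : ℤ) + (if l = i then (a i : ℤ) else 0) +
        if l = x then (a x : ℤ) + p - a i else 0) ?_ ?_
      · intro l
        by_cases hl : l = i
        · subst hl
          simp [cutCoordinate, hij]
        · by_cases hlj : l = x
          · subst hlj
            simp [cutCoordinate, cutNeighbor, cutVertex, hl, Finsupp.single_eq_of_ne hxi]
            push_cast [hpd.le, hai]
            ring
          · simp [cutCoordinate, cutNeighbor, cutVertex, hl, hlj, Finsupp.single_eq_of_ne hxi,
              Finsupp.single_eq_of_ne (Ne.symm hlj)]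
            rw [Nat.cast_sub (show 1 ≤ d - p by omega)]
            push_cast
            ring
      · have hd : ∑ l, (a l : ℤ) = d := by
          rw [← had, Finsupp.degree_eq_sum]
          push_cast
          rfl
        rw [Finset.sum_add_distrib, Finset.sum_add_distrib, Finset.sum_neg_distrib, hd]
        simp [cutVertex, Finsupp.single_eq_of_ne hxi]
        push_cast [hpd.le]
        ring
    · refine hmain (fun l => if l = x then (a x : ℤ) else 0) ?_ ?_
      · intro l
        by_cases hl : l = i
        · subst hl
          simp [cutCoordinate, Ne.symm hxi]
        · by_cases hlj : l = j
          · subst hlj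
            simp [cutCoordinate, cutNeighbor, cutVertex, hl, Finsupp.single_eq_of_ne hxi,
              Finsupp.single_eq_of_ne hxj, Ne.symm hxj]
          · by_cases hlx : l = x
            · subst hlx
              simp [cutCoordinate, cutNeighbor, cutVertex, hl, hlj, Finsupp.single_eq_of_ne hxi,
                Finsupp.single_eq_of_ne hxj]
            · simp [cutCoordinate, cutNeighbor, cutVertex, hl, hlj, Finsupp.single_eq_of_ne hxi,
                Finsupp.single_eq_of_ne hxj, hlx, Finsupp.single_eq_of_ne (Ne.symm hlx)]
      · simp [cutVertex, Finsupp.single_eq_of_ne hxi, Finsupp.single_eq_of_ne hxj]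

theorem exists_monomialValue_cutNeighbor [IsAlgClosed k] {d p : ℕ} (hp : 1 ≤ p) (hpd : p < d)
    {i j : Fin (n + 1)} (hij : i ≠ j) {t : Fin (n + 1) → k} (ht : ∀ l, t l ≠ 0) :
    ∃ s : Fin (n + 1) → k, monomialValue s (cutNeighbor d p i j i) = t i ∧
      ∀ l, l ≠ i → monomialValue s (cutNeighbor d p i j l) = t i * t l := by
  obtain ⟨z, hz⟩ := IsAlgClosed.exists_pow_nat_eq (t i / t j ^ (d - p)) (show 0 < d by omega)
  rw [eq_div_iff (pow_ne_zero _ (ht j))] at hz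
  obtain ⟨e, rfl⟩ : ∃ e, p = e + 1 := ⟨p - 1, by omega⟩
  obtain ⟨f, rfl⟩ : ∃ f, d = e + 1 + (f + 1) := ⟨d - (e + 1) - 1, by omega⟩
  simp only [Nat.add_sub_cancel_left] at hz
  set s : Fin (n + 1) → k := fun x => if x = i then z else if x = j then z * t j else z * t j * t x
    with hs
  have hsi : s i = z := if_pos rfl
  have hsj : s j = z * t j := by simp [hs, hij.symm]
  have hv : monomialValue s (cutVertex (e + 1 + (f + 1)) (e + 1) i j) = t i := by
    rw [cutVertex, monomialValue_add, monomialValue_single, monomialValue_single, hsi, hsj, ← hz,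
      Nat.add_sub_cancel_left]
    ring
  refine ⟨s, by rwa [cutNeighbor, if_pos rfl], fun l hl => ?_⟩
  rw [cutNeighbor, if_neg hl]
  split_ifs with hlj
  · subst hlj
    rw [monomialValue_add, monomialValue_single, monomialValue_single, hsi, hsj, ← hz,
      Nat.add_sub_cancel_left, Nat.add_sub_cancel]
    ring
  · have hsl : s l = z * t j * t l := by simp [hs, hl, hlj]
    rw [monomialValue_add, monomialValue_add, monomialValue_single, monomialValue_single,
      monomialValue_single, hsi, hsj, hsl, ← hz, Nat.add_sub_cancel_left, Nat.add_sub_cancel]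
    ring

/-- A criterion for smoothness. The exponents in `A` lie in the simplex truncated at its vertices,
so that the degree in `x_i` is at most `p i`; the vertices of this polytope and their neighbors
belong to `A`, and every other exponent in `A` is the midpoint of two others. -/
theorem finrank_coneTangentSpace_of_truncated [IsAlgClosed k] {A : Finset (Fin (n + 1) →₀ ℕ)}
    {d : ℕ} {p : Fin (n + 1) → ℕ} (hp : ∀ i, 1 ≤ p i) (hpd : ∀ i, p i < d)
    (hdeg : ∀ a ∈ A, a.degree = d) (hle : ∀ a ∈ A, ∀ i, a i ≤ p i)
    (hmem : ∀ i j l, i ≠ j → cutNeighbor d (p i) i j l ∈ A)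
    (hmid : ∀ a ∈ A, (∀ i j, i ≠ j → a ≠ cutVertex d (p i) i j) →
      ∃ b ∈ A, ∃ b' ∈ A, b ≠ a ∧ b + b' = a + a)
    {c : A → k} (hc : c ∈ zeroLocus k (toricIdeal k A)) (hc0 : c ≠ 0) :
    Module.finrank k (coneTangentSpace k A c) = n + 1 := by
  classical
  have : Infinite k := IsAlgClosed.instInfinite
  obtain ⟨a, ⟨i, j, hij, ha⟩, hca⟩ := exists_vertex_ne_zero
    (P := fun a => ∃ i j, i ≠ j ∧ a = cutVertex d (p i) i j) (by
      intro a haA hPa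
      push Not at hPa
      exact hmid a haA hPa) hc hc0
  have hai : a = ⟨cutNeighbor d (p i) i j i, hmem i j i hij⟩ :=
    Subtype.ext (ha.trans (if_pos rfl).symm)
  refine finrank_coneTangentSpace_of_chart i (fun l => ⟨cutNeighbor d (p i) i j l, hmem i j l hij⟩)
    (fun a => cutCoordinate (p i) i j a) ?_ ?_ ?_ ?_ ?_ hc (hai ▸ hca)
  · exact fun a => add_nsmul_cutVertex (hp i) (hpd i) hij (hdeg a a.2) (hle a a.2 i)
  · intro a
    exact if_pos rfl
  · funext l
    rw [cutCoordinate]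
    split_ifs with h1 h2
    · rfl
    · simp [cutNeighbor, cutVertex, Finsupp.single_eq_of_ne hij]
    · simp [cutNeighbor, cutVertex, Finsupp.single_eq_of_ne h1, Finsupp.single_eq_of_ne h2]
  · intro l hl
    funext x
    rw [cutCoordinate]
    by_cases hxl : x = l
    · subst hxl
      rw [if_neg hl, Pi.single_eq_same]
      split_ifs with h2
      · subst h2
        have := hp i
        simp [cutNeighbor, hl, Finsupp.single_eq_of_ne hij]
        omega
      · simp [cutNeighbor, hl, h2, Finsupp.single_eq_of_ne hl, Finsupp.single_eq_of_ne h2]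
    · rw [Pi.single_eq_of_ne hxl]
      split_ifs with h1 h2
      · rfl
      · subst h2
        simp [cutNeighbor, hl, Ne.symm hxl, Finsupp.single_eq_of_ne hij,
          Finsupp.single_eq_of_ne (Ne.symm hl)]
      · by_cases hlj : l = j
        · subst hlj
          simp [cutNeighbor, hl, Finsupp.single_eq_of_ne h1, Finsupp.single_eq_of_ne h2]
        · simp [cutNeighbor, hl, hlj, Finsupp.single_eq_of_ne h1, Finsupp.single_eq_of_ne h2,
            Finsupp.single_eq_of_ne hxl]
  · exact fun t ht => exists_monomialValue_cutNeighbor (hp i) (hpd i) hij ht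

/-! ### The trivial systems -/

theorem mem_inverseExponents {d : ℕ} {M : Finset (Fin (n + 1) →₀ ℕ)} (hM : ∀ m ∈ M, m.degree = d)
    {a : Fin (n + 1) →₀ ℕ} :
    a ∈ inverseExponents d (monomialIdeal k (M : Set (Fin (n + 1) →₀ ℕ))) ↔
      a.degree = d ∧ a ∉ M := by
  classical
  rw [inverseExponents, Finset.mem_filter, Finset.mem_finsuppAntidiag, Finsupp.degree_eq_sum]
  constructor
  · rintro ⟨⟨h1, _⟩, h2⟩
    refine ⟨h1, fun h => h2 ?_⟩
    exact (monomial_mem_monomialIdeal (M := (M : Set (Fin (n + 1) →₀ ℕ))) (fun m hm => hM m hm)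
      (hM a h)).2 h
  · rintro ⟨h1, h2⟩
    refine ⟨⟨h1, Finset.subset_univ _⟩, fun h => h2 ?_⟩
    exact (monomial_mem_monomialIdeal (M := (M : Set (Fin (n + 1) →₀ ℕ))) (fun m hm => hM m hm)
      (by rw [Finsupp.degree_eq_sum]; exact h1)).1 h

theorem two_mul_add_one_le_choose (hn : 2 ≤ n) {d : ℕ} (hd : 4 ≤ d) :
    2 * n + 1 ≤ (n + d - 1).choose (n - 1) := by
  have h1 : (n + 3).choose (n - 1) ≤ (n + d - 1).choose (n - 1) :=
    Nat.choose_le_choose _ (by omega)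
  refine le_trans ?_ h1
  rw [Nat.choose_symm_of_eq_add (show n + 3 = (n - 1) + 4 by omega)]
  induction n, hn using Nat.le_induction with
  | base => decide
  | succ m hm ih =>
    have h2 := ih (Nat.choose_le_choose _ (by omega))
    have h3 : (m + 1 + 3).choose 4 = (m + 3).choose 3 + (m + 3).choose 4 := by
      rw [show m + 1 + 3 = (m + 3) + 1 by omega, Nat.choose_succ_succ]
    have h4 : (3 + 1).choose 3 ≤ (m + 3).choose 3 := Nat.choose_le_choose _ (by omega)
    have h5 : (3 + 1).choose 3 = 4 := by decide
    omega

/-- Since `2 n + 1` is a lower bound for the number of generators, Togliatti systems with that many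
generators are minimal. -/
theorem mem_minimalSystems [CharZero k] (hn : 2 ≤ n) {d : ℕ} (hd : 4 ≤ d)
    {M : Finset (Fin (n + 1) →₀ ℕ)} (hM : ∀ m ∈ M, m.degree = d)
    (hcard : M.card ≤ 2 * n + 1) (hpure : ∀ i, Finsupp.single i d ∈ M)
    (hF : ∀ L : PolyRing k n, L.IsHomogeneous 1 → ∃ F : PolyRing k n, F ≠ 0 ∧
      F.IsHomogeneous (d - 1) ∧ L * F ∈ monomialIdeal k (M : Set (Fin (n + 1) →₀ ℕ))) :
    monomialIdeal k (M : Set (Fin (n + 1) →₀ ℕ)) ∈ minimalSystems k n d ∧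
      numGens (monomialIdeal k (M : Set (Fin (n + 1) →₀ ℕ))) = 2 * n + 1 := by
  have hT := isTogliattiSystem_of_forall_exists (by omega) (by omega) hM hpure
    (hcard.trans (two_mul_add_one_le_choose hn hd)) hF
  have hle := two_mul_add_one_le_card hn hd hM hT
  refine ⟨⟨⟨hT, _, rfl⟩, M, hM, rfl, ?_⟩, ?_⟩
  · intro M' hM' hT'
    have h1 := two_mul_add_one_le_card hn hd (fun m hm => hM m (hM'.1 hm)) hT'.1
    have h2 := Finset.card_lt_card hM'
    omega
  · rw [numGens_monomialIdeal hM]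
    omega

theorem apply_add_apply_le_degree {i j : Fin (n + 1)} (hij : i ≠ j) (a : Fin (n + 1) →₀ ℕ) :
    a i + a j ≤ a.degree := by
  rw [Finsupp.degree_eq_sum, ← Finset.sum_pair (f := fun x => a x) hij]
  exact Finset.sum_le_sum_of_subset (Finset.subset_univ _)

theorem eq_single_of_apply_eq {d : ℕ} {a : Fin (n + 1) →₀ ℕ} (hd : a.degree = d) {i : Fin (n + 1)}
    (hi : a i = d) : a = Finsupp.single i d := by
  ext x
  by_cases hx : x = i
  · subst hx
    rw [Finsupp.single_eq_same, hi]
  · have := apply_add_apply_le_degree (Ne.symm hx) a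
    rw [Finsupp.single_eq_of_ne hx]
    omega

theorem eq_single_add_single_of_apply {d p : ℕ} {a : Fin (n + 1) →₀ ℕ} (hd : a.degree = d)
    {i : Fin (n + 1)} (hi : a i = p) (hp : p + 1 = d) :
    ∃ l, l ≠ i ∧ a = Finsupp.single i p + Finsupp.single l 1 := by
  have hle : Finsupp.single i p ≤ a := Finsupp.single_le_iff.2 hi.ge
  obtain ⟨b, rfl⟩ := le_iff_exists_add.1 hle
  rw [map_add, Finsupp.degree_single] at hd
  have hb : b.degree = 1 := by omega
  obtain ⟨l, hl⟩ : ∃ l, b l ≠ 0 := by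
    by_contra h
    push Not at h
    rw [show b = 0 from Finsupp.ext h] at hb
    simp at hb
  have hl1 : b l = 1 := by
    have := Finsupp.le_degree l b
    omega
  refine ⟨l, ?_, by rw [← eq_single_of_apply_eq hb hl1]⟩
  rintro rfl
  simp at hi
  omega

theorem degree_cutNeighbor {d p : ℕ} (hp : 1 ≤ p) (hpd : p < d) (i j l : Fin (n + 1)) :
    (cutNeighbor d p i j l).degree = d := by
  rw [cutNeighbor, cutVertex]
  split_ifs <;> simp only [map_add, Finsupp.degree_single] <;> omega

theorem cutNeighbor_apply_le {d : ℕ} {p : Fin (n + 1) → ℕ} (hp : ∀ i, 1 ≤ p i)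
    (hpd : ∀ i, p i < d) (hpp : ∀ i j, i ≠ j → d + 1 ≤ p i + p j) {i j : Fin (n + 1)} (hij : i ≠ j)
    (l x : Fin (n + 1)) : cutNeighbor d (p i) i j l x ≤ p x := by
  have h1 := hpp i j hij
  have h2 := hp x
  have h3 := hpd i
  rw [cutNeighbor, cutVertex]
  by_cases hxi : x = i
  · subst hxi
    split_ifs with hl hlj <;>
      simp [Finsupp.single_eq_of_ne hij, *]
  · by_cases hxj : x = j
    · subst hxj
      split_ifs with hl hlj
      · simp [Finsupp.single_eq_of_ne hxi]
        omega
      · simp [Finsupp.single_eq_of_ne hxi]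
        omega
      · simp [Finsupp.single_eq_of_ne hxi, Finsupp.single_eq_of_ne (Ne.symm hlj)]
        omega
    · split_ifs with hl hlj
      · simp [Finsupp.single_eq_of_ne hxi, Finsupp.single_eq_of_ne hxj]
      · simp [Finsupp.single_eq_of_ne hxi, Finsupp.single_eq_of_ne hxj]
      · by_cases hxl : x = l
        · subst hxl
          simp [Finsupp.single_eq_of_ne hxi, Finsupp.single_eq_of_ne hxj, h2]
        · simp [Finsupp.single_eq_of_ne hxi, Finsupp.single_eq_of_ne hxj,
            Finsupp.single_eq_of_ne hxl]

/-- In a truncated simplex, an exponent without two coordinates which can be both increased and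
decreased is a vertex. -/
theorem eq_cutVertex_of_forall {d : ℕ} {p : Fin (n + 1) → ℕ}
    (hpd : ∀ i, p i < d) (hpp : ∀ i j, i ≠ j → d + 1 ≤ p i + p j) {a : Fin (n + 1) →₀ ℕ}
    (had : a.degree = d) (hap : ∀ i, a i ≤ p i)
    (h : ∀ x y, x ≠ y → 0 < a x → a x < p x → 0 < a y → a y < p y → False) :
    ∃ i j, i ≠ j ∧ a = cutVertex d (p i) i j := by
  have hother : ∀ i, (∀ x, x ≠ i → a x = 0) → a i = d := by
    intro i hi
    rw [← had, Finsupp.degree_eq_sum, Finset.sum_eq_single i]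
    · exact fun x _ hx => hi x hx
    · simp
  obtain ⟨i, hi⟩ : ∃ i, a i = p i := by
    by_contra hno
    push Not at hno
    have hlt : ∀ x, a x < p x := fun x => lt_of_le_of_ne (hap x) (hno x)
    obtain ⟨x, hx⟩ : ∃ x, a x ≠ 0 := by
      by_contra h0
      push Not at h0
      have := hother 0 fun x _ => h0 x
      have := h0 0
      have := hpd 0
      omega
    have := hother x fun y hy => by
      by_contra h0
      exact h x y hy.symm (by omega) (hlt x) (by omega) (hlt y)
    have := hap x
    have := hpd x
    omega
  obtain ⟨j, hji, hj⟩ : ∃ j, j ≠ i ∧ a j ≠ 0 := by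
    by_contra h0
    push Not at h0
    have := hother i h0
    have := hpd i
    omega
  have hlt : ∀ y, y ≠ i → a y < p y := by
    intro y hy
    have h1 := apply_add_apply_le_degree hy a
    have h2 := hpp y i hy
    omega
  have hzero : ∀ y, y ≠ i → y ≠ j → a y = 0 := by
    intro y hyi hyj
    by_contra h0
    exact h j y (Ne.symm hyj) (by omega) (hlt j hji) (by omega) (hlt y hyi)
  have hsum : a i + a j = d := by
    rw [← had, Finsupp.degree_eq_sum, ← Finset.sum_pair (f := fun x => a x) hji.symm]
    refine Finset.sum_subset (Finset.subset_univ _) fun x _ hx => ?_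
    simp only [Finset.mem_insert, Finset.mem_singleton, not_or] at hx
    exact hzero x hx.1 hx.2
  refine ⟨i, j, hji.symm, ?_⟩
  ext x
  by_cases hxi : x = i
  · subst hxi
    simp [cutVertex, Finsupp.single_eq_of_ne hji.symm, hi]
  · by_cases hxj : x = j
    · subst hxj
      simp [cutVertex, Finsupp.single_eq_of_ne hxi]
      omega
    · simp [cutVertex, Finsupp.single_eq_of_ne hxi, Finsupp.single_eq_of_ne hxj, hzero x hxi hxj]

theorem exists_midpoint {d : ℕ} {p : Fin (n + 1) → ℕ} {a : Fin (n + 1) →₀ ℕ}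
    (had : a.degree = d) (hap : ∀ i, a i ≤ p i) {x y : Fin (n + 1)} (hxy : x ≠ y)
    (hx : 0 < a x) (hxp : a x < p x) (hy : 0 < a y) (hyp : a y < p y) :
    ∃ b b' : Fin (n + 1) →₀ ℕ, (b.degree = d ∧ ∀ i, b i ≤ p i) ∧
      (b'.degree = d ∧ ∀ i, b' i ≤ p i) ∧ b ≠ a ∧ b + b' = a + a := by
  have key : ∀ x y : Fin (n + 1), x ≠ y → 0 < a y → a x < p x →
      (a - Finsupp.single y 1 + Finsupp.single x 1).degree = d ∧
        ∀ i, (a - Finsupp.single y 1 + Finsupp.single x 1 : Fin (n + 1) →₀ ℕ) i ≤ p i := by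
    intro x y hxy hy hxp
    have hle : Finsupp.single y 1 ≤ a := Finsupp.single_le_iff.2 hy
    have h1 := congrArg Finsupp.degree (tsub_add_cancel_of_le hle)
    rw [map_add, Finsupp.degree_single, had] at h1
    refine ⟨by rw [map_add, Finsupp.degree_single, h1], fun i => ?_⟩
    have := hap i
    by_cases hix : i = x
    · subst hix
      simp [Finsupp.single_eq_of_ne hxy]
      omega
    · simp [Finsupp.single_eq_of_ne hix]
      omega
  refine ⟨_, _, key x y hxy hy hxp, key y x hxy.symm hx hyp, ?_, ?_⟩
  · intro h
    have := congrArg (fun c : Fin (n + 1) →₀ ℕ => c x) h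
    simp [Finsupp.single_eq_of_ne hxy] at this
  · ext i
    by_cases hix : i = x
    · subst hix
      simp [Finsupp.single_eq_of_ne hxy]
      omega
    · by_cases hiy : i = y
      · subst hiy
        simp [Finsupp.single_eq_of_ne hix]
        omega
      · simp [Finsupp.single_eq_of_ne hix, Finsupp.single_eq_of_ne hiy]

/-- The exponents of the generators of the trivial system given by the form `x_0 ^ (d - 1)`. -/
noncomputable def trivialExponents (n d : ℕ) : Finset (Fin (n + 1) →₀ ℕ) := by
  classical
  exact purePowers n d ∪
    (Finset.univ.erase 0).image fun l => Finsupp.single 0 (d - 1) + Finsupp.single l 1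

theorem mem_trivialExponents {d : ℕ} {m : Fin (n + 1) →₀ ℕ} :
    m ∈ trivialExponents n d ↔ (∃ i, m = Finsupp.single i d) ∨
      ∃ l, l ≠ 0 ∧ m = Finsupp.single 0 (d - 1) + Finsupp.single l 1 := by
  classical
  simp [trivialExponents, mem_purePowers, eq_comm]

theorem degree_of_mem_trivialExponents {d : ℕ} (hd : 1 ≤ d) {m : Fin (n + 1) →₀ ℕ}
    (hm : m ∈ trivialExponents n d) : m.degree = d := by
  rw [mem_trivialExponents] at hm
  obtain ⟨i, rfl⟩ | ⟨l, _, rfl⟩ := hm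
  · simp
  · rw [map_add, Finsupp.degree_single, Finsupp.degree_single]
    omega

theorem card_trivialExponents_le {d : ℕ} (hd : 1 ≤ d) :
    (trivialExponents n d).card ≤ 2 * n + 1 := by
  classical
  refine (Finset.card_union_le _ _).trans ?_
  have h1 : (purePowers n d).card = n + 1 := card_purePowers (by omega)
  have h2 := Finset.card_image_le (s := Finset.univ.erase (0 : Fin (n + 1)))
    (f := fun l : Fin (n + 1) => Finsupp.single (0 : Fin (n + 1)) (d - 1) + Finsupp.single l 1)
  rw [Finset.card_erase_of_mem (Finset.mem_univ _), Finset.card_univ, Fintype.card_fin] at h2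
  omega

theorem trivialExponents_mem_minimalSystems [CharZero k] (hn : 2 ≤ n) {d : ℕ} (hd : 4 ≤ d) :
    monomialIdeal k (trivialExponents n d : Set (Fin (n + 1) →₀ ℕ)) ∈ minimalSystems k n d ∧
      numGens (monomialIdeal k (trivialExponents n d : Set (Fin (n + 1) →₀ ℕ))) = 2 * n + 1 := by
  have hpure : ∀ i, Finsupp.single i d ∈ trivialExponents n d :=
    fun i => mem_trivialExponents.2 (Or.inl ⟨i, rfl⟩)
  refine mem_minimalSystems hn hd (fun m hm => degree_of_mem_trivialExponents (by omega) hm)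
    (card_trivialExponents_le (by omega)) hpure ?_
  obtain ⟨F, hF, hFd, hmem⟩ := isTrivial_of_forall_mem (k := k) (by omega) (hpure 0)
    (fun l hl => mem_trivialExponents.2 (Or.inr ⟨l, hl, rfl⟩))
  intro L hL
  refine ⟨F, hF, hFd, ?_⟩
  have hL' : L ∈ homogeneousSubmodule (Fin (n + 1)) k 1 := hL
  rw [homogeneousSubmodule_one_eq_span_X, Submodule.mem_span_range_iff_exists_fun] at hL'
  obtain ⟨c, rfl⟩ := hL'
  rw [Finset.sum_mul]
  refine Ideal.sum_mem _ fun i _ => ?_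
  rw [smul_eq_C_mul, mul_assoc]
  exact Ideal.mul_mem_left _ _ (hmem i)

/-- The degree bounds of the truncated simplex complementary to `trivialExponents`. -/
def trivialBound (n d : ℕ) (i : Fin (n + 1)) : ℕ := if i = 0 then d - 2 else d - 1

theorem notMem_trivialExponents_iff {d : ℕ} (hd : 4 ≤ d) {a : Fin (n + 1) →₀ ℕ}
    (had : a.degree = d) : a ∉ trivialExponents n d ↔ ∀ i, a i ≤ trivialBound n d i := by
  rw [mem_trivialExponents]
  constructor
  · intro h i
    by_contra hlt
    apply h
    have hle := Finsupp.le_degree i a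
    rw [trivialBound] at hlt
    by_cases hid : a i = d
    · exact Or.inl ⟨i, eq_single_of_apply_eq had hid⟩
    · split_ifs at hlt with hi
      · subst hi
        right
        have h1 : a 0 = d - 1 := by omega
        exact eq_single_add_single_of_apply had h1 (by omega)
      · omega
  · rintro h (⟨i, rfl⟩ | ⟨l, hl, rfl⟩)
    · have := h i
      rw [Finsupp.single_eq_same, trivialBound] at this
      split_ifs at this <;> omega
    · have := h 0
      simp [trivialBound, Finsupp.single_eq_of_ne (Ne.symm hl)] at this
      omega

theorem isSmoothSystem_trivialExponents [IsAlgClosed k] {d : ℕ} (hd : 4 ≤ d) :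
    IsSmoothSystem d (monomialIdeal k (trivialExponents n d : Set (Fin (n + 1) →₀ ℕ))) := by
  intro c hc hc0
  have hp : ∀ i, 1 ≤ trivialBound n d i := fun i => by
    rw [trivialBound]
    split_ifs <;> omega
  have hpd : ∀ i, trivialBound n d i < d := fun i => by
    rw [trivialBound]
    split_ifs <;> omega
  have hpp : ∀ i j, i ≠ j → d + 1 ≤ trivialBound n d i + trivialBound n d j := fun i j hij => by
    rw [trivialBound, trivialBound]
    split_ifs with h1 h2
    · exact absurd (h1.trans h2.symm) hij
    all_goals omega
  have hA : ∀ a, a ∈ inverseExponents d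
      (monomialIdeal k (trivialExponents n d : Set (Fin (n + 1) →₀ ℕ))) ↔
      a.degree = d ∧ ∀ i, a i ≤ trivialBound n d i := by
    intro a
    rw [mem_inverseExponents fun m hm => degree_of_mem_trivialExponents (by omega) hm]
    exact and_congr_right fun h => notMem_trivialExponents_iff hd h
  refine finrank_coneTangentSpace_of_truncated hp hpd (fun a ha => ((hA a).1 ha).1)
    (fun a ha => ((hA a).1 ha).2) (fun i j l hij => (hA _).2
      ⟨degree_cutNeighbor (hp i) (hpd i) i j l,
      cutNeighbor_apply_le hp hpd hpp hij l⟩) ?_ hc hc0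
  intro a ha hv
  obtain ⟨had, hap⟩ := (hA a).1 ha
  by_contra hno
  obtain ⟨i, j, hij, hij'⟩ := eq_cutVertex_of_forall hpd hpp had hap (by
    intro x y hxy hx hxp hy hyp
    obtain ⟨b, b', hb, hb', hne, hsum⟩ := exists_midpoint had hap hxy hx hxp hy hyp
    exact hno ⟨b, (hA b).2 hb, b', (hA b').2 hb', hne, hsum⟩)
  exact hv i j hij hij'

/-! ### The two exceptional systems -/

theorem exists_linear_form_eq (e : Fin 3 ≃ Fin (2 + 1)) {L : PolyRing k 2}
    (hL : L.IsHomogeneous 1) :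
    ∃ a b c : k, L = C a * X (e 0) + C b * X (e 1) + C c * X (e 2) := by
  have hL' : L ∈ homogeneousSubmodule (Fin (2 + 1)) k 1 := hL
  rw [homogeneousSubmodule_one_eq_span_X, Submodule.mem_span_range_iff_exists_fun] at hL'
  obtain ⟨c, rfl⟩ := hL'
  refine ⟨c (e 0), c (e 1), c (e 2), ?_⟩
  rw [← e.sum_comp, Fin.sum_univ_three]
  simp only [smul_eq_C_mul]

theorem mul_mem_monomialIdeal {e : Fin 3 ≃ Fin (2 + 1)} {M : Finset (Fin (2 + 1) →₀ ℕ)}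
    {p q r : ℕ} (h : triExponent e p q r ∈ M) (a b c : k) :
    (C a * X (e 0)) ^ p * (C b * X (e 1)) ^ q * (C c * X (e 2)) ^ r ∈
      monomialIdeal k (M : Set (Fin (2 + 1) →₀ ℕ)) := by
  have h1 : (C a * X (e 0)) ^ p * (C b * X (e 1)) ^ q * (C c * X (e 2)) ^ r =
      C (a ^ p * b ^ q * c ^ r) * monomial (triExponent e p q r) (1 : k) := by
    rw [monomial_triExponent]
    simp only [map_mul, map_pow]
    ring
  rw [h1]
  exact Ideal.mul_mem_left _ _ (Ideal.subset_span ⟨_, h, rfl⟩)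

theorem isHomogeneous_term {σ : Type*} {u v w : MvPolynomial σ k} (hu : u.IsHomogeneous 1)
    (hv : v.IsHomogeneous 1) (hw : w.IsHomogeneous 1) {N : ℕ} (r : k) (p q s : ℕ)
    (h : p + q + s = N) : (C r * (u ^ p * v ^ q * w ^ s)).IsHomogeneous N := by
  have := ((isHomogeneous_C σ r).mul (((hu.pow p).mul (hv.pow q)).mul (hw.pow s)))
  convert this using 1
  omega

/-- The quotient of `u ^ 5 + v ^ 5 + w ^ 5 - 5 u ^ 3 v w + 5 u v ^ 2 w ^ 2` by `u + v + w`. -/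
theorem exists_quintic_quotient {σ : Type*} {u v w : MvPolynomial σ k} (hu : u.IsHomogeneous 1)
    (hv : v.IsHomogeneous 1) (hw : w.IsHomogeneous 1) :
    ∃ F : MvPolynomial σ k, F.IsHomogeneous 4 ∧
      (u + v + w) * F = u ^ 5 + v ^ 5 + w ^ 5 - 5 * (u ^ 3 * v ^ 1 * w ^ 1) +
        5 * (u ^ 1 * v ^ 2 * w ^ 2) := by
  have h := fun (r : k) (p q s : ℕ) (hh : p + q + s = 4) => isHomogeneous_term hu hv hw r p q s hh
  refine ⟨_, ((((((((((((((h 1 4 0 0 rfl).add (h (-1) 3 1 0 rfl)).add (h (-1) 3 0 1 rfl)).add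
    (h 1 2 2 0 rfl)).add (h (-3) 2 1 1 rfl)).add (h 1 2 0 2 rfl)).add (h (-1) 1 3 0 rfl)).add
    (h 2 1 2 1 rfl)).add (h 2 1 1 2 rfl)).add (h (-1) 1 0 3 rfl)).add (h 1 0 4 0 rfl)).add
    (h (-1) 0 3 1 rfl)).add (h 1 0 2 2 rfl)).add (h (-1) 0 1 3 rfl)).add (h 1 0 0 4 rfl), ?_⟩
  simp only [map_neg, map_one, map_ofNat]
  ring

/-- The quotient of `u ^ 4 + v ^ 4 - w ^ 4 + 4 u v w ^ 2 - 2 u ^ 2 v ^ 2` by `u + v + w`. -/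
theorem exists_quartic_quotient {σ : Type*} {u v w : MvPolynomial σ k} (hu : u.IsHomogeneous 1)
    (hv : v.IsHomogeneous 1) (hw : w.IsHomogeneous 1) :
    ∃ F : MvPolynomial σ k, F.IsHomogeneous 3 ∧
      (u + v + w) * F = u ^ 4 + v ^ 4 - w ^ 4 + 4 * (u ^ 1 * v ^ 1 * w ^ 2) -
        2 * (u ^ 2 * v ^ 2) := by
  have h := fun (r : k) (p q s : ℕ) (hh : p + q + s = 3) => isHomogeneous_term hu hv hw r p q s hh
  refine ⟨_, (((((((((h 1 3 0 0 rfl).add (h (-1) 2 1 0 rfl)).add (h (-1) 2 0 1 rfl)).add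
    (h (-1) 1 2 0 rfl)).add (h 2 1 1 1 rfl)).add (h 1 1 0 2 rfl)).add (h 1 0 3 0 rfl)).add
    (h (-1) 0 2 1 rfl)).add (h 1 0 1 2 rfl)).add (h (-1) 0 0 3 rfl), ?_⟩
  simp only [map_neg, map_one, map_ofNat]
  ring

theorem isHomogeneous_C_mul_X {σ : Type*} (a : k) (i : σ) :
    (C a * X i : MvPolynomial σ k).IsHomogeneous 1 := by
  simpa using (isHomogeneous_C σ a).mul (isHomogeneous_X k i)

theorem degree_of_mem_quinticExponents {e : Fin 3 ≃ Fin (2 + 1)} {m : Fin (2 + 1) →₀ ℕ}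
    (hm : m ∈ quinticExponents e) : m.degree = 5 := by
  rw [mem_quinticExponents] at hm
  rcases hm with rfl | rfl | rfl | rfl | rfl <;> simp [degree_triExponent]

theorem degree_of_mem_quarticExponents {e : Fin 3 ≃ Fin (2 + 1)} {m : Fin (2 + 1) →₀ ℕ}
    (hm : m ∈ quarticExponents e) : m.degree = 4 := by
  rw [mem_quarticExponents] at hm
  rcases hm with rfl | rfl | rfl | rfl | rfl <;> simp [degree_triExponent]

theorem quinticExponents_mem_minimalSystems [CharZero k] (e : Fin 3 ≃ Fin (2 + 1)) :
    monomialIdeal k (quinticExponents e : Set (Fin (2 + 1) →₀ ℕ)) ∈ minimalSystems k 2 5 ∧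
      numGens (monomialIdeal k (quinticExponents e : Set (Fin (2 + 1) →₀ ℕ))) = 5 := by
  classical
  have h1 : triExponent e 5 0 0 ∈ quinticExponents e := by simp [mem_quinticExponents]
  have h2 : triExponent e 0 5 0 ∈ quinticExponents e := by simp [mem_quinticExponents]
  have h3 : triExponent e 0 0 5 ∈ quinticExponents e := by simp [mem_quinticExponents]
  have h4 : triExponent e 3 1 1 ∈ quinticExponents e := by simp [mem_quinticExponents]
  have h5 : triExponent e 1 2 2 ∈ quinticExponents e := by simp [mem_quinticExponents]
  refine mem_minimalSystems le_rfl (by omega) (fun m hm => degree_of_mem_quinticExponents hm)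
    Finset.card_le_five ?_ ?_
  · intro i
    have hi := (mem_purePowers_two e).1 (mem_purePowers.2 ⟨i, rfl⟩ : Finsupp.single i 5 ∈ _)
    rcases hi with hi | hi | hi <;> rw [hi] <;> assumption
  · intro L hL
    obtain ⟨a, b, c, rfl⟩ := exists_linear_form_eq e hL
    by_cases h0 : a = 0 ∧ b = 0 ∧ c = 0
    · obtain ⟨rfl, rfl, rfl⟩ := h0
      refine ⟨X 0 ^ 4, pow_ne_zero _ (X_ne_zero 0), isHomogeneous_X_pow 0 4, ?_⟩
      simp
    · obtain ⟨F, hF, hmul⟩ := exists_quintic_quotient (isHomogeneous_C_mul_X a (e 0))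
        (isHomogeneous_C_mul_X b (e 1)) (isHomogeneous_C_mul_X c (e 2))
      refine ⟨F, ?_, hF, ?_⟩
      · rintro rfl
        rw [mul_zero] at hmul
        apply h0
        have e0 := congrArg (eval (Pi.single (e 0) 1)) hmul
        have e1 := congrArg (eval (Pi.single (e 1) 1)) hmul
        have e2 := congrArg (eval (Pi.single (e 2) 1)) hmul
        simp at e0 e1 e2
        exact ⟨(pow_eq_zero_iff (by norm_num)).1 e0.symm,
          (pow_eq_zero_iff (by norm_num)).1 e1.symm, (pow_eq_zero_iff (by norm_num)).1 e2.symm⟩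
      · rw [hmul]
        have m1 := mul_mem_monomialIdeal h1 a b c
        have m2 := mul_mem_monomialIdeal h2 a b c
        have m3 := mul_mem_monomialIdeal h3 a b c
        have m4 := mul_mem_monomialIdeal h4 a b c
        have m5 := mul_mem_monomialIdeal h5 a b c
        rw [pow_zero, pow_zero, mul_one, mul_one] at m1
        rw [pow_zero, pow_zero, one_mul, mul_one] at m2
        rw [pow_zero, pow_zero, one_mul, one_mul] at m3
        exact Ideal.add_mem _ (Ideal.sub_mem _ (Ideal.add_mem _ (Ideal.add_mem _ m1 m2) m3)
          (Ideal.mul_mem_left _ _ m4)) (Ideal.mul_mem_left _ _ m5)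

theorem quarticExponents_mem_minimalSystems [CharZero k] (e : Fin 3 ≃ Fin (2 + 1)) :
    monomialIdeal k (quarticExponents e : Set (Fin (2 + 1) →₀ ℕ)) ∈ minimalSystems k 2 4 ∧
      numGens (monomialIdeal k (quarticExponents e : Set (Fin (2 + 1) →₀ ℕ))) = 5 := by
  classical
  have h1 : triExponent e 4 0 0 ∈ quarticExponents e := by simp [mem_quarticExponents]
  have h2 : triExponent e 0 4 0 ∈ quarticExponents e := by simp [mem_quarticExponents]
  have h3 : triExponent e 0 0 4 ∈ quarticExponents e := by simp [mem_quarticExponents]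
  have h4 : triExponent e 1 1 2 ∈ quarticExponents e := by simp [mem_quarticExponents]
  have h5 : triExponent e 2 2 0 ∈ quarticExponents e := by simp [mem_quarticExponents]
  refine mem_minimalSystems le_rfl (by omega) (fun m hm => degree_of_mem_quarticExponents hm)
    Finset.card_le_five ?_ ?_
  · intro i
    have hi := (mem_purePowers_two e).1 (mem_purePowers.2 ⟨i, rfl⟩ : Finsupp.single i 4 ∈ _)
    rcases hi with hi | hi | hi <;> rw [hi] <;> assumption
  · intro L hL
    obtain ⟨a, b, c, rfl⟩ := exists_linear_form_eq e hL
    by_cases h0 : a = 0 ∧ b = 0 ∧ c = 0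
    · obtain ⟨rfl, rfl, rfl⟩ := h0
      refine ⟨X 0 ^ 3, pow_ne_zero _ (X_ne_zero 0), isHomogeneous_X_pow 0 3, ?_⟩
      simp
    · obtain ⟨F, hF, hmul⟩ := exists_quartic_quotient (isHomogeneous_C_mul_X a (e 0))
        (isHomogeneous_C_mul_X b (e 1)) (isHomogeneous_C_mul_X c (e 2))
      refine ⟨F, ?_, hF, ?_⟩
      · rintro rfl
        rw [mul_zero] at hmul
        apply h0
        have e0 := congrArg (eval (Pi.single (e 0) 1)) hmul
        have e1 := congrArg (eval (Pi.single (e 1) 1)) hmul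
        have e2 := congrArg (eval (Pi.single (e 2) 1)) hmul
        simp at e0 e1 e2
        exact ⟨(pow_eq_zero_iff (by norm_num)).1 e0.symm,
          (pow_eq_zero_iff (by norm_num)).1 e1.symm, e2⟩
      · rw [hmul]
        have m1 := mul_mem_monomialIdeal h1 a b c
        have m2 := mul_mem_monomialIdeal h2 a b c
        have m3 := mul_mem_monomialIdeal h3 a b c
        have m4 := mul_mem_monomialIdeal h4 a b c
        have m5 := mul_mem_monomialIdeal h5 a b c
        rw [pow_zero, pow_zero, mul_one, mul_one] at m1
        rw [pow_zero, pow_zero, one_mul, mul_one] at m2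
        rw [pow_zero, pow_zero, one_mul, one_mul] at m3
        rw [pow_zero, mul_one] at m5
        exact Ideal.sub_mem _ (Ideal.add_mem _ (Ideal.sub_mem _ (Ideal.add_mem _ m1 m2) m3)
          (Ideal.mul_mem_left _ _ m4)) (Ideal.mul_mem_left _ _ m5)

/-- An ideal generated by monomials is trivial only if it contains all products of some monomial
with the variables: any monomial of the form `F` has this property. -/
theorem exists_exponent_of_isTrivial {n d : ℕ} (hd : 1 ≤ d) {M : Finset (Fin (n + 1) →₀ ℕ)}
    (hM : ∀ m ∈ M, m.degree = d)
    (h : IsTrivial d (monomialIdeal k (M : Set (Fin (n + 1) →₀ ℕ)))) :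
    ∃ a : Fin (n + 1) →₀ ℕ, ∀ i, a + Finsupp.single i 1 ∈ M := by
  classical
  obtain ⟨F, hF, hFd, hmem⟩ := h
  obtain ⟨a, ha⟩ := ne_zero_iff.1 hF
  refine ⟨a, fun i => ?_⟩
  have hXF : (X i * F).IsHomogeneous d := by
    have := (isHomogeneous_X k i).mul hFd
    rwa [show 1 + (d - 1) = d by omega] at this
  refine (mem_monomialIdeal_of_isHomogeneous (M := (M : Set (Fin (n + 1) →₀ ℕ)))
    (fun m hm => hM m hm) hXF).1 (hmem i) _ ?_
  rw [add_comm a, coeff_X_mul]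
  exact ha

theorem triExponent_add_single (e : Fin 3 ≃ Fin (2 + 1)) (a : Fin (2 + 1) →₀ ℕ) :
    a + Finsupp.single (e 0) 1 = triExponent e (a (e 0) + 1) (a (e 1)) (a (e 2)) ∧
    a + Finsupp.single (e 1) 1 = triExponent e (a (e 0)) (a (e 1) + 1) (a (e 2)) ∧
    a + Finsupp.single (e 2) 1 = triExponent e (a (e 0)) (a (e 1)) (a (e 2) + 1) := by
  refine ⟨?_, ?_, ?_⟩ <;> rw [eq_triExponent_iff] <;> simp

theorem triExponent_inj {e : Fin 3 ≃ Fin (2 + 1)} {a b c a' b' c' : ℕ} :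
    triExponent e a b c = triExponent e a' b' c' ↔ a = a' ∧ b = b' ∧ c = c' := by
  rw [eq_triExponent_iff]
  obtain ⟨h1, h2, h3⟩ := triExponent_apply e a b c
  rw [h1, h2, h3]

theorem not_isTrivial_quinticExponents (e : Fin 3 ≃ Fin (2 + 1)) :
    ¬ IsTrivial 5 (monomialIdeal k (quinticExponents e : Set (Fin (2 + 1) →₀ ℕ))) := by
  intro h
  obtain ⟨a, ha⟩ := exists_exponent_of_isTrivial (by omega)
    (fun m hm => degree_of_mem_quinticExponents hm) h
  obtain ⟨t0, t1, t2⟩ := triExponent_add_single e a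
  have h0 := ha (e 0)
  have h1 := ha (e 1)
  have h2 := ha (e 2)
  rw [t0] at h0
  rw [t1] at h1
  rw [t2] at h2
  simp only [mem_quinticExponents, triExponent_inj] at h0 h1 h2
  omega

theorem not_isTrivial_quarticExponents (e : Fin 3 ≃ Fin (2 + 1)) :
    ¬ IsTrivial 4 (monomialIdeal k (quarticExponents e : Set (Fin (2 + 1) →₀ ℕ))) := by
  intro h
  obtain ⟨a, ha⟩ := exists_exponent_of_isTrivial (by omega)
    (fun m hm => degree_of_mem_quarticExponents hm) h
  obtain ⟨t0, t1, t2⟩ := triExponent_add_single e a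
  have h0 := ha (e 0)
  have h1 := ha (e 1)
  have h2 := ha (e 2)
  rw [t0] at h0
  rw [t1] at h1
  rw [t2] at h2
  simp only [mem_quarticExponents, triExponent_inj] at h0 h1 h2
  omega

theorem triExponent_add (e : Fin 3 ≃ Fin (2 + 1)) (a b c a' b' c' : ℕ) :
    triExponent e a b c + triExponent e a' b' c' = triExponent e (a + a') (b + b') (c + c') := by
  rw [eq_triExponent_iff]
  obtain ⟨h1, h2, h3⟩ := triExponent_apply e a b c
  obtain ⟨h1', h2', h3'⟩ := triExponent_apply e a' b' c'
  simp only [Finsupp.add_apply, h1, h2, h3, h1', h2', h3', and_self]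

/-- The quintic system is smooth: its exponents are those of a truncated triangle, except for two
interior points, and the remaining interior points are midpoints of others. -/
theorem isSmoothSystem_quinticExponents [IsAlgClosed k] (e : Fin 3 ≃ Fin (2 + 1)) :
    IsSmoothSystem 5 (monomialIdeal k (quinticExponents e : Set (Fin (2 + 1) →₀ ℕ))) := by
  intro c hc hc0
  have hA : ∀ a, a ∈ inverseExponents 5
      (monomialIdeal k (quinticExponents e : Set (Fin (2 + 1) →₀ ℕ))) ↔
      a.degree = 5 ∧ a ∉ quinticExponents e :=
    fun a => mem_inverseExponents fun m hm => degree_of_mem_quinticExponents hm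
  have hT : ∀ x y z, triExponent e x y z ∈ inverseExponents 5
      (monomialIdeal k (quinticExponents e : Set (Fin (2 + 1) →₀ ℕ))) ↔
      x + y + z = 5 ∧ x ≤ 4 ∧ y ≤ 4 ∧ z ≤ 4 ∧ ¬ (x = 3 ∧ y = 1) ∧ ¬ (x = 1 ∧ y = 2) := by
    intro x y z
    rw [hA, degree_triExponent, mem_quinticExponents]
    simp only [triExponent_inj]
    omega
  have hsurj : ∀ a : Fin (2 + 1) →₀ ℕ, a = triExponent e (a (e 0)) (a (e 1)) (a (e 2)) :=
    fun a => (eq_triExponent_iff e).2 ⟨rfl, rfl, rfl⟩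
  have hle : ∀ a ∈ inverseExponents 5
      (monomialIdeal k (quinticExponents e : Set (Fin (2 + 1) →₀ ℕ))), ∀ i, a i ≤ 4 := by
    intro a ha i
    rw [hsurj a, hT] at ha
    obtain ⟨y, rfl⟩ := e.surjective i
    fin_cases y <;> simp <;> omega
  refine finrank_coneTangentSpace_of_truncated (d := 5) (p := fun _ => 4) (fun _ => by omega)
    (fun _ => by omega) (fun a ha => ((hA a).1 ha).1) hle ?_ ?_ hc hc0
  · intro i j l hij
    have hdeg := degree_cutNeighbor (d := 5) (p := 4) (by omega) (by omega) i j l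
    have hb := cutNeighbor_apply_le (d := 5) (p := fun _ => 4) (fun _ => by omega)
      (fun _ => by omega) (fun _ _ _ => by omega) hij l
    -- the two missing interior points have three nonzero coordinates at most three
    have hz : (∃ x, cutNeighbor 5 4 i j l x = 4) ∨ ∃ x, cutNeighbor 5 4 i j l x = 0 := by
      by_cases hlj : l = j
      · right
        obtain ⟨x, hxi, hxj⟩ : ∃ x : Fin (2 + 1), i ≠ x ∧ j ≠ x := by
          clear * -
          revert i j
          decide
        refine ⟨x, ?_⟩
        simp [cutNeighbor, hlj, hij.symm, Finsupp.single_eq_of_ne hxi.symm,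
          Finsupp.single_eq_of_ne hxj.symm]
      · left
        refine ⟨i, ?_⟩
        rw [cutNeighbor, cutVertex]
        split_ifs with hli
        · simp [Finsupp.single_eq_of_ne hij]
        · simp [Finsupp.single_eq_of_ne (Ne.symm hli)]
    generalize cutNeighbor 5 4 i j l = a at hdeg hb hz
    rw [degree_eq_add e] at hdeg
    rw [hsurj a, hT]
    have b0 := hb (e 0)
    have b1 := hb (e 1)
    have b2 := hb (e 2)
    have hz' : (a (e 0) = 4 ∨ a (e 1) = 4 ∨ a (e 2) = 4) ∨
        (a (e 0) = 0 ∨ a (e 1) = 0 ∨ a (e 2) = 0) := by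
      rcases hz with ⟨x, hx⟩ | ⟨x, hx⟩ <;> obtain ⟨y, rfl⟩ := e.surjective x <;>
        fin_cases y <;> simp at hx <;> simp [hx]
    omega
  · intro a ha hv
    have hdeg := ((hA a).1 ha).1
    -- an exponent with a coordinate equal to four is a vertex
    have h3 : ∀ i, a i ≤ 3 := by
      intro i
      have h4 := hle a ha i
      by_contra h
      obtain ⟨l, hl, hal⟩ := eq_single_add_single_of_apply hdeg (show a i = 4 by omega) rfl
      exact hv i l (Ne.symm hl) hal
    have h30 := h3 (e 0)
    have h31 := h3 (e 1)
    have h32 := h3 (e 2)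
    rw [hsurj a, hT] at ha
    rw [hsurj a]
    obtain ⟨hs, -, -, -, hn1, hn2⟩ := ha
    generalize a (e 0) = x at *
    generalize a (e 1) = y at *
    generalize a (e 2) = z at *
    suffices h : ∃ x₁ y₁ z₁ x₂ y₂ z₂ : ℕ,
        (x₁ + y₁ + z₁ = 5 ∧ x₁ ≤ 4 ∧ y₁ ≤ 4 ∧ z₁ ≤ 4 ∧ ¬ (x₁ = 3 ∧ y₁ = 1) ∧ ¬ (x₁ = 1 ∧ y₁ = 2)) ∧
        (x₂ + y₂ + z₂ = 5 ∧ x₂ ≤ 4 ∧ y₂ ≤ 4 ∧ z₂ ≤ 4 ∧ ¬ (x₂ = 3 ∧ y₂ = 1) ∧ ¬ (x₂ = 1 ∧ y₂ = 2)) ∧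
        ¬ (x₁ = x ∧ y₁ = y ∧ z₁ = z) ∧ x₁ + x₂ = x + x ∧ y₁ + y₂ = y + y ∧ z₁ + z₂ = z + z by
      obtain ⟨x₁, y₁, z₁, x₂, y₂, z₂, g1, g2, g3, g4, g5, g6⟩ := h
      refine ⟨triExponent e x₁ y₁ z₁, (hT _ _ _).2 g1,
        triExponent e x₂ y₂ z₂, (hT _ _ _).2 g2, ?_, ?_⟩
      · rwa [Ne, triExponent_inj]
      · rw [triExponent_add, triExponent_add, g4, g5, g6]
    by_cases hz : z = 0
    · exact ⟨x + 1, y - 1, z, x - 1, y + 1, z, by omega⟩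
    by_cases hy : y = 0
    · exact ⟨x + 1, y, z - 1, x - 1, y, z + 1, by omega⟩
    by_cases hx : x = 2 ∨ x = 0
    · exact ⟨x, y + 1, z - 1, x, y - 1, z + 1, by omega⟩
    by_cases hy1 : y = 1
    · exact ⟨x + 1, y, z - 1, x - 1, y, z + 1, by omega⟩
    · exact ⟨x + 1, y - 1, z, x - 1, y + 1, z, by omega⟩

/-! ### A singular point of the quartic toric surface -/

/-- If no other combination of the exponents in `A` has the same sum, then the monomial with
exponent `m` does not occur in the equations of the toric variety. -/
theorem coeff_eq_zero_of_mem_toricIdeal [Infinite k] {A : Finset (Fin (n + 1) →₀ ℕ)}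
    {f : MvPolynomial A k} (hf : f ∈ toricIdeal k A) {m : A →₀ ℕ}
    (hm : ∀ m' : A →₀ ℕ, ∑ a, m' a • (a : Fin (n + 1) →₀ ℕ) =
      ∑ a, m a • (a : Fin (n + 1) →₀ ℕ) → m' = m) :
    coeff m f = 0 := by
  classical
  have h1 : aeval (fun a : A => (monomial (a : Fin (n + 1) →₀ ℕ) (1 : k) : PolyRing k n)) f =
      0 := by
    refine MvPolynomial.funext fun s => ?_
    rw [map_zero, ← mem_toricIdeal.1 hf s, ← MvPolynomial.coe_aeval_eq_eval]
    refine (MvPolynomial.comp_aeval_apply _ (aeval s) f).trans ?_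
    congr 2
    funext a
    simp [aeval_monomial, monomialValue, Finsupp.prod_fintype]
  have h2 : ∀ m' : A →₀ ℕ,
      ∏ a : A, (monomial (a : Fin (n + 1) →₀ ℕ) (1 : k) : PolyRing k n) ^ m' a =
      monomial (∑ a, m' a • (a : Fin (n + 1) →₀ ℕ)) 1 := by
    intro m'
    rw [monomial_sum_one]
    simp [monomial_pow]
  have h3 := congrArg (coeff (∑ a, m a • (a : Fin (n + 1) →₀ ℕ))) h1
  rw [aeval_def, eval₂_eq', coeff_sum, coeff_zero] at h3
  simp only [h2, algebraMap_eq, coeff_C_mul, coeff_monomial] at h3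
  rw [Finset.sum_eq_single m] at h3
  · simpa using h3
  · intro m' _ hne
    rw [if_neg fun h => hne (hm m' h), mul_zero]
  · intro h
    rw [notMem_support_iff.1 h, zero_mul]

/-- If the combinations of `v` and `w` that contain `w` at most once are determined by their sum,
then the coordinate point of `v` lies on the toric variety, with the coordinate vector of `w` as a
tangent vector: only the corresponding monomials survive at this point over the dual numbers. -/
theorem aeval_dualPoint_single_eq_zero [Infinite k] {A : Finset (Fin (n + 1) →₀ ℕ)} {v w : A}
    (h : ∀ m : A →₀ ℕ, (∀ a, a ≠ v → a ≠ w → m a = 0) → (w ≠ v → m w ≤ 1) →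
      ∀ m' : A →₀ ℕ, ∑ a, m' a • (a : Fin (n + 1) →₀ ℕ) =
        ∑ a, m a • (a : Fin (n + 1) →₀ ℕ) → m' = m)
    [DecidableEq A] {f : MvPolynomial A k} (hf : f ∈ toricIdeal k A) :
    aeval (dualPoint (Pi.single v 1) (Pi.single w (1 : k))) f = 0 := by
  rw [aeval_def, eval₂_eq']
  refine Finset.sum_eq_zero fun m _ => ?_
  by_cases h1 : ∀ a, a ≠ v → a ≠ w → m a = 0
  · by_cases h2 : w ≠ v → m w ≤ 1
    · rw [coeff_eq_zero_of_mem_toricIdeal hf (h m h1 h2), map_zero, zero_mul]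
    · push Not at h2
      have h3 : dualPoint (Pi.single v 1) (Pi.single w (1 : k)) w ^ 2 = 0 := by
        rw [pow_two]
        apply TrivSqZeroExt.ext <;> simp [Pi.single_eq_of_ne h2.1]
      have h4 : dualPoint (Pi.single v 1) (Pi.single w (1 : k)) w ^ m w = 0 :=
        pow_eq_zero_of_le h2.2 h3
      rw [Finset.prod_eq_zero (Finset.mem_univ w) h4, mul_zero]
  · push Not at h1
    obtain ⟨a, hav, haw, ha⟩ := h1
    have h3 : dualPoint (Pi.single v 1) (Pi.single w (1 : k)) a = 0 := by
      apply TrivSqZeroExt.ext <;> simp [Pi.single_eq_of_ne hav, Pi.single_eq_of_ne haw]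
    rw [Finset.prod_eq_zero (Finset.mem_univ a) (by rw [h3, zero_pow ha]), mul_zero]

/-- The quartic system is not smooth: at the vertex `x_0 ^ 3 x_1` there are the neighbors
`x_0 ^ 3 x_2` and `x_0 x_1 ^ 3` on the two edges, but `x_0 ^ 2 x_1 x_2` is not generated by them
relative to the vertex, since `x_0 ^ 2 x_1 ^ 2` is missing. Hence the tangent space to the cone at
the vertex has dimension at least four. -/
theorem not_isSmoothSystem_quarticExponents [CharZero k] (e : Fin 3 ≃ Fin (2 + 1)) :
    ¬ IsSmoothSystem 4 (monomialIdeal k (quarticExponents e : Set (Fin (2 + 1) →₀ ℕ))) := by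
  classical
  intro hsmooth
  unfold IsSmoothSystem at hsmooth
  have hA : ∀ a, a ∈ inverseExponents 4
      (monomialIdeal k (quarticExponents e : Set (Fin (2 + 1) →₀ ℕ))) ↔
      a.degree = 4 ∧ a ∉ quarticExponents e :=
    fun a => mem_inverseExponents fun m hm => degree_of_mem_quarticExponents hm
  have hT : ∀ x y z, triExponent e x y z ∈ inverseExponents 4
      (monomialIdeal k (quarticExponents e : Set (Fin (2 + 1) →₀ ℕ))) ↔
      x + y + z = 4 ∧ x ≤ 3 ∧ y ≤ 3 ∧ z ≤ 3 ∧ ¬ (x = 1 ∧ y = 1) ∧ ¬ (x = 2 ∧ y = 2) := by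
    intro x y z
    rw [hA, degree_triExponent, mem_quarticExponents]
    simp only [triExponent_inj]
    omega
  generalize inverseExponents 4
      (monomialIdeal k (quarticExponents e : Set (Fin (2 + 1) →₀ ℕ))) = A at hsmooth hT
  have hsurj : ∀ a : Fin (2 + 1) →₀ ℕ, a = triExponent e (a (e 0)) (a (e 1)) (a (e 2)) :=
    fun a => (eq_triExponent_iff e).2 ⟨rfl, rfl, rfl⟩
  obtain ⟨v, hv⟩ : ∃ v : A, (v : Fin (2 + 1) →₀ ℕ) = triExponent e 3 1 0 :=
    ⟨⟨_, (hT _ _ _).2 (by omega)⟩, rfl⟩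
  obtain ⟨u, hu⟩ : ∃ u : A, (u : Fin (2 + 1) →₀ ℕ) = triExponent e 3 0 1 :=
    ⟨⟨_, (hT _ _ _).2 (by omega)⟩, rfl⟩
  obtain ⟨q, hq⟩ : ∃ q : A, (q : Fin (2 + 1) →₀ ℕ) = triExponent e 1 3 0 :=
    ⟨⟨_, (hT _ _ _).2 (by omega)⟩, rfl⟩
  obtain ⟨r, hr⟩ : ∃ r : A, (r : Fin (2 + 1) →₀ ℕ) = triExponent e 2 1 1 :=
    ⟨⟨_, (hT _ _ _).2 (by omega)⟩, rfl⟩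
  obtain ⟨v0, v1, v2⟩ := (eq_triExponent_iff e).1 hv
  obtain ⟨u0, u1, u2⟩ := (eq_triExponent_iff e).1 hu
  obtain ⟨q0, q1, q2⟩ := (eq_triExponent_iff e).1 hq
  obtain ⟨r0, r1, r2⟩ := (eq_triExponent_iff e).1 hr
  have hvu : v ≠ u := fun h => by
    rw [h, u1] at v1
    omega
  have hvq : v ≠ q := fun h => by
    rw [h, q0] at v0
    omega
  have hvr : v ≠ r := fun h => by
    rw [h, r0] at v0
    omega
  have huq : u ≠ q := fun h => by
    rw [h, q0] at u0
    omega
  have hur : u ≠ r := fun h => by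
    rw [h, r0] at u0
    omega
  have hqr : q ≠ r := fun h => by
    rw [h, r0] at q0
    omega
  have hsum : ∀ (m : A →₀ ℕ) (g : A → ℕ), (∀ a, a ≠ v → a ≠ u → a ≠ q → a ≠ r → m a = 0) →
      ∑ a, m a * g a = m v * g v + m u * g u + m q * g q + m r * g r := by
    intro m g hm
    rw [← Finset.sum_subset (Finset.subset_univ {v, u, q, r})]
    · rw [Finset.sum_insert (by simp [hvu, hvq, hvr]), Finset.sum_insert (by simp [huq, hur]),
        Finset.sum_pair hqr]
      ring
    · intro a _ ha
      simp only [Finset.mem_insert, Finset.mem_singleton, not_or] at ha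
      rw [hm a ha.1 ha.2.1 ha.2.2.1 ha.2.2.2, zero_mul]
  -- the combinations used below are determined by the sum of the exponents: the functionals
  -- `a ↦ a 2` and `a ↦ 3 - a 0` are nonnegative and vanish at the vertex
  have hrigid : ∀ m : A →₀ ℕ, (∀ a, a ≠ v → a ≠ u → a ≠ q → a ≠ r → m a = 0) →
      ((m q = 0 ∧ m r = 0) ∨ (m u = 0 ∧ m r = 0) ∨ (m u = 0 ∧ m q = 0 ∧ m r ≤ 1)) →
      ∀ m' : A →₀ ℕ, ∑ a, m' a • (a : Fin (2 + 1) →₀ ℕ) =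
        ∑ a, m a • (a : Fin (2 + 1) →₀ ℕ) → m' = m := by
    intro m hm hcase m' hmm
    have hco : ∀ i, ∑ a, m' a * (a : Fin (2 + 1) →₀ ℕ) i = ∑ a, m a * (a : Fin (2 + 1) →₀ ℕ) i := by
      intro i
      have := congrArg (fun x : Fin (2 + 1) →₀ ℕ => x i) hmm
      simpa [Finsupp.finsetSum_apply] using this
    have hβ : ∑ a, m' a * (3 - (a : Fin (2 + 1) →₀ ℕ) (e 0)) =
        ∑ a, m a * (3 - (a : Fin (2 + 1) →₀ ℕ) (e 0)) := by
      have hexp : ∀ l : A →₀ ℕ, 3 * (∑ a, l a * (a : Fin (2 + 1) →₀ ℕ) (e 1)) +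
          3 * (∑ a, l a * (a : Fin (2 + 1) →₀ ℕ) (e 2)) =
          (∑ a, l a * (a : Fin (2 + 1) →₀ ℕ) (e 0)) +
          4 * ∑ a, l a * (3 - (a : Fin (2 + 1) →₀ ℕ) (e 0)) := by
        intro l
        simp only [Finset.mul_sum, ← Finset.sum_add_distrib]
        refine Finset.sum_congr rfl fun a _ => ?_
        have ha := a.2
        rw [hsurj a, hT] at ha
        have h1 : 3 * (a : Fin (2 + 1) →₀ ℕ) (e 1) + 3 * (a : Fin (2 + 1) →₀ ℕ) (e 2) =
            (a : Fin (2 + 1) →₀ ℕ) (e 0) + 4 * (3 - (a : Fin (2 + 1) →₀ ℕ) (e 0)) := by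
          omega
        calc _ = l a * (3 * (a : Fin (2 + 1) →₀ ℕ) (e 1) + 3 * (a : Fin (2 + 1) →₀ ℕ) (e 2)) := by
              ring
          _ = _ := by rw [h1]; ring
      have h1 := hexp m
      have h2 := hexp m'
      rw [hco, hco, hco] at h2
      omega
    have e0 := hco (e 0)
    have e1 := hco (e 1)
    have e2 := hco (e 2)
    have sβ := hsum m (fun a => 3 - (a : Fin (2 + 1) →₀ ℕ) (e 0)) hm
    have s2 := hsum m (fun a => (a : Fin (2 + 1) →₀ ℕ) (e 2)) hm
    simp only [v0, u0, q0, r0, v2, u2, q2, r2] at sβ s2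
    have hm' : ∀ a, a ≠ v → a ≠ u → a ≠ q → a ≠ r → m' a = 0 := by
      intro a hav hau haq har
      by_contra h0
      have ha := a.2
      rw [hsurj a, hT] at ha
      have hl2 : (a : Fin (2 + 1) →₀ ℕ) (e 2) ≤ ∑ a, m' a * (a : Fin (2 + 1) →₀ ℕ) (e 2) :=
        (Nat.le_mul_of_pos_left _ (Nat.pos_of_ne_zero h0)).trans
          (Finset.single_le_sum (f := fun a : A => m' a * (a : Fin (2 + 1) →₀ ℕ) (e 2))
            (fun _ _ => Nat.zero_le _) (Finset.mem_univ a))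
      have hlβ : 3 - (a : Fin (2 + 1) →₀ ℕ) (e 0) ≤
          ∑ a, m' a * (3 - (a : Fin (2 + 1) →₀ ℕ) (e 0)) :=
        (Nat.le_mul_of_pos_left _ (Nat.pos_of_ne_zero h0)).trans
          (Finset.single_le_sum (f := fun a : A => m' a * (3 - (a : Fin (2 + 1) →₀ ℕ) (e 0)))
            (fun _ _ => Nat.zero_le _) (Finset.mem_univ a))
      rw [e2, s2] at hl2
      rw [hβ, sβ] at hlβ
      have hne : ∀ (b : A) {x y z}, (b : Fin (2 + 1) →₀ ℕ) = triExponent e x y z → a ≠ b →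
          ¬ ((a : Fin (2 + 1) →₀ ℕ) (e 0) = x ∧ (a : Fin (2 + 1) →₀ ℕ) (e 1) = y ∧
            (a : Fin (2 + 1) →₀ ℕ) (e 2) = z) := fun b x y z hb hne h =>
        hne (Subtype.ext (((eq_triExponent_iff e).2 h).trans hb.symm))
      have g1 := hne v hv hav
      have g2 := hne u hu hau
      have g3 := hne q hq haq
      have g4 := hne r hr har
      have hsmall : 3 - (a : Fin (2 + 1) →₀ ℕ) (e 0) = 0 ∨ (a : Fin (2 + 1) →₀ ℕ) (e 2) = 0 ∨
          (3 - (a : Fin (2 + 1) →₀ ℕ) (e 0) ≤ 1 ∧ (a : Fin (2 + 1) →₀ ℕ) (e 2) ≤ 1) := by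
        rcases hcase with h | h | h
        · left
          omega
        · right; left
          omega
        · right; right
          omega
      clear hl2 hlβ hcase
      generalize (a : Fin (2 + 1) →₀ ℕ) (e 0) = x at *
      generalize (a : Fin (2 + 1) →₀ ℕ) (e 1) = y at *
      generalize (a : Fin (2 + 1) →₀ ℕ) (e 2) = z at *
      rcases hsmall with h | h | h <;> omega
    rw [hsum m' _ hm', hsum m _ hm] at e0 e1 e2
    simp only [v0, u0, q0, r0, v1, u1, q1, r1, v2, u2, q2, r2] at e0 e1 e2
    have hfin : m' v = m v ∧ m' u = m u ∧ m' q = m q ∧ m' r = m r := by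
      clear hsum hco hβ hm' hm sβ s2
      omega
    ext a
    by_cases hav : a = v
    · rw [hav, hfin.1]
    by_cases hau : a = u
    · rw [hau, hfin.2.1]
    by_cases haq : a = q
    · rw [haq, hfin.2.2.1]
    by_cases har : a = r
    · rw [har, hfin.2.2.2]
    rw [hm a hav hau haq har, hm' a hav hau haq har]
  let w : Fin 4 → A := ![v, u, q, r]
  have hw : Function.Injective w := by
    intro i j hij
    clear * - hij hvu hvq hvr huq hur hqr
    fin_cases i <;> fin_cases j <;>
      first
        | rfl
        | exact absurd hij ‹_›
        | exact absurd hij.symm ‹_›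
  have hzero : ∀ i, ∀ f ∈ toricIdeal k A,
      aeval (dualPoint (Pi.single v 1) (Pi.single (w i) (1 : k))) f = 0 := by
    intro i f hf
    refine aeval_dualPoint_single_eq_zero (fun m h1 h2 => hrigid m ?_ ?_) hf
    · intro a hav hau haq har
      refine h1 a hav ?_
      fin_cases i <;> assumption
    · fin_cases i
      · exact Or.inl ⟨h1 _ hvq.symm hvq.symm, h1 _ hvr.symm hvr.symm⟩
      · exact Or.inl ⟨h1 _ hvq.symm huq.symm, h1 _ hvr.symm hur.symm⟩
      · exact Or.inr (Or.inl ⟨h1 _ hvu.symm huq, h1 _ hvr.symm hqr.symm⟩)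
      · exact Or.inr (Or.inr ⟨h1 _ hvu.symm hur, h1 _ hvq.symm hqr, h2 hvr.symm⟩)
  have hc : (Pi.single v 1 : A → k) ∈ zeroLocus k (toricIdeal k A) := by
    intro f hf
    have h1 := (aeval_dualPoint (Pi.single v 1) (Pi.single (w 0) (1 : k)) f).1
    rw [hzero 0 f hf] at h1
    rw [MvPolynomial.aeval_eq_eval]
    exact h1.symm
  have hmem : ∀ i, (Pi.single (w i) 1 : A → k) ∈ coneTangentSpace k A (Pi.single v 1) := by
    intro i
    rw [mem_coneTangentSpace_iff]
    intro f hf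
    rw [hzero i f hf]
    rfl
  have hli : LinearIndependent k
      (fun i => (⟨Pi.single (w i) 1, hmem i⟩ : coneTangentSpace k A (Pi.single v 1))) := by
    refine LinearIndependent.of_comp (Submodule.subtype _) ?_
    have := (Pi.basisFun k A).linearIndependent.comp w hw
    convert this using 1
    funext i
    simp
  have hrank := hli.fintype_card_le_finrank
  rw [hsmooth _ hc (by simp)] at hrank
  simp at hrank

end Togliatti

theorem theorem3p6 (k : Type*) [Field k] [IsAlgClosed k] [CharZero k] :
    (∀ n d : ℕ, 2 ≤ n → 4 ≤ d →
      IsLeast (Togliatti.numGens '' Togliatti.minimalSystems k n d) (2 * n + 1) ∧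
      IsLeast (Togliatti.numGens '' Togliatti.minimalSmoothSystems k n d) (2 * n + 1) ∧
      ∀ I ∈ Togliatti.minimalSystems k n d, Togliatti.numGens I = 2 * n + 1 →
        ¬ Togliatti.IsTrivial d I →
          (n = 2 ∧ d = 5 ∧ Togliatti.IsPermutationOf (Togliatti.quinticSystem k) I) ∨
          (n = 2 ∧ d = 4 ∧ Togliatti.IsPermutationOf (Togliatti.quarticSystem k) I)) ∧
    (∀ I : Ideal (Togliatti.PolyRing k 2),
      Togliatti.IsPermutationOf (Togliatti.quinticSystem k) I →
        I ∈ Togliatti.minimalSystems k 2 5 ∧ Togliatti.numGens I = 5 ∧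
        ¬ Togliatti.IsTrivial 5 I ∧ Togliatti.IsSmoothSystem 5 I) ∧
    (∀ I : Ideal (Togliatti.PolyRing k 2),
      Togliatti.IsPermutationOf (Togliatti.quarticSystem k) I →
        I ∈ Togliatti.minimalSystems k 2 4 ∧ Togliatti.numGens I = 5 ∧
        ¬ Togliatti.IsTrivial 4 I ∧ ¬ Togliatti.IsSmoothSystem 4 I) := by
  open Togliatti in
  have hlow : ∀ n d : ℕ, 2 ≤ n → 4 ≤ d → ∀ I ∈ minimalSystems k n d, 2 * n + 1 ≤ numGens I := by
    rintro n d hn hd I ⟨⟨hI, -⟩, M, hM, rfl, -⟩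
    rw [numGens_monomialIdeal hM]
    exact two_mul_add_one_le_card hn hd hM hI
  refine ⟨fun n d hn hd => ⟨⟨?_, ?_⟩, ⟨?_, ?_⟩, ?_⟩, ?_, ?_⟩
  · exact ⟨_, trivialExponents_mem_minimalSystems hn hd⟩
  · rintro _ ⟨I, hI, rfl⟩
    exact hlow n d hn hd I hI
  · obtain ⟨h1, h2⟩ := trivialExponents_mem_minimalSystems (k := k) hn hd
    exact ⟨_, ⟨h1, isSmoothSystem_trivialExponents hd⟩, h2⟩
  · rintro _ ⟨I, hI, rfl⟩
    exact hlow n d hn hd I hI.1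
  · rintro I ⟨⟨hI, -⟩, M, hM, rfl, -⟩ hgens htriv
    rw [numGens_monomialIdeal hM] at hgens
    exact (isTrivial_or_isPermutationOf hn hd hM hI hgens).resolve_left htriv
  · rintro I ⟨e, rfl⟩
    rw [map_quinticSystem]
    obtain ⟨h1, h2⟩ := quinticExponents_mem_minimalSystems (k := k) e
    exact ⟨h1, h2, not_isTrivial_quinticExponents e, isSmoothSystem_quinticExponents e⟩
  · rintro I ⟨e, rfl⟩
    rw [map_quarticSystem]
    obtain ⟨h1, h2⟩ := quarticExponents_mem_minimalSystems (k := k) e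
    exact ⟨h1, h2, not_isTrivial_quarticExponents e, not_isSmoothSystem_quarticExponents e⟩
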